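/- Let $a^{j,m,p,n}_{k,l}\in\mathbb R$ ($1\le j,k,l,m,n,p\le 3$) be given, let $\nu>0$, and for vector fields $u,v$ on $\mathbb R^3$ put $$Q^j(u,v)=\sum_{k,l,m=1}^3 q^{j,m}_{k,l}\bigl(\partial_m(u^kv^l)\bigr),\qquad q^{j,m}_{k,l}(b)=\sum_{n,p=1}^3a^{j,m,p,n}_{k,l}\,\mathcal F^{-1}\Bigl(\frac{\xi_n\xi_p}{|\xi|^2}\,\widehat b(\xi)\Bigr),\qquad j=1,2,3.$$ Consider the generalized Navier--Stokes system $$\partial_tu-\nu\Delta u=Q(u,u)\quad(t>0,\ x\in\mathbb R^3),\qquad u(\cdot,0)=u_0.\tag{$GNS_\nu$}$$ For $i\in\{-1,0,1\}$ let $\chi^i$ be the space of tempered distributions $f$ on $\mathbb R^3$ (with values in $\mathbb C^3$) whose Fourier transform is a locally integrable function with $\|f\|_{\chi^i}=\int_{\mathbb R^3}|\xi|^i|\widehat f(\xi)|\,d\xi<\infty$. A mild solution on $[0,T]$ is a $u\in L^2([0,T];\chi^0)$ with $$u(t)=e^{\nu t\Delta}u_0+\int_0^te^{\nu(t-s)\Delta}Q(u(s),u(s))\,ds\qquad\text{for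 almost every }t\in[0,T];$$ functions of time that agree almost everywhere are identified. **Theorem.** Let $u_0\in\chi^{-1}$. There is a $T>0$ such that $(GNS_\nu)$ has a unique mild solution $u$ in $L^2([0,T];\chi^0)$. This solution also belongs to $$C([0,T];\chi^{-1})\cap L^1([0,T];\chi^1)\cap L^\infty([0,T];\chi^{-1}),\qquad\text{and } u(0)=u_0.$$ Let $T_{u_0}\in(0,\infty]$ be the maximal time of existence of such a solution, that is, the supremum of the $T>0$ for which there is one on $[0,T]$. There is a function $u$ on $[0,T_{u_0})$ which is such a solution on $[0,T]$ for every $0<T<T_{u_0}$; for every $T>0$, every mild solution on $[0,T]$ agrees with $u$ almost everywhere; and $u$ is real valued if $u_0$ is. Moreover: (i) There is a constant $C>0$, depending only on the coefficients $a^{j,m,p,n}_{k,l}$ (not on $\nu$ or $u_0$), such that $\|u_0\|_{\chi^{-1}}\le C\nu$ implies $T_{u_0}=\infty$. (ii) If $T_{u_0}<\infty$, then $\displaystyle\int_0^{T_{u_0}}\|u(t)\|_{\chi^0}^2\,dt=\infty$. -/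

import Mathlib

open MeasureTheory Set
open scoped SchwartzMap FourierTransform LineDeriv ENNReal

noncomputable section

namespace GNS

/-- Physical space `ℝ³`. -/
abbrev R3 := EuclideanSpace ℝ (Fin 3)

/-- Values of vector fields. Fields may be complex valued; see `IsRealField` for real ones. -/
abbrev C3 := EuclideanSpace ℂ (Fin 3)

section Spaces

variable {F : Type*} [NormedAddCommGroup F] [NormedSpace ℂ F]

/-- The tempered distribution `T` is (given by integration against) the function `g`. -/
def Represents (T : 𝓢'(R3, F)) (g : R3 → F) : Prop :=
  LocallyIntegrable g ∧ (∀ φ : 𝓢(R3, ℂ), Integrable fun x => φ x • g x) ∧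
    ∀ φ : 𝓢(R3, ℂ), T φ = ∫ x, φ x • g x

/-- `∫ |ξ|^i |f̂(ξ)| dξ`, which is `∞` if `f̂` is not a function. (The function representing `f̂` is
unique almost everywhere, so the infimum is over equal numbers: `chiENorm_eq`.) -/
def chiENorm (i : ℤ) (f : 𝓢'(R3, F)) : ℝ≥0∞ :=
  ⨅ (g : R3 → F) (_ : Represents (𝓕 f) g), ∫⁻ ξ, ENNReal.ofReal (‖ξ‖ ^ i) * ‖g ξ‖ₑ

theorem Represents.ae_eq [CompleteSpace F] {T : 𝓢'(R3, F)} {g h : R3 → F}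
    (hg : Represents T g) (hh : Represents T h) : g =ᵐ[volume] h := by
  refine ae_eq_of_integral_contDiff_smul_eq hg.1 hh.1 fun φ φ_smooth φ_cpt => ?_
  have h₁ : HasCompactSupport (Complex.ofRealCLM ∘ φ) := φ_cpt.comp_left rfl
  have h₂ : ContDiff ℝ (⊤ : ℕ∞) (Complex.ofRealCLM ∘ φ) := by fun_prop
  have := (hg.2.2 (h₁.toSchwartzMap h₂)).symm.trans (hh.2.2 (h₁.toSchwartzMap h₂))
  simpa using this

theorem Represents.zero : Represents (0 : 𝓢'(R3, F)) 0 :=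
  ⟨locallyIntegrable_zero, fun φ => by simp, fun φ => by simp⟩

theorem Represents.add {T S : 𝓢'(R3, F)} {g h : R3 → F}
    (hg : Represents T g) (hh : Represents S h) : Represents (T + S) (g + h) := by
  refine ⟨hg.1.add hh.1, fun φ => ?_, fun φ => ?_⟩
  · simp only [Pi.add_apply, smul_add]
    exact (hg.2.1 φ).add (hh.2.1 φ)
  · have := integral_add (hg.2.1 φ) (hh.2.1 φ)
    simp only [Pi.add_apply, smul_add]
    rw [this, ← hg.2.2, ← hh.2.2]
    rfl

theorem Represents.smul (c : ℂ) {T : 𝓢'(R3, F)} {g : R3 → F}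
    (hg : Represents T g) : Represents (c • T) (c • g) := by
  refine ⟨hg.1.smul c, fun φ => ?_, fun φ => ?_⟩
  · simp only [Pi.smul_apply, smul_comm _ c]
    exact (hg.2.1 φ).smul c
  · simp only [Pi.smul_apply, smul_comm _ c]
    rw [integral_smul, ← hg.2.2]
    rfl

theorem chiENorm_eq [CompleteSpace F] (i : ℤ) {f : 𝓢'(R3, F)} {g : R3 → F}
    (hg : Represents (𝓕 f) g) :
    chiENorm i f = ∫⁻ ξ, ENNReal.ofReal (‖ξ‖ ^ i) * ‖g ξ‖ₑ := by
  refine le_antisymm (iInf₂_le g hg) (le_iInf₂ fun h hh => le_of_eq (lintegral_congr_ae ?_))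
  filter_upwards [hg.ae_eq hh] with ξ hξ
  rw [hξ]

theorem exists_represents {i : ℤ} {f : 𝓢'(R3, F)} (hf : chiENorm i f < ∞) :
    ∃ g, Represents (𝓕 f) g := by
  by_contra! h
  simp [chiENorm, h] at hf

variable [CompleteSpace F]

theorem chiENorm_add_le (i : ℤ) (f g : 𝓢'(R3, F)) :
    chiENorm i (f + g) ≤ chiENorm i f + chiENorm i g := by
  rcases eq_or_ne (chiENorm i f) ∞ with hf | hf
  · simp [hf]
  rcases eq_or_ne (chiENorm i g) ∞ with hg | hg
  · simp [hg]
  obtain ⟨a, ha⟩ := exists_represents hf.lt_top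
  obtain ⟨b, hb⟩ := exists_represents hg.lt_top
  have hab : Represents (𝓕 (f + g)) (a + b) := by
    rw [FourierTransform.fourier_add]; exact ha.add hb
  rw [chiENorm_eq i ha, chiENorm_eq i hb, chiENorm_eq i hab, ← lintegral_add_left']
  · refine lintegral_mono fun ξ => ?_
    rw [← mul_add]
    gcongr
    exact enorm_add_le _ _
  · refine AEMeasurable.mul ?_ ha.1.aestronglyMeasurable.enorm
    exact (Measurable.ennreal_ofReal (by fun_prop)).aemeasurable

theorem chiENorm_smul (i : ℤ) (c : ℂ) {f : 𝓢'(R3, F)} (hf : chiENorm i f < ∞) :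
    chiENorm i (c • f) = ‖c‖ₑ * chiENorm i f := by
  obtain ⟨a, ha⟩ := exists_represents hf
  have hca : Represents (𝓕 (c • f)) (c • a) := by
    rw [FourierTransform.fourier_smul]; exact ha.smul c
  rw [chiENorm_eq i ha, chiENorm_eq i hca, ← lintegral_const_mul' _ _ enorm_ne_top]
  refine lintegral_congr fun ξ => ?_
  simp only [Pi.smul_apply, enorm_smul]
  ring

theorem chiENorm_zero (i : ℤ) : chiENorm i (0 : 𝓢'(R3, F)) = 0 := by
  have h : Represents (𝓕 (0 : 𝓢'(R3, F))) 0 := by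
    rw [FourierTransform.fourier_zero]; exact Represents.zero
  simp [chiENorm_eq i h]

theorem eq_zero_of_chiENorm {i : ℤ} {f : 𝓢'(R3, F)} (hf : chiENorm i f = 0) : f = 0 := by
  obtain ⟨a, ha⟩ := exists_represents (i := i) (f := f) (by simp [hf])
  rw [chiENorm_eq i ha, lintegral_eq_zero_iff'] at hf
  · have ha0 : a =ᵐ[volume] 0 := by
      have h0 : ∀ᵐ ξ : R3, ξ ≠ 0 := by simp [ae_iff]
      filter_upwards [hf, h0] with ξ h1 h2
      have : 0 < ‖ξ‖ ^ i := zpow_pos (norm_pos_iff.2 h2) i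
      have h3 : ¬ ‖ξ‖ ^ i ≤ 0 := not_le.2 this
      simpa [h3] using h1
    have hF : 𝓕 f = 0 := by
      ext φ
      rw [ha.2.2 φ]
      refine (integral_eq_zero_of_ae ?_)
      filter_upwards [ha0] with ξ h
      simp [h]
    have := congrArg (fun T => 𝓕⁻ T) hF
    simpa [FourierTransform.fourierInv_zero] using this
  · refine AEMeasurable.mul ?_ ha.1.aestronglyMeasurable.enorm
    exact (Measurable.ennreal_ofReal (by fun_prop)).aemeasurable

variable (F) in
/-- `χ^i` as a linear subspace of the tempered distributions. -/
def chiSubmodule (i : ℤ) : Submodule ℂ 𝓢'(R3, F) where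
  carrier := {f | chiENorm i f < ∞}
  zero_mem' := by simp [chiENorm_zero]
  add_mem' := fun {f g} hf hg =>
    (chiENorm_add_le i f g).trans_lt (ENNReal.add_lt_top.2 ⟨hf, hg⟩)
  smul_mem' := fun c f hf => by
    simp only [mem_ofPred_eq] at hf ⊢
    rw [chiENorm_smul i c hf]
    exact ENNReal.mul_lt_top enorm_lt_top hf

variable (F) in
/-- The space `χ^i = {f ∈ 𝓢' : ∫ |ξ|^i |f̂(ξ)| dξ < ∞}`. It is not an `abbrev`: its topology is that
of the norm below and not that of `𝓢'`. -/
def Chi (i : ℤ) : Type _ := chiSubmodule F i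

/-- The underlying tempered distribution. -/
def Chi.toDist {i : ℤ} (f : Chi F i) : 𝓢'(R3, F) := Subtype.val f

instance (i : ℤ) : AddCommGroup (Chi F i) := inferInstanceAs (AddCommGroup (chiSubmodule F i))

instance (i : ℤ) : Module ℂ (Chi F i) := inferInstanceAs (Module ℂ (chiSubmodule F i))

instance (i : ℤ) : Norm (Chi F i) := ⟨fun f => (chiENorm i f.toDist).toReal⟩

theorem Chi.core (i : ℤ) : NormedSpace.Core ℂ (Chi F i) where
  norm_nonneg _ := ENNReal.toReal_nonneg
  norm_smul c f := by
    have h := congrArg ENNReal.toReal (chiENorm_smul i c (f := f.toDist) f.2)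
    rw [ENNReal.toReal_mul, toReal_enorm] at h
    exact h
  norm_triangle f g := by
    have hf : chiENorm i f.toDist ≠ ∞ := f.2.ne
    have hg : chiENorm i g.toDist ≠ ∞ := g.2.ne
    have h := ENNReal.toReal_mono (ENNReal.add_ne_top.2 ⟨hf, hg⟩)
      (chiENorm_add_le i f.toDist g.toDist)
    rw [ENNReal.toReal_add hf hg] at h
    exact h
  norm_eq_zero_iff f := by
    constructor
    · intro h
      rcases (ENNReal.toReal_eq_zero_iff _).1 h with h | h
      · exact Subtype.ext (eq_zero_of_chiENorm h)
      · exact absurd h f.2.ne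
    · rintro rfl
      change (chiENorm i (0 : 𝓢'(R3, F))).toReal = 0
      simp [chiENorm_zero]

instance (i : ℤ) : NormedAddCommGroup (Chi F i) := NormedAddCommGroup.ofCore (Chi.core i)

instance (i : ℤ) : NormedSpace ℂ (Chi F i) := NormedSpace.ofCore (Chi.core i)

/-- `u ∈ L^p([0,T]; χ^i)` in the sense of Bochner. -/
def MemLpChi (p : ℝ≥0∞) (i : ℤ) (T : ℝ) (u : ℝ → 𝓢'(R3, F)) : Prop :=
  ∃ v : ℝ → Chi F i, MemLp v p (volume.restrict (Icc 0 T)) ∧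
    ∀ᵐ t ∂volume.restrict (Icc 0 T), (v t).toDist = u t

/-- `u ∈ C([0,T]; χ^i)`. -/
def ContinuousChi (i : ℤ) (T : ℝ) (u : ℝ → 𝓢'(R3, F)) : Prop :=
  ∃ v : ℝ → Chi F i, ContinuousOn v (Icc 0 T) ∧ ∀ t ∈ Icc 0 T, (v t).toDist = u t

end Spaces

section Operators

variable {F : Type*} [NormedAddCommGroup F] [NormedSpace ℂ F]

open Classical in
/-- The function that represents `T`; meaningful if there is one. -/
def funOf (T : 𝓢'(R3, F)) : R3 → F := if h : ∃ g, Represents T g then h.choose else 0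

open Classical in
/-- The tempered distribution given by the function `g`; meaningful if `g` defines one. -/
def distOf (g : R3 → F) : 𝓢'(R3, F) := if h : ∃ T, Represents T g then h.choose else 0

/-- The product `u^k v^l` of two components of the fields `u` and `v`, as a pointwise product. -/
def prodComp (k l : Fin 3) (u v : 𝓢'(R3, C3)) : 𝓢'(R3, ℂ) :=
  distOf fun x => funOf u x k * funOf v x l

/-- The Fourier multiplier `b ↦ 𝓕⁻¹ (ξ_n ξ_p / |ξ|² * b̂)`. -/
def riesz (n p : Fin 3) (b : 𝓢'(R3, ℂ)) : 𝓢'(R3, ℂ) :=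
  𝓕⁻ (distOf fun ξ : R3 => ((ξ n * ξ p / ‖ξ‖ ^ 2 : ℝ) : ℂ) * funOf (𝓕 b) ξ)

/-- Real coefficients `a j m p n k l`, written `a^{j,m,p,n}_{k,l}`. -/
abbrev Coeffs := Fin 3 → Fin 3 → Fin 3 → Fin 3 → Fin 3 → Fin 3 → ℝ

/-- `q^{j,m}_{k,l}(b) = ∑_{n,p} a^{j,m,p,n}_{k,l} 𝓕⁻¹ (ξ_n ξ_p / |ξ|² * b̂)`. -/
def qOp (a : Coeffs) (j m k l : Fin 3) (b : 𝓢'(R3, ℂ)) : 𝓢'(R3, ℂ) :=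
  ∑ n, ∑ p, (a j m p n k l : ℂ) • riesz n p b

/-- `Q^j(u,v) = ∑_{k,l,m} q^{j,m}_{k,l}(∂_m (u^k v^l))`. -/
def Q (a : Coeffs) (j : Fin 3) (u v : 𝓢'(R3, C3)) : 𝓢'(R3, ℂ) :=
  ∑ k, ∑ l, ∑ m, qOp a j m k l (∂_{EuclideanSpace.single m (1 : ℝ)} (prodComp k l u v))

/-- The heat semigroup `e^{τΔ}`, `τ ≥ 0`. The Fourier transform is `∫ e^{-2πi x·ξ} f(x) dx`, so that
`Δ` has the symbol `-(2π|ξ|)²`. -/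
def heat (τ : ℝ) (f : 𝓢'(R3, F)) : 𝓢'(R3, F) :=
  TemperedDistribution.fourierMultiplierCLM F
    (fun ξ : R3 => ((Real.exp (-τ * (2 * Real.pi * ‖ξ‖) ^ 2) : ℝ) : ℂ)) f

end Operators

/-- `u` is a mild solution in `L²([0,T]; χ⁰)` of `∂ₜu - νΔu = Q(u,u)`, `u(0) = u₀`:
`u(t) = e^{νtΔ} u₀ + ∫₀ᵗ e^{ν(t-s)Δ} Q(u(s),u(s)) ds` for almost every `t ∈ [0,T]`, the integral of
distributions being tested against Schwartz functions. -/
structure IsMildSolution (a : Coeffs) (ν : ℝ) (u₀ : 𝓢'(R3, C3)) (T : ℝ) (u : ℝ → 𝓢'(R3, C3)) :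
    Prop where
  memLp : MemLpChi 2 0 T u
  duhamel : ∀ᵐ t ∂volume.restrict (Icc 0 T), ∀ (φ : 𝓢(R3, ℂ)) (j : Fin 3),
    u t φ j = heat (ν * t) u₀ φ j + ∫ s in (0 : ℝ)..t, heat (ν * (t - s)) (Q a j (u s) (u s)) φ

/-- A mild solution in `L²([0,T]; χ⁰)` (more precisely, that representative of its class which is
continuous in time and takes the value `u₀` at time `0`) that belongs to
`C([0,T]; χ⁻¹) ∩ L¹([0,T]; χ¹) ∩ L^∞([0,T]; χ⁻¹)`. -/
structure IsRegularSolution (a : Coeffs) (ν : ℝ) (u₀ : 𝓢'(R3, C3)) (T : ℝ) (u : ℝ → 𝓢'(R3, C3)) :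
    Prop where
  mild : IsMildSolution a ν u₀ T u
  initial : u 0 = u₀
  continuous : ContinuousChi (-1) T u
  memL1 : MemLpChi 1 1 T u
  memLinfty : MemLpChi ∞ (-1) T u

/-- The maximal time of existence `T_{u₀} ∈ [0,∞]` of a solution. -/
def lifespan (a : Coeffs) (ν : ℝ) (u₀ : 𝓢'(R3, C3)) : ℝ≥0∞ :=
  ⨆ (T : ℝ) (_ : 0 < T ∧ ∃ u, IsRegularSolution a ν u₀ T u), ENNReal.ofReal T

/-- The field is real valued: its components are real on real test functions. -/
def IsRealField (f : 𝓢'(R3, C3)) : Prop :=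
  ∀ φ : 𝓢(R3, ℂ), (∀ x, (φ x).im = 0) → ∀ k, (f φ k).im = 0

end GNS

end

/-! On the Fourier side the norms of `χ⁰` and `χ⁻¹` are weighted `L¹` norms. Put `U(t) = û(t)` and
`f₀ = |ξ|⁻¹ û₀`, both with values in `L¹(ℝ³)`. Products become convolutions, which are bounded on
`L¹`, and the symbol of `Q` is `|ξ|` times a bounded function, so the Fourier transform of `Q(u,v)`
is `|ξ| q(U,V)` with a bounded bilinear `q` on `L¹` (`qL`). Let `H_p(τ)` be multiplication by `|ξ|^p
exp(-4π²ντ|ξ|²)` for `τ > 0` and `0` for `τ ≤ 0`. The mild equation reads `U = H₁ f₀ + H₁ * q(U,U)`,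
with convolution in time.

Everything rests on `∫₀^∞ |ξ|² exp(-8π²ντ|ξ|²) dτ ≤ 1/(8π²ν)`, uniformly in `ξ`. By Minkowski's
inequality (`lintegral_sq_lintegral_le`) `H₁` maps `L¹` to `L²(ℝ; L¹)` with norm at most `κ =
(8π²ν)^(-1/2)`, and convolution with `H₁` maps `L¹(ℝ; L¹)` to `L²(ℝ; L¹)` with the same bound. Since
`q` takes two factors in `L²` of time to `L¹` of time, the equation is `U = g + B(U,U)` in `L²(ℝ;
L¹)` with `‖B‖ ≤ κ‖q‖` on every time interval, and a contraction solves it if `4κ‖q‖‖g‖ < 1`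
(`exists_eq_add_bilinear`).

As `‖g‖ ≤ κ‖f₀‖`, small `‖f₀‖/ν` gives solutions for all times: this is (i). On short intervals `L²`
norms are small anyway, so a solution on `[0,T]` continues beyond `T`
(`SmoothingKernel.IsSol.extend`; local existence is the case `T = 0`), and two solutions cannot
separate (`SmoothingKernel.IsSol.unique`). If the integral in (ii) were finite, the maximal solution
would be a solution on the closed interval up to the lifespan, and could be continued.

For the regularity, `F = q(U,U)` lies in `L¹(ℝ; L¹)`. Then `|ξ|⁻¹ û = H₀ f₀ + H₀ * F` is continuous
in time because the `H₀(τ)` are contractions (`continuous_state`), and `|ξ| û = H₂ f₀ + H₂ * F` is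
integrable in time because the symbol of `H₂` has time integral at most `1/(4π²ν)` (`memL1_state`).
Solutions for real data are real by uniqueness, since conjugation preserves the equation. The
dictionary between distributions and `L¹` functions is `exists_isSol_of_mild` and
`isRegularSolution_of_isSol`. -/

open MeasureTheory Set
open scoped SchwartzMap FourierTransform LineDeriv ENNReal

noncomputable section

namespace GNS

open Filter Topology

/-! ### Multiplication by bounded functions. -/

section MulLp

variable {α E : Type*} [MeasurableSpace α] {μ : Measure α} [NormedAddCommGroup E] [NormedSpace ℂ E]

open Classical in
variable (E μ) in
/-- Multiplication by the bounded function `σ` on `L^p`; it is `0` if `σ` is not in `L^∞`. -/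
def mulLp (p : ℝ≥0∞) [Fact (1 ≤ p)] (σ : α → ℂ) : Lp E p μ →L[ℂ] Lp E p μ :=
  if h : MemLp σ ∞ μ then (ContinuousLinearMap.lsmul ℂ ℂ).holderL μ ∞ p p h.toLp else 0

theorem coeFn_mulLp {p : ℝ≥0∞} [Fact (1 ≤ p)] {σ : α → ℂ} (hσ : MemLp σ ∞ μ) (f : Lp E p μ) :
    mulLp E μ p σ f =ᵐ[μ] fun x => σ x • f x := by
  rw [mulLp, dif_pos hσ]
  have h := (ContinuousLinearMap.lsmul ℂ ℂ (E := E)).coeFn_holder (r := p) hσ.toLp f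
  filter_upwards [h, hσ.coeFn_toLp] with x h1 h2
  rw [ContinuousLinearMap.holderL_apply_apply, h1, h2]
  rfl

theorem norm_mulLp_apply_le {p : ℝ≥0∞} [Fact (1 ≤ p)] {σ : α → ℂ} (hσ : MemLp σ ∞ μ) {C : ℝ}
    (hC : ∀ x, ‖σ x‖ ≤ C) (f : Lp E p μ) : ‖mulLp E μ p σ f‖ ≤ C * ‖f‖ := by
  refine Lp.norm_le_mul_norm_of_ae_le_mul ?_
  filter_upwards [coeFn_mulLp hσ f] with x h
  rw [h, norm_smul]
  exact mul_le_mul_of_nonneg_right (hC x) (norm_nonneg _)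

theorem mulLp_zero {p : ℝ≥0∞} [Fact (1 ≤ p)] : mulLp E μ p (0 : α → ℂ) = 0 := by
  ext1 f
  refine Lp.ext ?_
  filter_upwards [coeFn_mulLp (μ := μ) (p := p) MemLp.zero f, Lp.coeFn_zero E p μ] with x h1 h2
  rw [h1, zero_apply, h2]
  simp

end MulLp

theorem eLpNorm_two_le_iff {α E : Type*} [MeasurableSpace α] {μ : Measure α}
    [NormedAddCommGroup E] {f : α → E}
    {C : ℝ≥0∞} : eLpNorm f 2 μ ≤ C ↔ ∫⁻ x, ‖f x‖ₑ ^ 2 ∂μ ≤ C ^ 2 := by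
  rw [eLpNorm_eq_lintegral_rpow_enorm_toReal two_ne_zero ENNReal.ofNat_ne_top]
  simp only [ENNReal.toReal_ofNat]
  rw [one_div, ENNReal.rpow_inv_le_iff two_pos]
  simp only [ENNReal.rpow_ofNat]

/-! ### Duhamel integrals and Minkowski's inequality. -/

section Duhamel

variable {L : Type*} [NormedAddCommGroup L] [NormedSpace ℂ L]

/-- The kernel is measurable in `τ` only pointwise in `f`. Joint measurability comes from continuity
in `f` and separability of `L`. -/
theorem measurable_kernel_apply [SecondCountableTopology L] [MeasurableSpace L] [BorelSpace L]
    {H : ℝ → L →L[ℂ] L} (hH : ∀ f, StronglyMeasurable fun τ => H τ f) :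
    StronglyMeasurable fun z : L × ℝ => H z.2 z.1 :=
  stronglyMeasurable_uncurry_of_continuous_of_stronglyMeasurable (u := fun f τ => H τ f)
    (fun τ => (H τ).continuous) hH

/-- `∫ H(t - s) F(s) ds`. For a kernel that vanishes for negative times this is the Duhamel
integral. -/
def duhamel (H : ℝ → L →L[ℂ] L) (F : ℝ → L) (t : ℝ) : L := ∫ s, H (t - s) (F s)

theorem duhamel_congr (H : ℝ → L →L[ℂ] L) {F G : ℝ → L} (h : F =ᵐ[volume] G) :
    duhamel H F = duhamel H G := by
  ext1 t
  refine integral_congr_ae ?_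
  filter_upwards [h] with s hs
  rw [hs]

theorem map_duhamel [CompleteSpace L] {G : Type*} [NormedAddCommGroup G] [NormedSpace ℂ G]
    [CompleteSpace G] (ℓ : L →L[ℂ] G) (H : ℝ → L →L[ℂ] L) {F : ℝ → L} {t : ℝ}
    (h : Integrable fun s => H (t - s) (F s)) :
    ℓ (duhamel H F t) = ∫ s, ℓ (H (t - s) (F s)) :=
  (ℓ.integral_comp_comm h).symm

/-- A conjugate-linear map is real linear, which is all that the Bochner integral needs. -/
theorem map_duhamel_conj [CompleteSpace L] (J : L →SL[starRingEnd ℂ] L) (H : ℝ → L →L[ℂ] L)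
    {F : ℝ → L} {t : ℝ} (h : Integrable fun s => H (t - s) (F s)) :
    J (duhamel H F t) = ∫ s, J (H (t - s) (F s)) := by
  let J' : L →L[ℝ] L :=
    { toFun := J
      map_add' := map_add J
      map_smul' := fun r x => by
        rw [RingHom.id_apply, ← Complex.coe_smul, ← Complex.coe_smul, map_smulₛₗ,
          Complex.conj_ofReal]
      cont := J.continuous }
  exact (J'.integral_comp_comm h).symm

variable [SecondCountableTopology L]

theorem aestronglyMeasurable_kernel_comp {H : ℝ → L →L[ℂ] L}
    (hH : ∀ f, StronglyMeasurable fun τ => H τ f) {F : ℝ → L} (hF : AEStronglyMeasurable F) :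
    AEStronglyMeasurable (fun z : ℝ × ℝ => H (z.1 - z.2) (F z.2)) (volume.prod volume) := by
  borelize L
  refine ⟨fun z => H (z.1 - z.2) (hF.mk F z.2), ?_, ?_⟩
  · exact (measurable_kernel_apply hH).comp_measurable
      ((hF.stronglyMeasurable_mk.measurable.comp measurable_snd).prodMk
        (measurable_fst.sub measurable_snd))
  · filter_upwards [Measure.quasiMeasurePreserving_snd.ae hF.ae_eq_mk] with z hz
    rw [hz]

theorem aestronglyMeasurable_kernel_comp_right {H : ℝ → L →L[ℂ] L}
    (hH : ∀ f, StronglyMeasurable fun τ => H τ f) {F : ℝ → L} (hF : AEStronglyMeasurable F)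
    (t : ℝ) : AEStronglyMeasurable (fun s => H (t - s) (F s)) := by
  borelize L
  refine ⟨fun s => H (t - s) (hF.mk F s), ?_, ?_⟩
  · exact (measurable_kernel_apply hH).comp_measurable
      (hF.stronglyMeasurable_mk.measurable.prodMk (measurable_const.sub measurable_id))
  · filter_upwards [hF.ae_eq_mk] with z hz
    rw [hz]

theorem aestronglyMeasurable_duhamel {H : ℝ → L →L[ℂ] L}
    (hH : ∀ f, StronglyMeasurable fun τ => H τ f) {F : ℝ → L} (hF : AEStronglyMeasurable F) :
    AEStronglyMeasurable (duhamel H F) :=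
  (aestronglyMeasurable_kernel_comp hH hF).integral_prod_right'

/-- Tonelli and translation invariance in `t`; this serves the kernel with `|ξ|²`, which is
integrable in time. -/
theorem lintegral_lintegral_kernel_le {H : ℝ → L →L[ℂ] L}
    (hH : ∀ f, StronglyMeasurable fun τ => H τ f) {C : ℝ≥0∞}
    (hC : ∀ f, ∫⁻ τ, ‖H τ f‖ₑ ≤ C * ‖f‖ₑ) {F : ℝ → L} (hF : AEStronglyMeasurable F) :
    ∫⁻ t, ∫⁻ s, ‖H (t - s) (F s)‖ₑ ≤ C * ∫⁻ s, ‖F s‖ₑ := by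
  rw [lintegral_lintegral_swap (f := fun t s => ‖H (t - s) (F s)‖ₑ)
    (aestronglyMeasurable_kernel_comp hH hF).enorm, ← lintegral_const_mul'' _ hF.enorm]
  refine lintegral_mono fun s => ?_
  rw [lintegral_sub_right_eq_self (fun t => ‖H t (F s)‖ₑ) s]
  exact hC _

/-- Minkowski's integral inequality for the exponent `2`. -/
theorem lintegral_sq_lintegral_le {α β : Type*} [MeasurableSpace α] [MeasurableSpace β]
    {μ : Measure α} {ν : Measure β} [SFinite μ] [SFinite ν] {h : α → β → ℝ≥0∞}
    (hh : AEMeasurable (Function.uncurry h) (μ.prod ν)) {N : β → ℝ≥0∞}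
    (hN : AEMeasurable N ν)
    (hhN : ∀ᵐ s ∂ν, ∫⁻ t, h t s ^ 2 ∂μ ≤ N s ^ 2) :
    ∫⁻ t, (∫⁻ s, h t s ∂ν) ^ 2 ∂μ ≤ (∫⁻ s, N s ∂ν) ^ 2 := by
  have hs : ∀ᵐ t ∂μ, AEMeasurable (h t) ν :=
    hh.aestronglyMeasurable.prodMk_left.mono fun _ h => h.aemeasurable
  have hs' : ∀ᵐ s ∂ν, AEMeasurable (fun t => h t s) μ :=
    hh.prod_swap.aestronglyMeasurable.prodMk_left.mono fun _ h => h.aemeasurable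
  -- The square of the inner integral is a double integral over `s` and `s'`; Cauchy–Schwarz in `t`
  -- is applied to each pair.
  have key : ∀ᵐ s ∂ν, ∀ᵐ s' ∂ν, ∫⁻ t, h t s * h t s' ∂μ ≤ N s * N s' := by
    filter_upwards [hhN, hs'] with s h1 h1'
    filter_upwards [hhN, hs'] with s' h2 h2'
    refine (ENNReal.lintegral_mul_le_Lp_mul_Lq μ Real.HolderConjugate.two_two h1' h2').trans ?_
    refine mul_le_mul' ?_ ?_
    · rw [one_div, ENNReal.rpow_inv_le_iff two_pos]; exact_mod_cast h1
    · rw [one_div, ENNReal.rpow_inv_le_iff two_pos]; exact_mod_cast h2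
  calc ∫⁻ t, (∫⁻ s, h t s ∂ν) ^ 2 ∂μ = ∫⁻ t, ∫⁻ s, ∫⁻ s', h t s * h t s' ∂ν ∂ν ∂μ := by
        refine lintegral_congr_ae ?_
        filter_upwards [hs] with t ht
        rw [sq, ← lintegral_mul_const'' _ ht]
        refine lintegral_congr fun s => ?_
        rw [lintegral_const_mul'' _ ht]
    _ = ∫⁻ s, ∫⁻ t, ∫⁻ s', h t s * h t s' ∂ν ∂μ ∂ν := by
        refine lintegral_lintegral_swap ?_
        have : AEMeasurable (fun z : α × β => h z.1 z.2 * ∫⁻ s', h z.1 s' ∂ν) (μ.prod ν) :=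
          hh.mul (hh.lintegral_prod_right'.comp_quasiMeasurePreserving
            Measure.quasiMeasurePreserving_fst)
        refine this.congr ?_
        filter_upwards [Measure.quasiMeasurePreserving_fst.ae hs] with z hz
        simp only [Function.uncurry]
        rw [lintegral_const_mul'' _ hz]
    _ ≤ ∫⁻ s, ∫⁻ s', N s * N s' ∂ν ∂ν := by
        refine lintegral_mono_ae ?_
        filter_upwards [key, hs'] with s hs1 hs2
        rw [lintegral_lintegral_swap]
        · exact lintegral_mono_ae hs1
        · exact (hs2.comp_quasiMeasurePreserving Measure.quasiMeasurePreserving_fst).mul hh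
    _ = (∫⁻ s, N s ∂ν) ^ 2 := by
        rw [sq, ← lintegral_mul_const'' _ hN]
        refine lintegral_congr fun s => ?_
        rw [lintegral_const_mul'' _ hN]

theorem lintegral_sq_lintegral_kernel_le {H : ℝ → L →L[ℂ] L}
    (hH : ∀ f, StronglyMeasurable fun τ => H τ f) {κ : ℝ≥0∞}
    (hκ : ∀ f, ∫⁻ τ, ‖H τ f‖ₑ ^ 2 ≤ (κ * ‖f‖ₑ) ^ 2) {F : ℝ → L} (hF : AEStronglyMeasurable F) :
    ∫⁻ t, (∫⁻ s, ‖H (t - s) (F s)‖ₑ) ^ 2 ≤ (κ * ∫⁻ s, ‖F s‖ₑ) ^ 2 := by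
  rw [← lintegral_const_mul'' _ hF.enorm]
  refine lintegral_sq_lintegral_le (aestronglyMeasurable_kernel_comp hH hF).enorm
    (hF.enorm.const_mul _) (Eventually.of_forall fun s => ?_)
  rw [lintegral_sub_right_eq_self (fun t => ‖H t (F s)‖ₑ ^ 2) s]
  exact hκ _

/-- A causal family of operators that maps `L` boundedly to `L²(ℝ; L)`. -/
structure SmoothingKernel (L : Type*) [NormedAddCommGroup L] [NormedSpace ℂ L] where
  /-- the operators -/
  op : ℝ → L →L[ℂ] L
  /-- the bound -/
  bound : NNReal
  stronglyMeasurable : ∀ f, StronglyMeasurable fun τ => op τ f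
  causal : ∀ τ ≤ 0, op τ = 0
  lintegral_le : ∀ f, ∫⁻ τ, ‖op τ f‖ₑ ^ 2 ≤ (bound * ‖f‖ₑ) ^ 2

namespace SmoothingKernel

variable (K : SmoothingKernel L)

/-- The integral of the norms is square integrable in `t`, hence finite for almost every `t`. Only
at such `t` is the Duhamel integral a genuine one, and additivity in `F` depends on that. -/
theorem ae_integrable {F : ℝ → L} (hF : Integrable F) :
    ∀ᵐ t, Integrable fun s => K.op (t - s) (F s) := by
  have h := lintegral_sq_lintegral_kernel_le K.stronglyMeasurable K.lintegral_le
    hF.aestronglyMeasurable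
  have h1 : ∫⁻ t, (∫⁻ s, ‖K.op (t - s) (F s)‖ₑ) ^ 2 ≠ ∞ := by
    refine (h.trans_lt ?_).ne
    exact ENNReal.pow_lt_top (ENNReal.mul_lt_top ENNReal.coe_lt_top hF.hasFiniteIntegral)
  have hm : AEMeasurable fun t => (∫⁻ s, ‖K.op (t - s) (F s)‖ₑ) ^ 2 :=
    (aestronglyMeasurable_kernel_comp K.stronglyMeasurable
      hF.aestronglyMeasurable).enorm.lintegral_prod_right'.pow_const 2
  filter_upwards [ae_lt_top' hm h1] with t ht
  refine ⟨aestronglyMeasurable_kernel_comp_right K.stronglyMeasurable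
    hF.aestronglyMeasurable t, ?_⟩
  by_contra hc
  have hc' : ∫⁻ s, ‖K.op (t - s) (F s)‖ₑ = ∞ := not_lt_top_iff.1 hc
  simp [hc'] at ht

theorem eLpNorm_duhamel_le {F : ℝ → L} (hF : AEStronglyMeasurable F) :
    eLpNorm (duhamel K.op F) 2 volume ≤ K.bound * eLpNorm F 1 volume := by
  rw [eLpNorm_two_le_iff, eLpNorm_one_eq_lintegral_enorm]
  refine le_trans (lintegral_mono fun t => ?_)
    (lintegral_sq_lintegral_kernel_le K.stronglyMeasurable K.lintegral_le hF)
  gcongr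
  exact enorm_integral_le_lintegral_enorm _

theorem memLp_duhamel {F : ℝ → L} (hF : MemLp F 1) : MemLp (duhamel K.op F) 2 :=
  ⟨aestronglyMeasurable_duhamel K.stronglyMeasurable hF.1,
    (K.eLpNorm_duhamel_le hF.1).trans_lt (ENNReal.mul_lt_top ENNReal.coe_lt_top hF.2)⟩

/-- The Duhamel integral as an operator from `L¹(ℝ; L)` to `L²(ℝ; L)`. -/
def duhamelL : Lp L 1 (volume : Measure ℝ) →L[ℂ] Lp L 2 (volume : Measure ℝ) :=
  LinearMap.mkContinuous
    { toFun := fun F => (K.memLp_duhamel (Lp.memLp F)).toLp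
      map_add' := fun F G => by
        rw [← MemLp.toLp_add]
        refine MemLp.toLp_congr _ _ ?_
        rw [duhamel_congr K.op (Lp.coeFn_add F G)]
        filter_upwards [K.ae_integrable (memLp_one_iff_integrable.1 (Lp.memLp F)),
          K.ae_integrable (memLp_one_iff_integrable.1 (Lp.memLp G))] with t h1 h2
        simp [duhamel, integral_add h1 h2]
      map_smul' := fun c F => by
        rw [RingHom.id_apply, ← MemLp.toLp_const_smul]
        refine MemLp.toLp_congr _ _ ?_
        rw [duhamel_congr K.op (Lp.coeFn_smul c F)]
        refine Eventually.of_forall fun t => ?_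
        simp [duhamel, integral_smul] }
    K.bound (fun F => by
      rw [LinearMap.coe_mk, AddHom.coe_mk, Lp.norm_toLp, Lp.norm_def]
      have h := ENNReal.toReal_mono
        (ENNReal.mul_lt_top ENNReal.coe_lt_top (Lp.memLp F).2).ne
        (K.eLpNorm_duhamel_le (Lp.memLp F).1)
      rwa [ENNReal.toReal_mul, ENNReal.coe_toReal] at h)

theorem coeFn_duhamelL (F : Lp L 1 (volume : Measure ℝ)) :
    K.duhamelL F =ᵐ[volume] duhamel K.op F :=
  MemLp.coeFn_toLp (K.memLp_duhamel (Lp.memLp F))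

theorem norm_duhamelL_apply_le (F : Lp L 1 (volume : Measure ℝ)) :
    ‖K.duhamelL F‖ ≤ K.bound * ‖F‖ := by
  refine (K.duhamelL.le_opNorm F).trans ?_
  gcongr
  exact LinearMap.mkContinuous_norm_le _ K.bound.2 _

end SmoothingKernel

end Duhamel

end GNS

end

noncomputable section

namespace GNS

open Filter Topology

/-! ### The quadratic fixed point equation. -/

section FixedPoint

variable {E : Type*} [NormedAddCommGroup E] [NormedSpace ℂ E] [CompleteSpace E]

/-- The quadratic equation `w = g + B(w,w)` has a solution if `g` is small. -/
theorem exists_eq_add_bilinear (B : E →L[ℂ] E →L[ℂ] E) {K : ℝ} (hK : 0 ≤ K)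
    (hB : ∀ v w, ‖B v w‖ ≤ K * ‖v‖ * ‖w‖) {g : E} (hg : 4 * K * ‖g‖ < 1) :
    ∃ w, w = g + B w w := by
  -- On the ball of radius `2‖g‖` the map has Lipschitz constant `4K‖g‖`, and the same number below
  -- `1` makes the ball invariant.
  set s := Metric.closedBall (0 : E) (2 * ‖g‖) with hs
  have hmaps : MapsTo (fun w => g + B w w) s s := by
    intro w hw
    rw [hs, mem_closedBall_zero_iff] at hw ⊢
    calc ‖g + B w w‖ ≤ ‖g‖ + K * ‖w‖ * ‖w‖ := (norm_add_le _ _).trans (by gcongr; exact hB w w)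
      _ ≤ ‖g‖ + K * (2 * ‖g‖) * (2 * ‖g‖) := by gcongr
      _ = ‖g‖ + (4 * K * ‖g‖) * ‖g‖ := by ring
      _ ≤ ‖g‖ + 1 * ‖g‖ := by gcongr
      _ = 2 * ‖g‖ := by ring
  have hlip : ContractingWith (4 * K * ‖g‖).toNNReal (hmaps.restrict _ s s) := by
    refine ⟨by rwa [Real.toNNReal_lt_one], ?_⟩
    refine LipschitzWith.of_dist_le_mul fun v w => ?_
    rw [Real.coe_toNNReal _ (by positivity), Subtype.dist_eq, Subtype.dist_eq, dist_eq_norm,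
      dist_eq_norm]
    have hv := mem_closedBall_zero_iff.1 v.2
    have hw := mem_closedBall_zero_iff.1 w.2
    have : g + B v.1 v.1 - (g + B w.1 w.1) = B v.1 (v.1 - w.1) + B (v.1 - w.1) w.1 := by
      simp only [map_sub, sub_apply]
      abel
    simp only [MapsTo.val_restrict_apply]
    rw [this]
    calc _ ≤ K * ‖v.1‖ * ‖v.1 - w.1‖ + K * ‖v.1 - w.1‖ * ‖w.1‖ :=
          (norm_add_le _ _).trans (add_le_add (hB _ _) (hB _ _))
      _ ≤ K * (2 * ‖g‖) * ‖v.1 - w.1‖ + K * ‖v.1 - w.1‖ * (2 * ‖g‖) := by gcongr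
      _ = _ := by ring
  obtain ⟨w, -, hw, -⟩ := hlip.exists_fixedPoint' Metric.isClosed_closedBall.isComplete hmaps
    (Metric.mem_closedBall_self (by positivity)) (edist_ne_top _ _)
  exact ⟨w, hw.symm⟩

end FixedPoint

/-! ### Restriction to time intervals. -/

section Cut

variable {L : Type*} [NormedAddCommGroup L] [NormedSpace ℂ L]

/-- Restriction of functions of time to the set `s`. -/
def cut {p : ℝ≥0∞} [Fact (1 ≤ p)] (s : Set ℝ) :
    Lp L p (volume : Measure ℝ) →L[ℂ] Lp L p (volume : Measure ℝ) :=
  mulLp L volume p (s.indicator 1)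

variable {p : ℝ≥0∞} [Fact (1 ≤ p)] {s t : Set ℝ}

theorem coeFn_cut (hs : MeasurableSet s) (f : Lp L p (volume : Measure ℝ)) :
    cut s f =ᵐ[volume] s.indicator f := by
  have h : MemLp (s.indicator (1 : ℝ → ℂ)) ∞ (volume : Measure ℝ) := by
    refine memLp_top_of_bound ((stronglyMeasurable_one.indicator hs).aestronglyMeasurable) 1
      (Eventually.of_forall fun x => ?_)
    by_cases hx : x ∈ s <;> simp [hx]
  filter_upwards [coeFn_mulLp h f] with x hx
  rw [cut, hx]
  by_cases hx : x ∈ s <;> simp [hx]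

theorem cut_cut (hs : MeasurableSet s) (ht : MeasurableSet t) (f : Lp L p (volume : Measure ℝ)) :
    cut s (cut t f) = cut (s ∩ t) f := by
  refine Lp.ext ?_
  filter_upwards [coeFn_cut hs (cut t f), coeFn_cut ht f, coeFn_cut (hs.inter ht) f] with x h1 h2 h3
  rw [h1, h3]
  by_cases hxs : x ∈ s <;> by_cases hxt : x ∈ t <;> simp [hxs, hxt, h2]

theorem cut_eq_zero_of_disjoint (hs : MeasurableSet s) (ht : MeasurableSet t) (hst : Disjoint s t)
    (f : Lp L p (volume : Measure ℝ)) : cut s (cut t f) = 0 := by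
  rw [cut_cut hs ht, disjoint_iff_inter_eq_empty.1 hst]
  refine Lp.ext ?_
  filter_upwards [coeFn_cut .empty f, Lp.coeFn_zero L p volume] with x h1 h2
  rw [h1, h2]
  simp

theorem cut_Ioc_add {a b c : ℝ} (hab : a ≤ b) (hbc : b ≤ c) (f : Lp L p (volume : Measure ℝ)) :
    cut (Ioc a b) f + cut (Ioc b c) f = cut (Ioc a c) f := by
  refine Lp.ext ?_
  filter_upwards [coeFn_cut measurableSet_Ioc f, coeFn_cut measurableSet_Ioc f,
    coeFn_cut measurableSet_Ioc f, Lp.coeFn_add (cut (Ioc a b) f) (cut (Ioc b c) f)]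
    with x h1 h2 h3 h4
  rw [h4, h3, Pi.add_apply, h1, h2, ← Ioc_union_Ioc_eq_Ioc hab hbc,
    indicator_union_of_disjoint (Ioc_disjoint_Ioc_of_le le_rfl)]

theorem norm_cut_le (hs : MeasurableSet s) (f : Lp L p (volume : Measure ℝ)) :
    ‖cut s f‖ ≤ ‖f‖ := by
  refine Lp.norm_le_norm_of_ae_le ?_
  filter_upwards [coeFn_cut hs f] with x hx
  rw [hx]
  exact norm_indicator_le_norm_self _ _

theorem holder_cut_left (q : L →L[ℂ] L →L[ℂ] L) (hs : MeasurableSet s)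
    (U V : Lp L 2 (volume : Measure ℝ)) :
    q.holder 1 (cut s U) V = cut s (q.holder 1 U V) := by
  refine Lp.ext ?_
  filter_upwards [coeFn_cut hs (q.holder 1 U V), coeFn_cut hs U,
    q.coeFn_holder (r := 1) (cut s U) V, q.coeFn_holder (r := 1) U V] with x h1 h2 h3 h4
  rw [h3, h1, h2]
  by_cases hx : x ∈ s <;> simp [hx, h4]

theorem holder_cut_right (q : L →L[ℂ] L →L[ℂ] L) (hs : MeasurableSet s)
    (U V : Lp L 2 (volume : Measure ℝ)) :
    q.holder 1 U (cut s V) = cut s (q.holder 1 U V) := by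
  refine Lp.ext ?_
  filter_upwards [coeFn_cut hs (q.holder 1 U V), coeFn_cut hs V,
    q.coeFn_holder (r := 1) U (cut s V), q.coeFn_holder (r := 1) U V] with x h1 h2 h3 h4
  rw [h3, h1, h2]
  by_cases hx : x ∈ s <;> simp [hx, h4]

theorem norm_cut_Ioc_sq (U : Lp L 2 (volume : Measure ℝ)) {a b : ℝ} (hab : a ≤ b) :
    ‖cut (Ioc a b) U‖ ^ 2 = ∫ r in a..b, ‖U r‖ ^ 2 := by
  rw [Lp.norm_def, eLpNorm_congr_ae (coeFn_cut measurableSet_Ioc U),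
    eLpNorm_indicator_eq_eLpNorm_restrict measurableSet_Ioc,
    eLpNorm_eq_lintegral_rpow_enorm_toReal two_ne_zero ENNReal.ofNat_ne_top,
    intervalIntegral.integral_of_le hab, integral_eq_lintegral_of_nonneg_ae
      (Eventually.of_forall fun _ => by positivity)
      ((Lp.memLp U).integrable_norm_pow two_ne_zero).aestronglyMeasurable.restrict]
  simp only [ENNReal.toReal_ofNat]
  rw [← ENNReal.toReal_pow, ← ENNReal.rpow_natCast, ← ENNReal.rpow_mul]
  norm_num

theorem continuous_integral_norm_sq {E : Type*} [NormedAddCommGroup E]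
    (U : Lp E 2 (volume : Measure ℝ)) (a : ℝ) :
    Continuous fun b => ∫ r in a..b, ‖U r‖ ^ 2 := by
  have h : Integrable fun r => ‖U r‖ ^ 2 := (Lp.memLp U).integrable_norm_pow two_ne_zero
  exact intervalIntegral.continuous_primitive (fun _ _ => h.intervalIntegrable) a

/-- Absolute continuity of the integral of `‖U‖²`. This is the only source of smallness for large
data. -/
theorem exists_gt_norm_cut_lt (U : Lp L 2 (volume : Measure ℝ)) (a : ℝ) {ε : ℝ} (hε : 0 < ε) :
    ∀ᶠ b in 𝓝[>] a, ‖cut (Ioc a b) U‖ < ε := by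
  have h := (continuous_integral_norm_sq U a).tendsto a
  rw [intervalIntegral.integral_same] at h
  have h1 : ∀ᶠ b in 𝓝[>] a, ∫ r in a..b, ‖U r‖ ^ 2 < ε ^ 2 :=
    nhdsWithin_le_nhds (h.eventually (gt_mem_nhds (by positivity)))
  filter_upwards [h1, self_mem_nhdsWithin] with b hb hab
  rw [← norm_cut_Ioc_sq U (le_of_lt hab)] at hb
  exact lt_of_pow_lt_pow_left₀ 2 hε.le hb

end Cut

/-! ### The abstract equation: existence, continuation, uniqueness. -/

namespace SmoothingKernel

variable {L : Type*} [NormedAddCommGroup L] [NormedSpace ℂ L] [SecondCountableTopology L]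
  (K : SmoothingKernel L) (q : L →L[ℂ] L →L[ℂ] L)

/-- Causality: for `t ≤ T < s` the time `t - s` is negative, where the kernel vanishes. -/
theorem cut_Iic_duhamelL (T : ℝ) (F : Lp L 1 (volume : Measure ℝ)) :
    cut (Iic T) (K.duhamelL (cut (Iic T) F)) = cut (Iic T) (K.duhamelL F) := by
  refine Lp.ext ?_
  filter_upwards [coeFn_cut measurableSet_Iic (K.duhamelL (cut (Iic T) F)),
    coeFn_cut measurableSet_Iic (K.duhamelL F), K.coeFn_duhamelL F,
    K.coeFn_duhamelL (cut (Iic T) F)] with t h1 h2 h3 h4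
  rw [h1, h2]
  by_cases ht : t ∈ Iic T
  · simp only [indicator_of_mem ht]
    rw [h3, h4]
    refine integral_congr_ae ?_
    filter_upwards [coeFn_cut measurableSet_Iic F] with s hs
    rw [hs]
    by_cases hsT : s ∈ Iic T
    · simp [hsT]
    · have : t - s ≤ 0 := by
        simp only [mem_Iic, not_le] at ht hsT
        linarith
      simp [K.causal _ this]
  · simp [ht]

theorem cut_duhamelL {s : Set ℝ} (hs : MeasurableSet s) {T : ℝ} (hsT : s ⊆ Iic T)
    (F : Lp L 1 (volume : Measure ℝ)) :
    cut s (K.duhamelL F) = cut s (K.duhamelL (cut (Iic T) F)) := by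
  have h := congrArg (cut s) (K.cut_Iic_duhamelL T F)
  rw [cut_cut hs measurableSet_Iic, cut_cut hs measurableSet_Iic,
    inter_eq_self_of_subset_left hsT] at h
  exact h.symm

/-- `U` solves `U = g + D q(U,U)` on the time interval `(0,T]` and vanishes elsewhere. -/
def IsSol (g : Lp L 2 (volume : Measure ℝ)) (T : ℝ) (U : Lp L 2 (volume : Measure ℝ)) : Prop :=
  U = cut (Ioc 0 T) (g + K.duhamelL (q.holder 1 U U))

variable {K q} {g U V : Lp L 2 (volume : Measure ℝ)} {T T' : ℝ}

/-- The seed of local existence, which is `IsSol.extend` at time `0`. -/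
theorem isSol_zero : K.IsSol q g 0 0 := by
  rw [IsSol, eq_comm, ← norm_eq_zero, ← sq_eq_zero_iff, norm_cut_Ioc_sq _ le_rfl,
    intervalIntegral.integral_same]

theorem IsSol.cut_eq (hU : K.IsSol q g T U) : cut (Ioc 0 T) U = U := by
  conv_lhs => rw [hU]
  rw [cut_cut measurableSet_Ioc measurableSet_Ioc, inter_self]
  exact hU.symm

/-- Cutting does not increase norms, so the bilinear map has norm at most `K.bound * ‖q‖` for every
set `s`, and smallness is required of `g` on `s` only. -/
theorem exists_eq_cut [CompleteSpace L] {s : Set ℝ} (hs : MeasurableSet s)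
    (hg : 4 * (K.bound * ‖q‖) * ‖cut s g‖ < 1) :
    ∃ W, W = cut s (g + K.duhamelL (q.holder 1 W W)) := by
  let B : Lp L 2 (volume : Measure ℝ) →L[ℂ] Lp L 2 (volume : Measure ℝ) →L[ℂ]
      Lp L 2 (volume : Measure ℝ) :=
    (ContinuousLinearMap.compL ℂ _ _ _ ((cut s) ∘L K.duhamelL)) ∘L q.holderL volume 2 2 1
  have hB : ∀ v w, B v w = cut s (K.duhamelL (q.holder 1 v w)) := fun v w => rfl
  obtain ⟨W, hW⟩ := exists_eq_add_bilinear B (K := K.bound * ‖q‖) (by positivity)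
    (fun v w => by
      rw [hB]
      refine (norm_cut_le hs _).trans ((K.norm_duhamelL_apply_le _).trans ?_)
      rw [mul_assoc, mul_assoc]
      refine mul_le_mul_of_nonneg_left ?_ K.bound.2
      rw [← mul_assoc]
      exact q.norm_holder_apply_apply_le v w) hg
  exact ⟨W, by rw [map_add, ← hB]; exact hW⟩

theorem exists_isSol_of_small [CompleteSpace L] (hg : 4 * (K.bound * ‖q‖) * ‖g‖ < 1) (T : ℝ) :
    ∃ U, K.IsSol q g T U :=
  exists_eq_cut measurableSet_Ioc (lt_of_le_of_lt
    (mul_le_mul_of_nonneg_left (norm_cut_le measurableSet_Ioc g) (by positivity)) hg)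

theorem IsSol.restrict (hU : K.IsSol q g T' U) (hTT : T ≤ T') :
    K.IsSol q g T (cut (Ioc 0 T) U) := by
  rw [IsSol, holder_cut_left q measurableSet_Ioc, holder_cut_right q measurableSet_Ioc,
    cut_cut measurableSet_Ioc measurableSet_Ioc, inter_self]
  have h1 : cut (Ioc 0 T) U = cut (Ioc 0 T) (g + K.duhamelL (q.holder 1 U U)) := by
    conv_lhs => rw [hU]
    rw [cut_cut measurableSet_Ioc measurableSet_Ioc, inter_eq_self_of_subset_left
      (Ioc_subset_Ioc_right hTT)]
  have h2 : q.holder 1 U U = cut (Ioc 0 T') (q.holder 1 U U) := by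
    conv_lhs => rw [← hU.cut_eq]
    rw [holder_cut_left q measurableSet_Ioc, hU.cut_eq]
  rw [h1, map_add, map_add, K.cut_duhamelL measurableSet_Ioc Ioc_subset_Iic_self, h2,
    cut_cut measurableSet_Iic measurableSet_Ioc, cut_cut measurableSet_Ioc measurableSet_Ioc]
  congr 5
  ext x
  simp only [mem_inter_iff, mem_Iic, mem_Ioc]
  constructor
  · rintro ⟨h1, h2, h3⟩; exact ⟨⟨h2, h1⟩, h2, h3⟩
  · rintro ⟨⟨h1, h2⟩, h3, h4⟩; exact ⟨h2, h1, h4⟩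

/-- The past enters only through the new inhomogeneity `G = g + D q(U,U)`, which is small on a short
interval `(T,T']`. There `W = G + D q(W,W)` is solvable, and `U + W` is the continuation: `U` and
`W` have disjoint supports in time, so the cross terms of `q` vanish. -/
theorem IsSol.extend [CompleteSpace L] (hT : 0 ≤ T) (hU : K.IsSol q g T U) :
    ∃ T' > T, ∃ U', K.IsSol q g T' U' := by
  set G := g + K.duhamelL (q.holder 1 U U) with hG
  -- The `+ 1` keeps the denominator positive when `K.bound * ‖q‖ = 0`.
  obtain ⟨T', h1, hTT⟩ := ((exists_gt_norm_cut_lt G T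
    (ε := 1 / (4 * (K.bound * ‖q‖) + 1)) (by positivity)).and self_mem_nhdsWithin).exists
  have hTT : T < T' := hTT
  obtain ⟨W, hW⟩ := exists_eq_cut (K := K) (q := q) (g := G) (s := Ioc T T') measurableSet_Ioc (by
    rw [lt_div_iff₀ (by positivity)] at h1
    nlinarith [norm_nonneg (cut (Ioc T T') G)])
  refine ⟨T', hTT, U + W, ?_⟩
  have hWc : cut (Ioc T T') W = W := by
    conv_lhs => rw [hW]
    rw [cut_cut measurableSet_Ioc measurableSet_Ioc, inter_self]
    exact hW.symm
  have hdis : Disjoint (Ioc 0 T) (Ioc T T') := Ioc_disjoint_Ioc_of_le le_rfl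
  have hUW : q.holder 1 U W = 0 := by
    rw [← hU.cut_eq, ← hWc, holder_cut_left q measurableSet_Ioc,
      holder_cut_right q measurableSet_Ioc,
      cut_eq_zero_of_disjoint measurableSet_Ioc measurableSet_Ioc hdis]
  have hWU : q.holder 1 W U = 0 := by
    rw [← hU.cut_eq, ← hWc, holder_cut_left q measurableSet_Ioc,
      holder_cut_right q measurableSet_Ioc,
      cut_eq_zero_of_disjoint measurableSet_Ioc measurableSet_Ioc hdis.symm]
  have hWW : q.holder 1 W W = cut (Ioc T T') (q.holder 1 W W) := by
    conv_lhs => rw [← hWc]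
    rw [holder_cut_left q measurableSet_Ioc, hWc]
  -- `q(W,W)` lives after `T`, so by causality it does not disturb the old solution.
  have h0 : cut (Ioc 0 T) (K.duhamelL (q.holder 1 W W)) = 0 := by
    rw [K.cut_duhamelL measurableSet_Ioc Ioc_subset_Iic_self, hWW,
      cut_eq_zero_of_disjoint measurableSet_Iic measurableSet_Ioc (Iic_disjoint_Ioc le_rfl),
      map_zero, map_zero]
  rw [IsSol, q.holder_add_left, q.holder_add_right, q.holder_add_right, hUW, hWU, add_zero,
    zero_add, map_add K.duhamelL, ← add_assoc, ← hG, ← cut_Ioc_add hT hTT.le, ← hW,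
    map_add, h0, add_zero]
  exact congrArg (· + W) hU

/-- If the difference `W` vanishes up to time `a`, then on a short `(a,b]` it satisfies `‖W‖ ≤
κ‖q‖(‖U‖ + ‖V‖)‖W‖`, all norms taken over `(a,b]`, with a factor below `1`. So `W` vanishes up to
`b`, and the agreement spreads over `[0,T]`. -/
theorem IsSol.unique (hT : 0 ≤ T) (hU : K.IsSol q g T U) (hV : K.IsSol q g T V) : U = V := by
  have hW : cut (Ioc 0 T) (U - V) = U - V := by rw [map_sub, hU.cut_eq, hV.cut_eq]
  have hdiff : U - V = cut (Ioc 0 T) (K.duhamelL (q.holder 1 U (U - V) +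
      q.holder 1 (U - V) V)) := by
    have h : q.holder 1 U (U - V) + q.holder 1 (U - V) V = q.holder 1 U U - q.holder 1 V V := by
      simp only [← q.holderL_apply_apply volume 2 2 1, map_sub, sub_apply]
      abel
    rw [h, map_sub, map_sub]
    conv_lhs => rw [hU, hV]
    rw [map_add, map_add]
    abel
  set W := U - V with hWdef
  -- Closedness for the continuation argument: vanishing on `(0,t]` means that the integral of
  -- `‖W‖²` up to `t`, continuous in `t`, is zero.
  have hs : IsClosed ({t | cut (Ioc 0 t) W = 0} ∩ Icc 0 T) := by
    have : {t | cut (Ioc 0 t) W = 0} ∩ Icc 0 T = {t | ∫ r in (0 : ℝ)..t, ‖W r‖ ^ 2 = 0} ∩ Icc 0 T := by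
      ext t
      simp only [mem_inter_iff, mem_ofPred_eq, and_congr_left_iff]
      intro ht
      rw [← norm_cut_Ioc_sq W ht.1]
      simp
    rw [this]
    exact (isClosed_eq (continuous_integral_norm_sq W 0) continuous_const).inter isClosed_Icc
  have hsub : Icc 0 T ⊆ {t | cut (Ioc 0 t) W = 0} := by
    refine hs.Icc_subset_of_forall_exists_gt ?_ ?_
    · rw [mem_ofPred_eq, ← norm_eq_zero, ← sq_eq_zero_iff, norm_cut_Ioc_sq W le_rfl]
      simp
    · rintro a ⟨ha, ha0, haT⟩ c hc
      have ha : cut (Ioc 0 a) W = 0 := ha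
      have hε : 0 < 1 / (2 * (K.bound * ‖q‖) + 1) := by positivity
      obtain ⟨b, ⟨⟨⟨hbU, hbV⟩, hbc⟩, hbT⟩, hab⟩ := ((((exists_gt_norm_cut_lt U a hε).and
        (exists_gt_norm_cut_lt V a hε)).and (Ioc_mem_nhdsGT hc)).and
          (Ioc_mem_nhdsGT haT)).and self_mem_nhdsWithin |>.exists
      have hab : a < b := hab
      refine ⟨b, ?_, hbc⟩
      have hsum := cut_Ioc_add ha0 hab.le W
      rw [ha, zero_add] at hsum
      change cut (Ioc 0 b) W = 0
      rw [← hsum]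
      set R := cut (L := L) (p := 2) (Ioc a b) with hR
      have hIic : cut (Iic b) W = R W := by
        rw [← hW, cut_cut measurableSet_Iic measurableSet_Ioc, hW, hsum]
        congr 2
        ext x
        simp only [mem_inter_iff, mem_Iic, mem_Ioc]
        have := hbT.2
        constructor
        · rintro ⟨h1, h2, h3⟩; exact ⟨h2, h1⟩
        · rintro ⟨h1, h2⟩; exact ⟨h2, h1, h2.trans this⟩
      have hRR : ∀ f, R (R f) = R f := fun f => by
        rw [hR, cut_cut measurableSet_Ioc measurableSet_Ioc, inter_self]
      have hUR : q.holder 1 U (R W) = q.holder 1 (R U) (R W) := by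
        rw [hR, holder_cut_left q measurableSet_Ioc, ← holder_cut_right q measurableSet_Ioc,
          ← hR, hRR]
      have hVR : q.holder 1 (R W) V = q.holder 1 (R W) (R V) := by
        rw [hR, holder_cut_right q measurableSet_Ioc, ← holder_cut_left q measurableSet_Ioc,
          ← hR, hRR]
      -- The Duhamel term on `(a,b]` sees only times up to `b`, and `W` is zero up to `a`; hence all
      -- factors may be cut to `(a,b]`.
      have hRW : R W = R (K.duhamelL (q.holder 1 (R U) (R W) + q.holder 1 (R W) (R V))) := by
        conv_lhs => rw [hdiff]
        rw [hR, cut_cut measurableSet_Ioc measurableSet_Ioc, inter_eq_self_of_subset_left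
          (Ioc_subset_Ioc ha0 hbT.2), K.cut_duhamelL measurableSet_Ioc Ioc_subset_Iic_self,
          map_add, ← holder_cut_right q measurableSet_Iic, ← holder_cut_left q measurableSet_Iic,
          hIic, hUR, hVR]
      have hle : ‖R W‖ ≤ K.bound * ‖q‖ * (‖R U‖ + ‖R V‖) * ‖R W‖ := by
        conv_lhs => rw [hRW]
        refine (norm_cut_le measurableSet_Ioc _).trans ((K.norm_duhamelL_apply_le _).trans ?_)
        calc _ ≤ K.bound * (‖q‖ * ‖R U‖ * ‖R W‖ + ‖q‖ * ‖R W‖ * ‖R V‖) := by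
              gcongr
              exact (norm_add_le _ _).trans (add_le_add (q.norm_holder_apply_apply_le _ _)
                (q.norm_holder_apply_apply_le _ _))
          _ = _ := by ring
      have hlt : K.bound * ‖q‖ * (‖R U‖ + ‖R V‖) < 1 := by
        rw [lt_div_iff₀ (by positivity)] at hbU hbV
        nlinarith [norm_nonneg (R U), norm_nonneg (R V)]
      by_contra hne
      have := norm_pos_iff.2 hne
      nlinarith
  have := hsub (right_mem_Icc.2 hT)
  rw [mem_ofPred_eq, hW, hWdef, sub_eq_zero] at this
  exact this

end SmoothingKernel

end GNS

end

/-! ### The heat kernels `|ξ|^p exp(-4π²ντ|ξ|²)` on `L¹`. -/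

noncomputable section

namespace GNS

open Filter Topology

/-- Dominated convergence. The symbols converge only pointwise, so the operators converge strongly
and not necessarily in norm. -/
theorem tendsto_mulLp {α E ι : Type*} [MeasurableSpace α] {μ : Measure α} [NormedAddCommGroup E]
    [NormedSpace ℂ E] {l : Filter ι} [l.IsCountablyGenerated] {σ : ι → α → ℂ} {σ' : α → ℂ}
    (hσ : ∀ i, MemLp (σ i) ∞ μ) (hσ' : MemLp σ' ∞ μ) {C : ℝ} (hC : ∀ᶠ i in l, ∀ x, ‖σ i x‖ ≤ C)
    (hC' : ∀ x, ‖σ' x‖ ≤ C) (h : ∀ x, Tendsto (fun i => σ i x) l (𝓝 (σ' x))) (f : Lp E 1 μ) :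
    Tendsto (fun i => mulLp E μ 1 (σ i) f) l (𝓝 (mulLp E μ 1 σ' f)) := by
  rw [tendsto_iff_norm_sub_tendsto_zero]
  have heq : ∀ i, ‖mulLp E μ 1 (σ i) f - mulLp E μ 1 σ' f‖ = ∫ x, ‖(σ i x - σ' x) • f x‖ ∂μ := by
    intro i
    rw [L1.norm_eq_integral_norm]
    refine integral_congr_ae ?_
    filter_upwards [Lp.coeFn_sub (mulLp E μ 1 (σ i) f) (mulLp E μ 1 σ' f), coeFn_mulLp (hσ i) f,
      coeFn_mulLp hσ' f] with x h1 h2 h3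
    rw [h1, Pi.sub_apply, h2, h3, sub_smul]
  simp only [heq]
  have hf : Integrable f μ := L1.integrable_coeFn f
  have h0 : (0 : ℝ) = ∫ x, (0 : ℝ) ∂μ := by simp
  rw [h0]
  refine tendsto_integral_filter_of_dominated_convergence (fun x => (C + C) * ‖f x‖) ?_ ?_ ?_ ?_
  · exact Eventually.of_forall fun i =>
      (((hσ i).1.sub hσ'.1).smul hf.aestronglyMeasurable).norm
  · filter_upwards [hC] with i hi
    refine Eventually.of_forall fun x => ?_
    rw [norm_norm, norm_smul]
    gcongr
    exact (norm_sub_le _ _).trans (add_le_add (hi x) (hC' x))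
  · exact hf.norm.const_mul _
  · refine Eventually.of_forall fun x => ?_
    have := (((h x).sub_const (σ' x)).smul_const (f x)).norm
    simpa using this

/-- The Fourier transforms of the fields under consideration, suitably weighted, lie in this
space. -/
abbrev FL : Type := Lp C3 1 (volume : Measure R3)

instance : SecondCountableTopology FL :=
  haveI : Fact ((1 : ℝ≥0∞) ≠ ∞) := ⟨ENNReal.one_ne_top⟩
  Lp.SecondCountableTopology

/-- The symbol of `e^{τΔ}`. -/
def gauss (τ : ℝ) (ξ : R3) : ℝ := Real.exp (-τ * (2 * Real.pi * ‖ξ‖) ^ 2)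

theorem gauss_pos (τ : ℝ) (ξ : R3) : 0 < gauss τ ξ := Real.exp_pos _

theorem gauss_le_one {τ : ℝ} (hτ : 0 ≤ τ) (ξ : R3) : gauss τ ξ ≤ 1 := by
  rw [gauss, Real.exp_le_one_iff, neg_mul, neg_nonpos]
  positivity

theorem continuous_gauss : Continuous fun z : ℝ × R3 => gauss z.1 z.2 := by
  unfold gauss
  fun_prop

/-- A crude bound: it only shows that the symbols are bounded, locally uniformly in positive time.
The constants that matter come from `lintegral_mul_exp_le`. -/
theorem norm_pow_mul_gauss_le {τ : ℝ} (hτ : 0 < τ) {p : ℕ} (hp : p ≤ 2) (ξ : R3) :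
    ‖ξ‖ ^ p * gauss τ ξ ≤ 1 + 1 / τ := by
  have h1 : ‖ξ‖ ^ p ≤ 1 + ‖ξ‖ ^ 2 := by
    rcases le_total ‖ξ‖ 1 with h | h
    · have := pow_le_one₀ (norm_nonneg ξ) h (n := p)
      nlinarith [sq_nonneg ‖ξ‖]
    · have := pow_le_pow_right₀ h hp
      linarith
  have h2 : ‖ξ‖ ^ 2 * gauss τ ξ ≤ 1 / τ := by
    rw [gauss, neg_mul, Real.exp_neg, ← div_eq_mul_inv, div_le_iff₀ (Real.exp_pos _)]
    have h3 := Real.add_one_le_exp (τ * (2 * Real.pi * ‖ξ‖) ^ 2)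
    have h4 : τ * ‖ξ‖ ^ 2 ≤ τ * (2 * Real.pi * ‖ξ‖) ^ 2 := by
      rw [mul_pow]
      have : 1 ≤ (2 * Real.pi) ^ 2 := by nlinarith [Real.pi_gt_three]
      nlinarith [mul_nonneg hτ.le (sq_nonneg ‖ξ‖)]
    rw [one_div, ← div_eq_inv_mul, le_div_iff₀ hτ]
    linarith
  calc _ ≤ (1 + ‖ξ‖ ^ 2) * gauss τ ξ := by gcongr; exact (gauss_pos _ _).le
    _ ≤ _ := by linarith [gauss_le_one hτ.le ξ]

/-- The symbol `|ξ|^p e^{-ντ(2π|ξ|)²}`, for positive times. -/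
def sym (ν : ℝ) (p : ℕ) (τ : ℝ) (ξ : R3) : ℂ :=
  if 0 < τ then ((‖ξ‖ ^ p * gauss (ν * τ) ξ : ℝ) : ℂ) else 0

theorem sym_of_pos (ν : ℝ) (p : ℕ) {τ : ℝ} (hτ : 0 < τ) (ξ : R3) :
    sym ν p τ ξ = ((‖ξ‖ ^ p * gauss (ν * τ) ξ : ℝ) : ℂ) := if_pos hτ

theorem sym_of_nonpos (ν : ℝ) (p : ℕ) {τ : ℝ} (hτ : τ ≤ 0) : sym ν p τ = 0 := by
  ext1 ξ
  exact if_neg (not_lt.2 hτ)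

theorem norm_sym_of_pos (ν : ℝ) (p : ℕ) {τ : ℝ} (hτ : 0 < τ) (ξ : R3) :
    ‖sym ν p τ ξ‖ = ‖ξ‖ ^ p * gauss (ν * τ) ξ := by
  rw [sym_of_pos ν p hτ, Complex.norm_real, Real.norm_of_nonneg]
  exact mul_nonneg (by positivity) (gauss_pos _ _).le

theorem measurable_sym (ν : ℝ) (p : ℕ) : Measurable fun z : ℝ × R3 => sym ν p z.1 z.2 := by
  refine Measurable.ite (measurable_fst measurableSet_Ioi) ?_ measurable_const
  refine Complex.measurable_ofReal.comp ?_
  have : Continuous fun z : ℝ × R3 => gauss (ν * z.1) z.2 :=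
    continuous_gauss.comp (by fun_prop : Continuous fun z : ℝ × R3 => (ν * z.1, z.2))
  exact (by fun_prop : Continuous fun z : ℝ × R3 => ‖z.2‖ ^ p * gauss (ν * z.1) z.2).measurable

variable {ν : ℝ} {p : ℕ}

theorem norm_sym_le (hν : 0 < ν) (hp : p ≤ 2) {τ₀ τ : ℝ} (hτ₀ : 0 < τ₀) (hτ : τ₀ ≤ τ) (ξ : R3) :
    ‖sym ν p τ ξ‖ ≤ 1 + 1 / (ν * τ₀) := by
  rw [norm_sym_of_pos ν p (hτ₀.trans_le hτ)]
  refine (norm_pow_mul_gauss_le (mul_pos hν (hτ₀.trans_le hτ)) hp ξ).trans ?_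
  gcongr

theorem memLp_sym (hν : 0 < ν) (hp : p ≤ 2) (τ : ℝ) : MemLp (sym ν p τ) ∞ := by
  rcases le_or_gt τ 0 with hτ | hτ
  · rw [sym_of_nonpos ν p hτ]; exact MemLp.zero
  · refine memLp_top_of_bound
      ((measurable_sym ν p).comp measurable_prodMk_left).aestronglyMeasurable (1 + 1 / (ν * τ))
      (Eventually.of_forall fun ξ => norm_sym_le hν hp hτ le_rfl ξ)

/-- The operators with symbol `|ξ|^p e^{-ντ(2π|ξ|)²}`, for positive times. -/
def kernelOp (ν : ℝ) (p : ℕ) (τ : ℝ) : FL →L[ℂ] FL := mulLp C3 volume 1 (sym ν p τ)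

theorem kernelOp_of_nonpos (ν : ℝ) (p : ℕ) {τ : ℝ} (hτ : τ ≤ 0) : kernelOp ν p τ = 0 := by
  rw [kernelOp, sym_of_nonpos ν p hτ, mulLp_zero]

theorem coeFn_kernelOp (hν : 0 < ν) (hp : p ≤ 2) (τ : ℝ) (f : FL) :
    kernelOp ν p τ f =ᵐ[volume] fun ξ => sym ν p τ ξ • f ξ :=
  coeFn_mulLp (memLp_sym hν hp τ) f

theorem enorm_kernelOp (hν : 0 < ν) (hp : p ≤ 2) (τ : ℝ) (f : FL) :
    ‖kernelOp ν p τ f‖ₑ = ∫⁻ ξ, ‖sym ν p τ ξ‖ₑ * ‖f ξ‖ₑ := by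
  rw [Lp.enorm_def, eLpNorm_one_eq_lintegral_enorm]
  refine lintegral_congr_ae ?_
  filter_upwards [coeFn_kernelOp hν hp τ f] with ξ h
  rw [h, enorm_smul]

theorem continuousAt_kernelOp (hν : 0 < ν) (hp : p ≤ 2) (f : FL) {τ : ℝ} (hτ : 0 < τ) :
    ContinuousAt (fun τ => kernelOp ν p τ f) τ := by
  refine tendsto_mulLp (memLp_sym hν hp) (memLp_sym hν hp τ) (C := 1 + 1 / (ν * (τ / 2))) ?_ ?_ ?_ f
  · filter_upwards [lt_mem_nhds (half_lt_self hτ)] with r hr ξ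
    exact norm_sym_le hν hp (half_pos hτ) hr.le ξ
  · exact fun ξ => norm_sym_le hν hp (half_pos hτ) (half_lt_self hτ).le ξ
  · intro ξ
    have h : Continuous fun r : ℝ => ((‖ξ‖ ^ p * gauss (ν * r) ξ : ℝ) : ℂ) := by
      unfold gauss
      fun_prop
    have := h.tendsto τ
    rw [sym_of_pos ν p hτ]
    refine this.congr' ?_
    filter_upwards [lt_mem_nhds hτ] with r hr
    rw [sym_of_pos ν p hr]

theorem stronglyMeasurable_kernelOp (hν : 0 < ν) (hp : p ≤ 2) (f : FL) :
    StronglyMeasurable fun τ => kernelOp ν p τ f := by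
  borelize FL
  refine Measurable.stronglyMeasurable ?_
  have h : (fun τ => kernelOp ν p τ f) =
      (Ioi (0 : ℝ)).piecewise (fun τ => kernelOp ν p τ f) (fun _ => 0) := by
    ext1 τ
    by_cases hτ : τ ∈ Ioi (0 : ℝ)
    · simp [hτ]
    · rw [piecewise_eq_of_notMem _ _ _ hτ, kernelOp_of_nonpos ν p (not_lt.1 hτ), zero_apply]
  rw [h]
  refine ContinuousOn.measurable_piecewise ?_ continuousOn_const measurableSet_Ioi
  exact fun τ hτ => (continuousAt_kernelOp hν hp f hτ).continuousWithinAt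

/-- Parabolic scaling: the integral does not depend on `x > 0`. With `x = |ξ|²` it bounds all
frequencies at once. -/
theorem lintegral_mul_exp_le {b x : ℝ} (hb : 0 < b) (hx : 0 ≤ x) :
    ∫⁻ τ in Ioi (0 : ℝ), ENNReal.ofReal (x * Real.exp (-(b * x) * τ)) ≤ ENNReal.ofReal (1 / b) := by
  rcases hx.eq_or_lt with rfl | hx
  · simp
  have hbx : -(b * x) < 0 := neg_neg_of_pos (mul_pos hb hx)
  rw [← ofReal_integral_eq_lintegral_ofReal ((integrableOn_exp_mul_Ioi hbx 0).const_mul x)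
    (Eventually.of_forall fun τ => by positivity), integral_const_mul, integral_exp_mul_Ioi hbx]
  refine ENNReal.ofReal_le_ofReal (le_of_eq ?_)
  simp
  field_simp

theorem lintegral_Ioi_eq {h : ℝ → ℝ≥0∞} (h0 : ∀ τ ≤ 0, h τ = 0) :
    ∫⁻ τ, h τ = ∫⁻ τ in Ioi (0 : ℝ), h τ := by
  rw [← lintegral_indicator measurableSet_Ioi]
  refine lintegral_congr fun τ => ?_
  by_cases hτ : τ ∈ Ioi (0 : ℝ)
  · simp [hτ]
  · rw [indicator_of_notMem hτ, h0 τ (not_lt.1 hτ)]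

/-- Squaring doubles the exponent `4π²ν|ξ|²τ`, whence the constant `8π²ν`. -/
theorem lintegral_sym_one_sq_le (hν : 0 < ν) (ξ : R3) :
    ∫⁻ τ, ‖sym ν 1 τ ξ‖ₑ ^ 2 ≤ ENNReal.ofReal (1 / (8 * Real.pi ^ 2 * ν)) := by
  rw [lintegral_Ioi_eq fun τ hτ => by simp [sym_of_nonpos ν 1 hτ]]
  refine le_trans (le_of_eq (setLIntegral_congr_fun measurableSet_Ioi fun τ hτ => ?_))
    (lintegral_mul_exp_le (b := 8 * Real.pi ^ 2 * ν) (by positivity) (sq_nonneg ‖ξ‖))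
  rw [← ofReal_norm, ← ENNReal.ofReal_pow (norm_nonneg _), norm_sym_of_pos ν 1 hτ, gauss,
    pow_one, mul_pow, ← Real.exp_nat_mul]
  congr 3
  push_cast
  ring

theorem lintegral_sym_two_le (hν : 0 < ν) (ξ : R3) :
    ∫⁻ τ, ‖sym ν 2 τ ξ‖ₑ ≤ ENNReal.ofReal (1 / (4 * Real.pi ^ 2 * ν)) := by
  rw [lintegral_Ioi_eq fun τ hτ => by simp [sym_of_nonpos ν 2 hτ]]
  refine le_trans (le_of_eq (setLIntegral_congr_fun measurableSet_Ioi fun τ hτ => ?_))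
    (lintegral_mul_exp_le (b := 4 * Real.pi ^ 2 * ν) (by positivity) (sq_nonneg ‖ξ‖))
  rw [← ofReal_norm, norm_sym_of_pos ν 2 hτ, gauss]
  congr 3
  ring

theorem aemeasurable_sym_mul (ν : ℝ) (p : ℕ) (f : FL) :
    AEMeasurable (Function.uncurry fun (τ : ℝ) (ξ : R3) => ‖sym ν p τ ξ‖ₑ * ‖f ξ‖ₑ)
      (volume.prod volume) :=
  (measurable_sym ν p).enorm.aemeasurable.mul
    ((Lp.aestronglyMeasurable f).enorm.comp_quasiMeasurePreserving
      Measure.quasiMeasurePreserving_snd)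

/-- Minkowski's inequality with the frequency as the outer variable: the `L²` norm in time is taken
first, for each `ξ`. -/
theorem lintegral_kernelOp_one_sq_le (hν : 0 < ν) (f : FL) :
    ∫⁻ τ, ‖kernelOp ν 1 τ f‖ₑ ^ 2 ≤
      (((√(1 / (8 * Real.pi ^ 2 * ν))).toNNReal : ℝ≥0∞) * ‖f‖ₑ) ^ 2 := by
  simp only [enorm_kernelOp hν one_le_two]
  rw [Lp.enorm_def f, eLpNorm_one_eq_lintegral_enorm,
    ← lintegral_const_mul'' _ (Lp.aestronglyMeasurable f).enorm]
  refine lintegral_sq_lintegral_le (aemeasurable_sym_mul ν 1 f)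
    ((Lp.aestronglyMeasurable f).enorm.const_mul _) (Eventually.of_forall fun ξ => ?_)
  simp only [mul_pow]
  rw [lintegral_mul_const']
  · gcongr
    refine (lintegral_sym_one_sq_le hν ξ).trans (le_of_eq ?_)
    change _ = ENNReal.ofReal _ ^ 2
    rw [← ENNReal.ofReal_pow (Real.sqrt_nonneg _), Real.sq_sqrt (by positivity)]
  · exact ENNReal.pow_ne_top enorm_ne_top

theorem lintegral_kernelOp_two_le (hν : 0 < ν) (f : FL) :
    ∫⁻ τ, ‖kernelOp ν 2 τ f‖ₑ ≤ ENNReal.ofReal (1 / (4 * Real.pi ^ 2 * ν)) * ‖f‖ₑ := by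
  simp only [enorm_kernelOp hν le_rfl]
  rw [lintegral_lintegral_swap (aemeasurable_sym_mul ν 2 f), Lp.enorm_def f,
    eLpNorm_one_eq_lintegral_enorm, ← lintegral_const_mul'' _ (Lp.aestronglyMeasurable f).enorm]
  refine lintegral_mono fun ξ => ?_
  rw [lintegral_mul_const' _ _ enorm_ne_top]
  gcongr
  exact lintegral_sym_two_le hν ξ

/-- The kernel `|∇| e^{ντΔ}`. -/
def heatKernel (hν : 0 < ν) : SmoothingKernel FL where
  op := kernelOp ν 1
  bound := (√(1 / (8 * Real.pi ^ 2 * ν))).toNNReal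
  stronglyMeasurable := stronglyMeasurable_kernelOp hν one_le_two
  causal _ hτ := kernelOp_of_nonpos ν 1 hτ
  lintegral_le := lintegral_kernelOp_one_sq_le hν

end GNS

end

noncomputable section

namespace GNS

open Filter Topology
open scoped Convolution

/-! ### Convolution and the bilinear operator on `L¹`. -/

section Convolution

/-- Convolution of complex functions. -/
abbrev conv (f g : R3 → ℂ) : R3 → ℂ := f ⋆[ContinuousLinearMap.mul ℂ ℂ, volume] g

theorem integrable_conv {f g : R3 → ℂ} (hf : Integrable f) (hg : Integrable g) :
    Integrable (conv f g) :=
  hf.integrable_convolution _ hg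

theorem conv_congr {f f' g g' : R3 → ℂ} (hf : f =ᵐ[volume] f') (hg : g =ᵐ[volume] g') :
    conv f g = conv f' g' :=
  convolution_congr _ hf hg

theorem integral_norm_conv_le {f g : R3 → ℂ} (hf : Integrable f) (hg : Integrable g) :
    ∫ ξ, ‖conv f g ξ‖ ≤ (∫ ξ, ‖f ξ‖) * ∫ ξ, ‖g ξ‖ := by
  have h := integral_convolution (ContinuousLinearMap.mul ℝ ℝ) hf.norm hg.norm
    (μ := (volume : Measure R3)) (ν := volume)
  rw [ContinuousLinearMap.mul_apply'] at h
  rw [← h]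
  refine integral_mono (integrable_conv hf hg).norm (hf.norm.integrable_convolution _ hg.norm)
    fun ξ => ?_
  refine (norm_integral_le_integral_norm _).trans (le_of_eq ?_)
  simp [convolution_def]

/-- Convolution on `L¹`. -/
def convL : Lp ℂ 1 (volume : Measure R3) →L[ℂ] Lp ℂ 1 (volume : Measure R3) →L[ℂ]
    Lp ℂ 1 (volume : Measure R3) :=
  LinearMap.mkContinuous₂
    (LinearMap.mk₂ ℂ (fun f g => (integrable_conv (L1.integrable_coeFn f)
        (L1.integrable_coeFn g)).toL1 (conv f g))
      (fun f f' g => by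
        rw [← Integrable.toL1_add, Integrable.toL1_eq_toL1_iff, conv_congr (Lp.coeFn_add f f')
          (ae_eq_refl g)]
        -- The convolution integrals of `L¹` functions converge only almost everywhere, so
        -- additivity holds only there.
        filter_upwards [(L1.integrable_coeFn f).ae_convolution_exists
          (ContinuousLinearMap.mul ℂ ℂ) (L1.integrable_coeFn g),
          (L1.integrable_coeFn f').ae_convolution_exists
          (ContinuousLinearMap.mul ℂ ℂ) (L1.integrable_coeFn g)] with x h1 h2
        exact h1.add_distrib h2)
      (fun c f g => by
        rw [← Integrable.toL1_smul, Integrable.toL1_eq_toL1_iff, conv_congr (Lp.coeFn_smul c f)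
          (ae_eq_refl g), conv, smul_convolution]
        exact ae_eq_refl _)
      (fun f g g' => by
        rw [← Integrable.toL1_add, Integrable.toL1_eq_toL1_iff, conv_congr (ae_eq_refl f)
          (Lp.coeFn_add g g')]
        filter_upwards [(L1.integrable_coeFn f).ae_convolution_exists
          (ContinuousLinearMap.mul ℂ ℂ) (L1.integrable_coeFn g),
          (L1.integrable_coeFn f).ae_convolution_exists
          (ContinuousLinearMap.mul ℂ ℂ) (L1.integrable_coeFn g')] with x h1 h2
        exact h1.distrib_add h2)
      (fun c f g => by
        rw [← Integrable.toL1_smul, Integrable.toL1_eq_toL1_iff, conv_congr (ae_eq_refl f)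
          (Lp.coeFn_smul c g), conv, convolution_smul]
        exact ae_eq_refl _))
    1 (fun f g => by
      rw [LinearMap.mk₂_apply, one_mul, L1.norm_eq_integral_norm, L1.norm_eq_integral_norm,
        L1.norm_eq_integral_norm]
      refine le_trans (le_of_eq (integral_congr_ae ?_))
        (integral_norm_conv_le (L1.integrable_coeFn f) (L1.integrable_coeFn g))
      filter_upwards [Integrable.coeFn_toL1 (integrable_conv (L1.integrable_coeFn f)
        (L1.integrable_coeFn g))] with x hx
      rw [hx])

theorem coeFn_convL (f g : Lp ℂ 1 (volume : Measure R3)) :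
    convL f g =ᵐ[volume] conv f g :=
  Integrable.coeFn_toL1 (integrable_conv (L1.integrable_coeFn f) (L1.integrable_coeFn g))

end Convolution

/-- The symbol of the operator of order zero `|∇|⁻¹ ∑_m q^{j,m}_{k,l} ∂_m`. -/
def qSym (a : Coeffs) (j k l : Fin 3) (ξ : R3) : ℂ :=
  ∑ m, ∑ n, ∑ p, (a j m p n k l : ℂ) *
    (2 * Real.pi * Complex.I * ((ξ m * ξ n * ξ p / ‖ξ‖ ^ 3 : ℝ) : ℂ))

theorem abs_coord_le (ξ : R3) (m : Fin 3) : |ξ m| ≤ ‖ξ‖ := PiLp.norm_apply_le ξ m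

theorem measurable_qSym (a : Coeffs) (j k l : Fin 3) : Measurable (qSym a j k l) := by
  unfold qSym
  fun_prop

theorem memLp_qSym (a : Coeffs) (j k l : Fin 3) : MemLp (qSym a j k l) ∞ := by
  refine memLp_top_of_bound (measurable_qSym a j k l).aestronglyMeasurable
    (∑ m, ∑ n, ∑ p, |a j m p n k l| * (2 * Real.pi)) (Eventually.of_forall fun ξ => ?_)
  refine norm_sum_le_of_le _ fun m _ => norm_sum_le_of_le _ fun n _ => norm_sum_le_of_le _
    fun p _ => ?_
  rw [norm_mul, Complex.norm_real, Real.norm_eq_abs]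
  gcongr
  rw [norm_mul, Complex.norm_real, Real.norm_eq_abs, norm_mul, Complex.norm_I, mul_one,
    norm_mul, Complex.norm_real, Real.norm_of_nonneg Real.pi_pos.le, Complex.norm_ofNat]
  have h : |ξ m * ξ n * ξ p / ‖ξ‖ ^ 3| ≤ 1 := by
    rw [abs_div, abs_mul, abs_mul, abs_of_nonneg (by positivity : 0 ≤ ‖ξ‖ ^ 3)]
    refine div_le_one_of_le₀ ?_ (by positivity)
    calc |ξ m| * |ξ n| * |ξ p| ≤ ‖ξ‖ * ‖ξ‖ * ‖ξ‖ := by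
          gcongr <;> exact abs_coord_le _ _
      _ = ‖ξ‖ ^ 3 := by ring
  exact mul_le_of_le_one_right (by positivity) h

/-- The `k`-th component of the elements of `FL`. -/
def compL (k : Fin 3) : FL →L[ℂ] Lp ℂ 1 (volume : Measure R3) :=
  (EuclideanSpace.proj k : C3 →L[ℂ] ℂ).compLpL 1 volume

theorem coeFn_compL (k : Fin 3) (U : FL) : compL k U =ᵐ[volume] fun ξ => U ξ k :=
  (EuclideanSpace.proj k : C3 →L[ℂ] ℂ).coeFn_compLpL U

/-- The vector field with the `j`-th component given and the others zero. -/
def singleL (j : Fin 3) : Lp ℂ 1 (volume : Measure R3) →L[ℂ] FL :=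
  (ContinuousLinearMap.toSpanSingleton ℂ (EuclideanSpace.single j (1 : ℂ))).compLpL 1 volume

theorem coeFn_singleL (j : Fin 3) (f : Lp ℂ 1 (volume : Measure R3)) :
    singleL j f =ᵐ[volume] fun ξ => f ξ • EuclideanSpace.single j (1 : ℂ) :=
  (ContinuousLinearMap.toSpanSingleton ℂ (EuclideanSpace.single j (1 : ℂ))).coeFn_compLpL f

/-- The bilinear operator `|∇|⁻¹ Q` on the Fourier side. -/
def qL (a : Coeffs) : FL →L[ℂ] FL →L[ℂ] FL :=
  ∑ j, ∑ k, ∑ l, (ContinuousLinearMap.compL ℂ _ _ _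
    (singleL j ∘L mulLp ℂ volume 1 (qSym a j k l))) ∘L convL.bilinearComp (compL k) (compL l)

theorem qL_apply (a : Coeffs) (U V : FL) :
    qL a U V = ∑ j, ∑ k, ∑ l,
      singleL j (mulLp ℂ volume 1 (qSym a j k l) (convL (compL k U) (compL l V))) := by
  simp only [qL, sum_apply]
  rfl

theorem coeFn_sum {ι α E : Type*} [MeasurableSpace α] {μ : Measure α} [NormedAddCommGroup E]
    {p : ℝ≥0∞} (s : Finset ι) (f : ι → Lp E p μ) :
    (∑ i ∈ s, f i : Lp E p μ) =ᵐ[μ] fun x => ∑ i ∈ s, f i x := by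
  classical
  induction s using Finset.induction_on with
  | empty => simp only [Finset.sum_empty]; exact Lp.coeFn_zero E p μ
  | insert i s hi ih =>
    rw [Finset.sum_insert hi]
    filter_upwards [Lp.coeFn_add (f i) (∑ i ∈ s, f i), ih] with x h1 h2
    rw [h1, Pi.add_apply, h2, Finset.sum_insert hi]

theorem coeFn_qL (a : Coeffs) (U V : FL) (j : Fin 3) :
    (fun ξ => qL a U V ξ j) =ᵐ[volume] fun ξ => ∑ k, ∑ l,
      qSym a j k l ξ * conv (fun ξ => U ξ k) (fun ξ => V ξ l) ξ := by
  have h1 : ∀ i k l, ∀ᵐ ξ : R3,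
      singleL i (mulLp ℂ volume 1 (qSym a i k l) (convL (compL k U) (compL l V))) ξ =
        (qSym a i k l ξ * conv (fun ξ => U ξ k) (fun ξ => V ξ l) ξ) •
          EuclideanSpace.single i (1 : ℂ) := by
    intro i k l
    filter_upwards [coeFn_singleL i (mulLp ℂ volume 1 (qSym a i k l)
      (convL (compL k U) (compL l V))), coeFn_mulLp (memLp_qSym a i k l)
      (convL (compL k U) (compL l V)), coeFn_convL (compL k U) (compL l V)] with ξ h1 h2 h3
    rw [h1, h2, h3, conv_congr (coeFn_compL k U) (coeFn_compL l V), smul_eq_mul]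
  have h1' : ∀ᵐ ξ : R3, ∀ i k l,
      singleL i (mulLp ℂ volume 1 (qSym a i k l) (convL (compL k U) (compL l V))) ξ =
        (qSym a i k l ξ * conv (fun ξ => U ξ k) (fun ξ => V ξ l) ξ) •
          EuclideanSpace.single i (1 : ℂ) := by
    simp only [ae_all_iff]
    exact h1
  have h2 : ∀ᵐ ξ : R3, ∀ i k, (∑ l, singleL i (mulLp ℂ volume 1 (qSym a i k l)
      (convL (compL k U) (compL l V))) : FL) ξ = ∑ l, singleL i (mulLp ℂ volume 1 (qSym a i k l)
      (convL (compL k U) (compL l V))) ξ := by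
    simp only [ae_all_iff]
    exact fun i k => coeFn_sum _ _
  have h3 : ∀ᵐ ξ : R3, ∀ i, (∑ k, ∑ l, singleL i (mulLp ℂ volume 1 (qSym a i k l)
      (convL (compL k U) (compL l V))) : FL) ξ = ∑ k, (∑ l, singleL i (mulLp ℂ volume 1
        (qSym a i k l) (convL (compL k U) (compL l V))) : FL) ξ := by
    simp only [ae_all_iff]
    exact fun i => coeFn_sum _ _
  rw [qL_apply]
  filter_upwards [h1', h2, h3, coeFn_sum Finset.univ fun i => (∑ k, ∑ l, singleL i (mulLp ℂ volume 1
    (qSym a i k l) (convL (compL k U) (compL l V))) : FL)] with ξ h1 h2 h3 h4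
  rw [h4]
  simp only [h3, h2, h1, ← Finset.sum_smul]
  simp [Pi.single_apply]

end GNS

end

noncomputable section

namespace GNS

open Filter Topology
open scoped Convolution

/-! ### Distributions given by functions, and their Fourier transforms. -/

section Represents

variable {F : Type*} [NormedAddCommGroup F] [NormedSpace ℂ F]

theorem Represents.congr {T : 𝓢'(R3, F)} {g h : R3 → F} (hg : Represents T g)
    (hgh : g =ᵐ[volume] h) : Represents T h := by
  refine ⟨hg.1.congr hgh, fun φ => (hg.2.1 φ).congr ?_, fun φ => ?_⟩
  · filter_upwards [hgh] with x hx
    rw [hx]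
  · rw [hg.2.2 φ]
    refine integral_congr_ae ?_
    filter_upwards [hgh] with x hx
    rw [hx]

theorem Represents.unique {T S : 𝓢'(R3, F)} {g : R3 → F} (hT : Represents T g)
    (hS : Represents S g) : T = S := by
  ext φ
  rw [hT.2.2, hS.2.2]

theorem funOf_ae_eq [CompleteSpace F] {T : 𝓢'(R3, F)} {g : R3 → F} (hT : Represents T g) :
    funOf T =ᵐ[volume] g := by
  have h : ∃ g, Represents T g := ⟨g, hT⟩
  rw [funOf, dif_pos h]
  exact h.choose_spec.ae_eq hT

theorem represents_funOf {T : 𝓢'(R3, F)} (h : ∃ g, Represents T g) : Represents T (funOf T) := by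
  rw [funOf, dif_pos h]
  exact h.choose_spec

theorem distOf_eq {T : 𝓢'(R3, F)} {g : R3 → F} (hT : Represents T g) : distOf g = T := by
  have h : ∃ T, Represents T g := ⟨T, hT⟩
  rw [distOf, dif_pos h]
  exact h.choose_spec.unique hT

theorem Represents.sum {ι : Type*} (s : Finset ι) {T : ι → 𝓢'(R3, F)} {g : ι → R3 → F}
    (h : ∀ i ∈ s, Represents (T i) (g i)) : Represents (∑ i ∈ s, T i) (∑ i ∈ s, g i) := by
  classical
  induction s using Finset.induction_on with
  | empty => simpa using Represents.zero
  | insert i s hi ih =>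
    rw [Finset.sum_insert hi, Finset.sum_insert hi]
    exact (h i (Finset.mem_insert_self i s)).add (ih fun j hj => h j (Finset.mem_insert_of_mem hj))

theorem Represents.smulLeft {T : 𝓢'(R3, F)} {g : R3 → F} (hT : Represents T g) {w : R3 → ℂ}
    (hw : w.HasTemperateGrowth) :
    Represents (TemperedDistribution.smulLeftCLM F w T) (fun ξ => w ξ • g ξ) := by
  have key : ∀ φ : 𝓢(R3, ℂ), (fun x => φ x • w x • g x) =
      fun x => SchwartzMap.smulLeftCLM ℂ w φ x • g x := by
    intro φ
    ext1 x
    rw [SchwartzMap.smulLeftCLM_apply_apply hw, smul_smul, smul_eq_mul, mul_comm]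
  refine ⟨?_, fun φ => ?_, fun φ => ?_⟩
  · exact hT.1.continuous_smul hw.1.continuous
  · rw [key φ]; exact hT.2.1 _
  · rw [key φ, TemperedDistribution.smulLeftCLM_apply_apply]; exact hT.2.2 _

theorem apply_eq_of_represents_fourier {T : 𝓢'(R3, F)} {g : R3 → F} (hT : Represents (𝓕 T) g)
    (φ : 𝓢(R3, ℂ)) : T φ = ∫ ξ, (𝓕⁻ φ) ξ • g ξ := by
  rw [← hT.2.2, TemperedDistribution.fourier_apply, FourierTransform.fourier_fourierInv_eq]

theorem continuous_fourierInv {f : R3 → F} (hf : Integrable f) : Continuous (𝓕⁻ f) := by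
  refine VectorFourier.fourierIntegral_continuous Real.continuous_fourierChar ?_ hf
  simp only [LinearMap.neg_apply, innerₗ_apply_apply]
  fun_prop

theorem norm_fourierInv_le (f : R3 → F) (x : R3) : ‖(𝓕⁻ f) x‖ ≤ ∫ ξ, ‖f ξ‖ :=
  VectorFourier.norm_fourierIntegral_le_integral_norm _ _ _ _ _

theorem memLp_top_fourierInv {f : R3 → F} (hf : Integrable f) : MemLp (𝓕⁻ f) ∞ :=
  memLp_top_of_bound (continuous_fourierInv hf).aestronglyMeasurable _
    (Eventually.of_forall (norm_fourierInv_le f))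

variable [CompleteSpace F]

theorem represents_toTemperedDistribution {p : ℝ≥0∞} [hp : Fact (1 ≤ p)]
    (f : Lp F p (volume : Measure R3)) :
    Represents (Lp.toTemperedDistribution f) f := by
  refine ⟨(Lp.memLp f).locallyIntegrable hp.out, fun φ => ?_,
    fun φ => Lp.toTemperedDistribution_apply f φ⟩
  have := ENNReal.HolderConjugate.inv_one_sub_inv' hp.out
  rw [← memLp_one_iff_integrable]
  exact (Lp.memLp f).smul (φ.memLp (1 - p⁻¹)⁻¹ volume)

theorem exists_represents_of_memLp {p : ℝ≥0∞} (hp : 1 ≤ p) {g : R3 → F} (hg : MemLp g p) :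
    ∃ T, Represents T g :=
  haveI : Fact (1 ≤ p) := ⟨hp⟩
  ⟨_, (represents_toTemperedDistribution hg.toLp).congr hg.coeFn_toLp⟩

/-- A function of at most quadratic growth, in the mean, defines a tempered distribution. -/
theorem exists_represents_of_integrable {g : R3 → F}
    (hg : Integrable fun ξ => (1 + ‖ξ‖ ^ 2)⁻¹ • g ξ) : ∃ T, Represents T g := by
  obtain ⟨T, hT⟩ := exists_represents_of_memLp le_rfl (memLp_one_iff_integrable.2 hg)
  have hw : (fun ξ : R3 => ((1 + ‖ξ‖ ^ 2 : ℝ) : ℂ)).HasTemperateGrowth := by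
    have : (fun ξ : R3 => 1 + ‖ξ‖ ^ 2).HasTemperateGrowth :=
      (Function.HasTemperateGrowth.const (1 : ℝ)).add (Function.hasTemperateGrowth_norm_sq R3)
    exact Function.Complex.hasTemperateGrowth_ofReal.comp this
  refine ⟨_, (hT.smulLeft hw).congr (Eventually.of_forall fun ξ => ?_)⟩
  simp only
  rw [Complex.coe_smul, smul_smul, mul_inv_cancel₀ (by positivity), one_smul]

theorem integral_fourierInv_smul_eq (f : R3 → F) (hf : Integrable f) (φ : 𝓢(R3, ℂ)) :
    ∫ ξ, (𝓕⁻ φ) ξ • f ξ = ∫ x, φ x • (𝓕⁻ f) x := by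
  rw [SchwartzMap.fourierInv_coe]
  -- The inverse transform is the Fourier integral for the symmetric form `-⟨x,ξ⟩`, so it is its own
  -- transpose.
  have hL : Continuous fun z : R3 × R3 => (-innerₗ R3) z.1 z.2 := by
    simp only [LinearMap.neg_apply, innerₗ_apply_apply]
    fun_prop
  have h := VectorFourier.integral_fourierIntegral_smul_eq_flip (μ := (volume : Measure R3))
    (ν := (volume : Measure R3)) (L := -innerₗ R3) Real.continuous_fourierChar hL
    (f := φ) (g := f) φ.integrable hf
  have hflip : (-innerₗ R3).flip = -innerₗ R3 := by
    ext x y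
    simp [real_inner_comm]
  rw [hflip] at h
  exact h

/-- A distribution with integrable Fourier transform is a bounded continuous function. -/
theorem represents_fourierInv {T : 𝓢'(R3, F)} {f : R3 → F} (hf : Integrable f)
    (hT : Represents (𝓕 T) f) : Represents T (𝓕⁻ f) := by
  obtain ⟨S, hS⟩ := exists_represents_of_memLp le_top (memLp_top_fourierInv hf)
  have : T = S := by
    ext φ
    rw [apply_eq_of_represents_fourier hT, integral_fourierInv_smul_eq f hf, hS.2.2]
  rwa [this]

theorem represents_fourier_of_fourierInv {T : 𝓢'(R3, F)} {f : R3 → F} (hf : Integrable f)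
    (hT : Represents T (𝓕⁻ f)) : Represents (𝓕 T) f := by
  obtain ⟨S, hS⟩ := exists_represents_of_memLp le_rfl (memLp_one_iff_integrable.2 hf)
  have : 𝓕 T = S := by
    ext φ
    rw [TemperedDistribution.fourier_apply, hT.2.2, ← integral_fourierInv_smul_eq f hf,
      FourierTransform.fourierInv_fourier_eq, hS.2.2]
  rwa [this]

end Represents

/-- The derivatives of `exp(-x)` are bounded by `1` on `[0,∞)` but are unbounded on `ℝ`; hence the
composition is taken on that half-line. -/
theorem hasTemperateGrowth_gauss {τ : ℝ} (hτ : 0 ≤ τ) :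
    (fun ξ : R3 => ((gauss τ ξ : ℝ) : ℂ)).HasTemperateGrowth := by
  have hf : (fun ξ : R3 => τ * (2 * Real.pi) ^ 2 * ‖ξ‖ ^ 2).HasTemperateGrowth :=
    (Function.HasTemperateGrowth.const _).mul (Function.hasTemperateGrowth_norm_sq R3)
  have hsm : ContDiff ℝ (⊤ : ℕ∞) fun x : ℝ => Real.exp (-x) := by fun_prop
  have h := hf.comp' (g := fun x : ℝ => Real.exp (-x)) (t := Ici 0)
    (by rintro _ ⟨ξ, rfl⟩; exact mem_Ici.2 (by positivity))
    (uniqueDiffOn_Ici 0) hsm.contDiffOn (fun N => by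
      refine ⟨0, 1, zero_le_one, fun n _ x hx => ?_⟩
      rw [norm_iteratedFDerivWithin_eq_norm_iteratedDerivWithin,
        iteratedDerivWithin_eq_iteratedDeriv (uniqueDiffOn_Ici 0)
          (hsm.contDiffAt.of_le (mod_cast le_top)) hx, iteratedDeriv_comp_neg, iteratedDeriv_eq_iterate,
        Real.iter_deriv_exp]
      have : Real.exp (-x) ≤ 1 := by simpa using hx
      simpa using this)
  have h2 := Function.Complex.hasTemperateGrowth_ofReal.comp h
  have heq : (fun ξ : R3 => ((gauss τ ξ : ℝ) : ℂ)) = Complex.ofReal ∘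
      (fun x : ℝ => Real.exp (-x)) ∘ fun ξ : R3 => τ * (2 * Real.pi) ^ 2 * ‖ξ‖ ^ 2 := by
    ext1 ξ
    simp only [gauss, Function.comp]
    congr 2
    ring
  rw [heq]
  exact h2

end GNS

end

noncomputable section

namespace GNS

open Filter Topology
open scoped Convolution

/-! ### The Fourier symbols of the operators in the equation. -/

section Operators

variable {F : Type*} [NormedAddCommGroup F] [NormedSpace ℂ F]

theorem represents_fourier_heat {T : 𝓢'(R3, F)} {g : R3 → F} (hT : Represents (𝓕 T) g) {τ : ℝ}
    (hτ : 0 ≤ τ) : Represents (𝓕 (heat τ T)) (fun ξ => (gauss τ ξ : ℂ) • g ξ) := by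
  rw [heat, TemperedDistribution.fourierMultiplierCLM_apply,
    FourierTransform.fourier_fourierInv_eq]
  exact hT.smulLeft (hasTemperateGrowth_gauss hτ)

theorem represents_fourier_lineDeriv {T : 𝓢'(R3, ℂ)} {g : R3 → ℂ} (hT : Represents (𝓕 T) g)
    (m : Fin 3) : Represents (𝓕 (∂_{EuclideanSpace.single m (1 : ℝ)} T))
      (fun ξ => 2 * Real.pi * Complex.I * (ξ m : ℂ) * g ξ) := by
  rw [TemperedDistribution.fourier_lineDerivOp_eq]
  have hw : (fun ξ : R3 => ((inner ℝ ξ (EuclideanSpace.single m (1 : ℝ)) : ℝ) : ℂ)).HasTemperateGrowth :=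
    Function.Complex.hasTemperateGrowth_ofReal.comp
      (Function.hasTemperateGrowth_inner_left (EuclideanSpace.single m (1 : ℝ)))
  refine ((hT.smulLeft hw).smul (2 * Real.pi * Complex.I)).congr (Eventually.of_forall fun ξ => ?_)
  simp [EuclideanSpace.inner_single_right, mul_assoc]

/-- The symbol is bounded by `1`, so the product still satisfies the growth condition `hg` and
defines a distribution. Thus `distOf` does not take its default value. -/
theorem represents_fourier_riesz {b : 𝓢'(R3, ℂ)} {g : R3 → ℂ} (hb : Represents (𝓕 b) g)
    (hg : Integrable fun ξ => (1 + ‖ξ‖ ^ 2)⁻¹ • g ξ) (n p : Fin 3) :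
    Represents (𝓕 (riesz n p b)) (fun ξ => ((ξ n * ξ p / ‖ξ‖ ^ 2 : ℝ) : ℂ) * g ξ) := by
  have h_int : Integrable fun ξ : R3 =>
      (1 + ‖ξ‖ ^ 2)⁻¹ • (((ξ n * ξ p / ‖ξ‖ ^ 2 : ℝ) : ℂ) * g ξ) := by
    have hm : Measurable fun ξ : R3 => ((ξ n * ξ p / ‖ξ‖ ^ 2 : ℝ) : ℂ) := by fun_prop
    have := hg.bdd_mul (c := 1) hm.aestronglyMeasurable (Eventually.of_forall fun ξ => by
      rw [Complex.norm_real, Real.norm_eq_abs, abs_div, abs_mul,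
        abs_of_nonneg (by positivity : 0 ≤ ‖ξ‖ ^ 2)]
      refine div_le_one_of_le₀ ?_ (by positivity)
      rw [sq]
      gcongr <;> exact abs_coord_le _ _)
    refine this.congr (Eventually.of_forall fun ξ => ?_)
    simp only [Complex.real_smul]
    ring
  obtain ⟨T, hT⟩ := exists_represents_of_integrable h_int
  have hcongr : (fun ξ : R3 => ((ξ n * ξ p / ‖ξ‖ ^ 2 : ℝ) : ℂ) * g ξ) =ᵐ[volume]
      fun ξ : R3 => ((ξ n * ξ p / ‖ξ‖ ^ 2 : ℝ) : ℂ) * funOf (𝓕 b) ξ := by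
    filter_upwards [funOf_ae_eq hb] with ξ h
    rw [h]
  rw [riesz, distOf_eq (hT.congr hcongr), FourierTransform.fourier_fourierInv_eq]
  exact hT

theorem fourierInv_apply_comp {f : R3 → C3} (hf : Integrable f) (x : R3) (k : Fin 3) :
    (𝓕⁻ f) x k = (𝓕⁻ fun ξ => f ξ k) x := by
  rw [Real.fourierInv_eq, Real.fourierInv_eq]
  have hi : Integrable fun ξ => Real.fourierChar (inner ℝ ξ x) • f ξ := by
    have := (Real.fourierIntegral_convergent_iff (-x)).2 hf
    simpa using this
  have : ∫ ξ, (Real.fourierChar (inner ℝ ξ x) • f ξ) k =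
      (∫ ξ, Real.fourierChar (inner ℝ ξ x) • f ξ) k :=
    (EuclideanSpace.proj k : C3 →L[ℂ] ℂ).integral_comp_comm hi
  rw [← this]
  refine integral_congr_ae (Eventually.of_forall fun ξ => ?_)
  simp [Circle.smul_def]

theorem integrable_comp {f : R3 → C3} (hf : Integrable f) (k : Fin 3) :
    Integrable fun ξ => f ξ k :=
  (EuclideanSpace.proj k : C3 →L[ℂ] ℂ).integrable_comp hf

/-- The Fourier transform turns the product of fields into the convolution. -/
theorem represents_fourier_prodComp {u v : 𝓢'(R3, C3)} {f g : R3 → C3} (hf : Integrable f)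
    (hg : Integrable g) (hu : Represents (𝓕 u) f) (hv : Represents (𝓕 v) g) (k l : Fin 3) :
    Represents (𝓕 (prodComp k l u v)) (conv (fun ξ => f ξ k) (fun ξ => g ξ l)) := by
  have hc := integrable_conv (integrable_comp hf k) (integrable_comp hg l)
  -- Both transforms are integrable, so the fields are functions and the convolution theorem
  -- identifies their product.
  have heq : (𝓕⁻ (conv (fun ξ => f ξ k) (fun ξ => g ξ l))) =ᵐ[volume]
      fun x => funOf u x k * funOf v x l := by
    filter_upwards [funOf_ae_eq (represents_fourierInv hf hu),
      funOf_ae_eq (represents_fourierInv hg hv)] with x h1 h2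
    rw [h1, h2, fourierInv_apply_comp hf, fourierInv_apply_comp hg,
      Real.fourierInv_eq_fourier_neg, Real.fourierInv_eq_fourier_neg,
      Real.fourierInv_eq_fourier_neg,
      Real.fourier_mul_convolution_eq (integrable_comp hf k) (integrable_comp hg l)]
  obtain ⟨T, hT⟩ := exists_represents_of_memLp le_top (memLp_top_fourierInv hc)
  rw [prodComp, distOf_eq (hT.congr heq)]
  exact represents_fourier_of_fourierInv hc hT

/-- A derivative costs one power of `|ξ|`, which the weight absorbs since `1 + r ≤ 2(1 + r²)`. -/
theorem integrable_inv_mul_of_le {E : Type*} [NormedAddCommGroup E] [NormedSpace ℂ E]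
    {f : R3 → E} (hf : Integrable f) {σ : R3 → ℂ}
    (hσ : Measurable σ) {C : ℝ} (hC : ∀ ξ, ‖σ ξ‖ ≤ C * (1 + ‖ξ‖)) :
    Integrable fun ξ => (1 + ‖ξ‖ ^ 2)⁻¹ • σ ξ • f ξ := by
  have hm : Measurable fun ξ : R3 => (1 + ‖ξ‖ ^ 2)⁻¹ • σ ξ := by fun_prop
  have := hf.bdd_smul (φ := fun ξ : R3 => (1 + ‖ξ‖ ^ 2)⁻¹ • σ ξ) (2 * |C|) hm.aestronglyMeasurable
    (Eventually.of_forall fun ξ => by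
      rw [norm_smul, norm_inv, Real.norm_of_nonneg (by positivity), inv_mul_le_iff₀ (by positivity)]
      have h1 := hC ξ
      have h2 : C * (1 + ‖ξ‖) ≤ |C| * (1 + ‖ξ‖) := by gcongr; exact le_abs_self C
      have h3 : 1 + ‖ξ‖ ≤ 2 * (1 + ‖ξ‖ ^ 2) := by nlinarith [sq_nonneg (‖ξ‖ - 1), norm_nonneg ξ]
      nlinarith [abs_nonneg C])
  refine this.congr (Eventually.of_forall fun ξ => ?_)
  exact smul_assoc _ _ _

theorem norm_mul_qSym (a : Coeffs) (j k l : Fin 3) (ξ : R3) :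
    (‖ξ‖ : ℂ) * qSym a j k l ξ = ∑ m, ∑ n, ∑ p, (a j m p n k l : ℂ) *
      (((ξ n * ξ p / ‖ξ‖ ^ 2 : ℝ) : ℂ) * (2 * Real.pi * Complex.I * (ξ m : ℂ))) := by
  simp only [qSym, Finset.mul_sum]
  refine Finset.sum_congr rfl fun m _ => Finset.sum_congr rfl fun n _ =>
    Finset.sum_congr rfl fun p _ => ?_
  -- At `ξ = 0` both sides vanish, division by zero giving zero.
  rcases eq_or_ne ‖ξ‖ 0 with h | h
  · have : ξ = 0 := norm_eq_zero.1 h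
    subst this
    simp
  · have h' : (‖ξ‖ : ℂ) ≠ 0 := by exact_mod_cast h
    push_cast
    field_simp

theorem represents_fourier_Q (a : Coeffs) {u v : 𝓢'(R3, C3)} {f g : R3 → C3} (hf : Integrable f)
    (hg : Integrable g) (hu : Represents (𝓕 u) f) (hv : Represents (𝓕 v) g) (j : Fin 3) :
    Represents (𝓕 (Q a j u v)) (fun ξ => (‖ξ‖ : ℂ) * ∑ k, ∑ l, qSym a j k l ξ *
      conv (fun ξ => f ξ k) (fun ξ => g ξ l) ξ) := by
  have h1 : ∀ k l m n p, Represents (𝓕 ((a j m p n k l : ℂ) • riesz n p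
      (∂_{EuclideanSpace.single m (1 : ℝ)} (prodComp k l u v))))
      ((a j m p n k l : ℂ) • fun ξ : R3 => ((ξ n * ξ p / ‖ξ‖ ^ 2 : ℝ) : ℂ) *
        (2 * Real.pi * Complex.I * (ξ m : ℂ) * conv (fun ξ => f ξ k) (fun ξ => g ξ l) ξ)) := by
    intro k l m n p
    rw [FourierTransform.fourier_smul]
    refine (represents_fourier_riesz (represents_fourier_lineDeriv
      (represents_fourier_prodComp hf hg hu hv k l) m) ?_ n p).smul _
    refine integrable_inv_mul_of_le (C := 2 * Real.pi)
      (integrable_conv (integrable_comp hf k) (integrable_comp hg l))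
      (σ := fun ξ : R3 => 2 * Real.pi * Complex.I * (ξ m : ℂ)) (by fun_prop) fun ξ => ?_
    rw [norm_mul, norm_mul, Complex.norm_I, mul_one, norm_mul, Complex.norm_real,
      Complex.norm_real, Complex.norm_ofNat, Real.norm_of_nonneg Real.pi_pos.le]
    gcongr
    exact (abs_coord_le ξ m).trans (by linarith)
  have h2 := Represents.sum Finset.univ fun k _ => Represents.sum Finset.univ fun l _ =>
    Represents.sum Finset.univ fun m _ => Represents.sum Finset.univ fun n _ =>
      Represents.sum Finset.univ fun p _ => h1 k l m n p
  have h3 : 𝓕 (Q a j u v) = ∑ k, ∑ l, ∑ m, ∑ n, ∑ p, 𝓕 ((a j m p n k l : ℂ) • riesz n p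
      (∂_{EuclideanSpace.single m (1 : ℝ)} (prodComp k l u v))) := by
    simp only [Q, qOp, FourierTransform.fourier_sum]
  rw [h3]
  refine h2.congr (Eventually.of_forall fun ξ => ?_)
  simp only [Finset.sum_apply, Pi.smul_apply, Finset.mul_sum, ← mul_assoc, norm_mul_qSym,
    Finset.sum_mul, smul_eq_mul]

end Operators

end GNS

end

noncomputable section

namespace GNS

open Filter Topology
open scoped Convolution

/-! ### Identification of `χ⁰` and `χ⁻¹` with `L¹`. -/

section Iota

theorem eq_of_represents_fourier {F : Type*} [NormedAddCommGroup F] [NormedSpace ℂ F]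
    {T S : 𝓢'(R3, F)} {g : R3 → F}
    (hT : Represents (𝓕 T) g) (hS : Represents (𝓕 S) g) : T = S := by
  have := congrArg (fun T => 𝓕⁻ T) (hT.unique hS)
  simpa using this

/-- The field with Fourier transform `|ξ|^m h(ξ)`. -/
def iota (m : ℕ) (h : FL) : 𝓢'(R3, C3) := 𝓕⁻ (distOf fun ξ => ((‖ξ‖ : ℂ) ^ m) • h ξ)

variable {m : ℕ}

theorem norm_pow_le_one_add (hm : m ≤ 1) (ξ : R3) : ‖ξ‖ ^ m ≤ 1 + ‖ξ‖ := by
  interval_cases m <;> simp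

theorem represents_fourier_iota (hm : m ≤ 1) (h : FL) :
    Represents (𝓕 (iota m h)) (fun ξ => ((‖ξ‖ : ℂ) ^ m) • h ξ) := by
  have hi : Integrable fun ξ => (1 + ‖ξ‖ ^ 2)⁻¹ • ((‖ξ‖ : ℂ) ^ m) • h ξ :=
    integrable_inv_mul_of_le (C := 1) (L1.integrable_coeFn h) (by fun_prop) fun ξ => by
      rw [norm_pow, Complex.norm_real, norm_norm, one_mul]
      exact norm_pow_le_one_add hm ξ
  obtain ⟨T, hT⟩ := exists_represents_of_integrable hi
  rw [iota, distOf_eq hT, FourierTransform.fourier_fourierInv_eq]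
  exact hT

/-- The functional `h ↦ ⟨iota m h, φ⟩`. -/
def pairL (m : ℕ) (φ : 𝓢(R3, ℂ)) : FL →L[ℂ] C3 :=
  L1.integralCLM' ℂ ∘L mulLp C3 volume 1 (fun ξ => (𝓕⁻ φ) ξ * (‖ξ‖ : ℂ) ^ m)

theorem memLp_pairSym (m : ℕ) (φ : 𝓢(R3, ℂ)) :
    MemLp (fun ξ : R3 => (𝓕⁻ φ) ξ * (‖ξ‖ : ℂ) ^ m) ∞ := by
  obtain ⟨C, -, hC⟩ := (𝓕⁻ φ).decay m 0
  refine memLp_top_of_bound ?_ C (Eventually.of_forall fun ξ => ?_)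
  · have : Continuous fun ξ : R3 => (𝓕⁻ φ) ξ * (‖ξ‖ : ℂ) ^ m :=
      (𝓕⁻ φ).continuous.mul (by fun_prop)
    exact this.aestronglyMeasurable
  · have := hC ξ
    rw [norm_iteratedFDeriv_zero] at this
    rwa [norm_mul, norm_pow, Complex.norm_real, norm_norm, mul_comm]

theorem pairL_apply (m : ℕ) (φ : 𝓢(R3, ℂ)) (h : FL) :
    pairL m φ h = ∫ ξ, (𝓕⁻ φ) ξ • ((‖ξ‖ : ℂ) ^ m) • h ξ := by
  have h1 : pairL m φ h = ∫ ξ, mulLp C3 volume 1 (fun ξ => (𝓕⁻ φ) ξ * (‖ξ‖ : ℂ) ^ m) h ξ := by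
    rw [← L1.integral_eq_integral, L1.integral_eq' ℂ]
    rfl
  rw [h1]
  refine integral_congr_ae ?_
  filter_upwards [coeFn_mulLp (memLp_pairSym m φ) h] with ξ hξ
  rw [hξ, mul_smul]

theorem iota_apply (hm : m ≤ 1) (h : FL) (φ : 𝓢(R3, ℂ)) : iota m h φ = pairL m φ h := by
  rw [apply_eq_of_represents_fourier (represents_fourier_iota hm h), pairL_apply]

theorem pairL_component (m : ℕ) (φ : 𝓢(R3, ℂ)) (h : FL) (j : Fin 3) :
    pairL m φ h j = ∫ ξ, (𝓕⁻ φ) ξ • ((‖ξ‖ : ℂ) ^ m * h ξ j) := by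
  rw [pairL_apply]
  have hi : Integrable fun ξ => (𝓕⁻ φ) ξ • ((‖ξ‖ : ℂ) ^ m) • h ξ := by
    refine (L1.integrable_coeFn (mulLp C3 volume 1 (fun ξ => (𝓕⁻ φ) ξ * (‖ξ‖ : ℂ) ^ m) h)).congr ?_
    filter_upwards [coeFn_mulLp (memLp_pairSym m φ) h] with ξ hξ
    rw [hξ, mul_smul]
  exact ((EuclideanSpace.proj j : C3 →L[ℂ] ℂ).integral_comp_comm hi).symm

theorem iota_injective (hm : m ≤ 1) {h h' : FL} (heq : iota m h = iota m h') : h = h' := by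
  have h1 := represents_fourier_iota hm h
  rw [heq] at h1
  refine Lp.ext ?_
  have h0 : ∀ᵐ ξ : R3, ξ ≠ 0 := by simp [ae_iff]
  filter_upwards [h1.ae_eq (represents_fourier_iota hm h'), h0] with ξ hξ h0
  refine smul_right_injective C3 (r := (‖ξ‖ : ℂ) ^ m) ?_ hξ
  exact pow_ne_zero _ (by exact_mod_cast norm_ne_zero_iff.2 h0)

theorem chiENorm_iota {i : ℤ} (hm : m ≤ 1) (him : i = -m) (h : FL) :
    chiENorm i (iota m h) = ‖h‖ₑ := by
  rw [chiENorm_eq i (represents_fourier_iota hm h), Lp.enorm_def, eLpNorm_one_eq_lintegral_enorm]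
  refine lintegral_congr_ae ?_
  have h0 : ∀ᵐ ξ : R3, ξ ≠ 0 := by simp [ae_iff]
  filter_upwards [h0] with ξ h0
  have h0' : (0 : ℝ) < ‖ξ‖ := norm_pos_iff.2 h0
  rw [enorm_smul, ← mul_assoc, ← ofReal_norm (_ ^ m), norm_pow, Complex.norm_real, norm_norm,
    ← ENNReal.ofReal_mul (by positivity), him, zpow_neg, zpow_natCast,
    inv_mul_cancel₀ (by positivity), ENNReal.ofReal_one, one_mul]

open Classical in
/-- The function `|ξ|^i f̂(ξ)` in `L¹`, for `f` in `χ^i`. -/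
def toFL (i : ℤ) (f : 𝓢'(R3, C3)) : FL :=
  if h : Integrable fun ξ => ((‖ξ‖ : ℂ) ^ i) • funOf (𝓕 f) ξ then h.toL1 else 0

variable {i : ℤ}

theorem enorm_zpow_smul (i : ℤ) (g : R3 → C3) (ξ : R3) :
    ‖((‖ξ‖ : ℂ) ^ i) • g ξ‖ₑ = ENNReal.ofReal (‖ξ‖ ^ i) * ‖g ξ‖ₑ := by
  rw [enorm_smul, ← ofReal_norm (_ ^ i), norm_zpow, Complex.norm_real, norm_norm]

theorem integrable_zpow_smul {f : 𝓢'(R3, C3)} (hf : chiENorm i f < ∞) {g : R3 → C3}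
    (hg : Represents (𝓕 f) g) : Integrable fun ξ => ((‖ξ‖ : ℂ) ^ i) • g ξ := by
  have hm : Measurable fun ξ : R3 => (‖ξ‖ : ℂ) ^ i := by fun_prop
  refine ⟨hm.aestronglyMeasurable.smul hg.1.aestronglyMeasurable, ?_⟩
  rw [HasFiniteIntegral]
  simp only [enorm_zpow_smul]
  rwa [← chiENorm_eq i hg]

theorem coeFn_toFL {f : 𝓢'(R3, C3)} (hf : chiENorm i f < ∞) {g : R3 → C3}
    (hg : Represents (𝓕 f) g) : toFL i f =ᵐ[volume] fun ξ => ((‖ξ‖ : ℂ) ^ i) • g ξ := by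
  have hi := integrable_zpow_smul hf (represents_funOf (exists_represents hf))
  rw [toFL, dif_pos hi]
  filter_upwards [hi.coeFn_toL1, funOf_ae_eq hg] with ξ h1 h2
  rw [h1, h2]

theorem enorm_toFL {f : 𝓢'(R3, C3)} (hf : chiENorm i f < ∞) : ‖toFL i f‖ₑ = chiENorm i f := by
  obtain ⟨g, hg⟩ := exists_represents hf
  rw [Lp.enorm_def, eLpNorm_one_eq_lintegral_enorm, chiENorm_eq i hg]
  refine lintegral_congr_ae ?_
  filter_upwards [coeFn_toFL hf hg] with ξ h
  rw [h, enorm_zpow_smul]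

theorem toFL_sub {f g : 𝓢'(R3, C3)} (hf : chiENorm i f < ∞) (hg : chiENorm i g < ∞) :
    toFL i (f - g) = toFL i f - toFL i g := by
  obtain ⟨a, ha⟩ := exists_represents hf
  obtain ⟨b, hb⟩ := exists_represents hg
  have hfg : chiENorm i (f - g) < ∞ := (chiSubmodule C3 i).sub_mem hf hg
  have hab : Represents (𝓕 (f - g)) (a + (-1 : ℂ) • b) := by
    have : f - g = f + (-1 : ℂ) • g := by
      ext1 φ
      change f φ - g φ = f φ + (-1 : ℂ) • g φ
      rw [neg_smul, one_smul, sub_eq_add_neg]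
    rw [this, FourierTransform.fourier_add, FourierTransform.fourier_smul]
    exact ha.add (hb.smul _)
  refine Lp.ext ?_
  filter_upwards [coeFn_toFL hf ha, coeFn_toFL hg hb, coeFn_toFL hfg hab,
    Lp.coeFn_sub (toFL i f) (toFL i g)] with ξ h1 h2 h3 h4
  rw [h3, h4, Pi.sub_apply, h1, h2]
  simp [sub_eq_add_neg]

theorem Chi.chiENorm_lt_top (f : Chi C3 i) : chiENorm i f.toDist < ∞ := f.2

/-- Where the norm is infinite the lift is `0`; in the applications this happens at most on a null
set of times. -/
theorem exists_chi_lift (i : ℤ) (u : ℝ → 𝓢'(R3, C3)) :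
    ∃ v : ℝ → Chi C3 i, ∀ t, chiENorm i (u t) < ∞ → (v t).toDist = u t := by
  have : ∀ t, ∃ w : Chi C3 i, chiENorm i (u t) < ∞ → w.toDist = u t := fun t => by
    by_cases ht : chiENorm i (u t) < ∞
    · exact ⟨(⟨u t, ht⟩ : chiSubmodule C3 i), fun _ => rfl⟩
    · exact ⟨0, fun h => absurd h ht⟩
  choose v hv using this
  exact ⟨v, hv⟩

/-- Hence measurability and continuity in `χ^i` can be tested in `L¹`, also for `i = 1`, where
`iota` is not used. -/
theorem isometry_toFL (i : ℤ) : Isometry fun f : Chi C3 i => toFL i f.toDist := by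
  refine Isometry.of_dist_eq fun f g => ?_
  have hfg : chiENorm i (f.toDist - g.toDist) < ∞ := (chiSubmodule C3 i).sub_mem f.2 g.2
  rw [dist_eq_norm, dist_eq_norm, ← toFL_sub f.chiENorm_lt_top g.chiENorm_lt_top,
    ← toReal_enorm, enorm_toFL hfg]
  rfl

theorem iota_toFL (hm : m ≤ 1) (him : i = -m) {f : 𝓢'(R3, C3)} (hf : chiENorm i f < ∞) :
    iota m (toFL i f) = f := by
  obtain ⟨g, hg⟩ := exists_represents hf
  refine eq_of_represents_fourier (represents_fourier_iota hm _) (hg.congr ?_)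
  have h0 : ∀ᵐ ξ : R3, ξ ≠ 0 := by simp [ae_iff]
  filter_upwards [coeFn_toFL hf hg, h0] with ξ h h0
  have h0' : (‖ξ‖ : ℂ) ^ m ≠ 0 := pow_ne_zero _ (by exact_mod_cast norm_ne_zero_iff.2 h0)
  rw [h, smul_smul, him, zpow_neg, zpow_natCast, mul_inv_cancel₀ h0', one_smul]

theorem chiENorm_iota_lt_top (hm : m ≤ 1) (him : i = -m) (h : FL) : chiENorm i (iota m h) < ∞ := by
  rw [chiENorm_iota hm him]
  exact enorm_lt_top

theorem toFL_iota (hm : m ≤ 1) (him : i = -m) (h : FL) : toFL i (iota m h) = h :=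
  iota_injective hm (iota_toFL hm him (chiENorm_iota_lt_top hm him h))

end Iota

/-! ### Functions of time with values in `χ^i`. -/

section TimeSpaces

variable {i : ℤ} {p : ℝ≥0∞} {T : ℝ} {u : ℝ → 𝓢'(R3, C3)}

theorem memLpChi_of_toFL (h : MemLp (fun t => toFL i (u t)) p (volume.restrict (Icc 0 T)))
    (hu : ∀ᵐ t ∂volume.restrict (Icc 0 T), chiENorm i (u t) < ∞) : MemLpChi p i T u := by
  obtain ⟨v, hv₀⟩ := exists_chi_lift i u
  have hv : ∀ᵐ t ∂volume.restrict (Icc 0 T), (v t).toDist = u t := by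
    filter_upwards [hu] with t ht using hv₀ t ht
  have hv' : (fun t => toFL i (u t)) =ᵐ[volume.restrict (Icc 0 T)]
      fun t => toFL i (v t).toDist := by
    filter_upwards [hv] with t ht
    rw [ht]
  refine ⟨v, ?_, hv⟩
  have hm := (isometry_toFL i).isEmbedding.aestronglyMeasurable_comp_iff.1 (h.1.congr hv')
  refine h.of_le hm ?_
  filter_upwards [hu, hv] with t ht ht'
  have h1 : ‖toFL i (u t)‖ = (chiENorm i (u t)).toReal := by
    rw [← toReal_enorm, enorm_toFL ht]
  rw [h1, ← ht']
  exact le_rfl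

theorem MemLpChi.chiENorm_lt_top (h : MemLpChi p i T u) :
    ∀ᵐ t ∂volume.restrict (Icc 0 T), chiENorm i (u t) < ∞ := by
  obtain ⟨v, -, hvu⟩ := h
  filter_upwards [hvu] with t ht
  rw [← ht]
  exact (v t).2

theorem MemLpChi.memLp_toFL (h : MemLpChi p i T u) :
    MemLp (fun t => toFL i (u t)) p (volume.restrict (Icc 0 T)) := by
  obtain ⟨v, hv, hvu⟩ := h
  have hv' : (fun t => toFL i (v t).toDist) =ᵐ[volume.restrict (Icc 0 T)]
      fun t => toFL i (u t) := by
    filter_upwards [hvu] with t ht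
    rw [ht]
  have h1 : MemLp (fun t => toFL i (v t).toDist) p (volume.restrict (Icc 0 T)) := by
    refine hv.of_le ((isometry_toFL i).continuous.comp_aestronglyMeasurable hv.1)
      (Eventually.of_forall fun t => ?_)
    rw [← toReal_enorm, enorm_toFL (v t).chiENorm_lt_top]
    exact le_rfl
  exact (memLp_congr_ae hv').1 h1

theorem continuousChi_of_toFL (h : ContinuousOn (fun t => toFL i (u t)) (Icc 0 T))
    (hu : ∀ t ∈ Icc 0 T, chiENorm i (u t) < ∞) : ContinuousChi i T u := by
  obtain ⟨v, hv₀⟩ := exists_chi_lift i u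
  have hv : ∀ t ∈ Icc 0 T, (v t).toDist = u t :=
    fun t ht => hv₀ t (hu t ht)
  refine ⟨v, ?_, hv⟩
  rw [(isometry_toFL i).isEmbedding.isInducing.continuousOn_iff]
  refine h.congr fun t ht => ?_
  simp only [Function.comp, hv t ht]

end TimeSpaces

/-! ### The heat semigroup up to time zero. -/

section HeatL

/-- The heat semigroup on the Fourier side. -/
def heatL (τ : ℝ) : FL →L[ℂ] FL := mulLp C3 volume 1 fun ξ => (gauss (max τ 0) ξ : ℂ)

theorem norm_gauss_le (τ : ℝ) (ξ : R3) : ‖(gauss (max τ 0) ξ : ℂ)‖ ≤ 1 := by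
  rw [Complex.norm_real, Real.norm_of_nonneg (gauss_pos _ _).le]
  exact gauss_le_one (le_max_right _ _) ξ

theorem memLp_gauss (τ : ℝ) : MemLp (fun ξ : R3 => (gauss (max τ 0) ξ : ℂ)) ∞ := by
  refine memLp_top_of_bound ?_ 1 (Eventually.of_forall (norm_gauss_le τ))
  unfold gauss
  exact (by fun_prop : Measurable fun ξ : R3 =>
    ((Real.exp (-max τ 0 * (2 * Real.pi * ‖ξ‖) ^ 2) : ℝ) : ℂ)).aestronglyMeasurable

theorem coeFn_heatL (τ : ℝ) (f : FL) :
    heatL τ f =ᵐ[volume] fun ξ => (gauss (max τ 0) ξ : ℂ) • f ξ :=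
  coeFn_mulLp (memLp_gauss τ) f

theorem continuous_heatL (f : FL) : Continuous fun τ => heatL τ f := by
  refine continuous_iff_continuousAt.2 fun τ => ?_
  refine tendsto_mulLp memLp_gauss (memLp_gauss τ) (C := 1)
    (Eventually.of_forall norm_gauss_le) (norm_gauss_le τ) (fun ξ => ?_) f
  have : Continuous fun τ : ℝ => (gauss (max τ 0) ξ : ℂ) := by
    unfold gauss
    fun_prop
  exact this.tendsto τ

theorem heatL_zero (f : FL) : heatL 0 f = f := by
  refine Lp.ext ?_
  filter_upwards [coeFn_heatL 0 f] with ξ h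
  rw [h]
  simp [gauss]

theorem norm_heatL_le (τ : ℝ) (f : FL) : ‖heatL τ f‖ ≤ ‖f‖ := by
  have := norm_mulLp_apply_le (memLp_gauss τ) (norm_gauss_le τ) f
  rwa [one_mul] at this

/-- At times `τ ≤ 0` the two differ: the causal kernel is `0` and `heatL` is the identity. -/
theorem kernelOp_zero_eq {ν τ : ℝ} (hν : 0 < ν) (hτ : 0 < τ) (f : FL) :
    kernelOp ν 0 τ f = heatL (ν * τ) f := by
  refine Lp.ext ?_
  filter_upwards [coeFn_heatL (ν * τ) f, coeFn_kernelOp hν zero_le_two τ f] with ξ h1 h2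
  rw [h1, h2, sym_of_pos ν 0 hτ, max_eq_left (by positivity), pow_zero, one_mul]

theorem heat_iota {m : ℕ} (hm : m ≤ 1) {τ : ℝ} (hτ : 0 ≤ τ) (f : FL) :
    heat τ (iota m f) = iota m (heatL τ f) := by
  refine eq_of_represents_fourier (represents_fourier_heat (represents_fourier_iota hm f) hτ)
    ((represents_fourier_iota hm (heatL τ f)).congr ?_)
  filter_upwards [coeFn_heatL τ f] with ξ h
  rw [h, max_eq_left hτ, smul_comm]

/-- The derivative in `Q` becomes the weight `|ξ|` in `pairL 1`, so `qL` remains an operator on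
`L¹`. -/
theorem heat_Q_apply (a : Coeffs) (U V : FL) {τ : ℝ} (hτ : 0 ≤ τ) (φ : 𝓢(R3, ℂ)) (j : Fin 3) :
    heat τ (Q a j (iota 0 U) (iota 0 V)) φ = pairL 1 φ (heatL τ (qL a U V)) j := by
  have hrep : ∀ W : FL, Represents (𝓕 (iota 0 W)) W := fun W =>
    (represents_fourier_iota zero_le_one W).congr (Eventually.of_forall fun ξ => by simp)
  have h := represents_fourier_heat (represents_fourier_Q a (L1.integrable_coeFn U)
    (L1.integrable_coeFn V) (hrep U) (hrep V) j) hτ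
  rw [apply_eq_of_represents_fourier h, pairL_component]
  refine integral_congr_ae ?_
  filter_upwards [coeFn_heatL τ (qL a U V), coeFn_qL a U V j] with ξ h1 h2
  rw [h1, PiLp.smul_apply, h2, max_eq_left hτ, pow_one, smul_eq_mul, smul_eq_mul, smul_eq_mul,
    smul_eq_mul]
  ring

end HeatL

end GNS

end

noncomputable section

namespace GNS

open Filter Topology

/-! ### The solution in `χ⁻¹` and the integral equation. -/

section State

variable {ν : ℝ} (a : Coeffs) (f₀ : FL) (U : Lp FL 2 (volume : Measure ℝ))

theorem memLp_kernelOp_one (hν : 0 < ν) (f₀ : FL) : MemLp (fun t => kernelOp ν 1 t f₀) 2 := by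
  refine ⟨(stronglyMeasurable_kernelOp hν one_le_two f₀).aestronglyMeasurable, ?_⟩
  refine lt_of_le_of_lt (eLpNorm_two_le_iff.2 (lintegral_kernelOp_one_sq_le hν f₀)) ?_
  exact ENNReal.mul_lt_top ENNReal.coe_lt_top enorm_lt_top

/-- The linear evolution `|∇| e^{νtΔ}` of the data, for positive times. -/
def linearPart {ν : ℝ} (hν : 0 < ν) (f₀ : FL) : Lp FL 2 (volume : Measure ℝ) :=
  (memLp_kernelOp_one hν f₀).toLp

theorem norm_linearPart_le {ν : ℝ} (hν : 0 < ν) (f₀ : FL) :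
    ‖linearPart hν f₀‖ ≤ (heatKernel hν).bound * ‖f₀‖ := by
  rw [linearPart, Lp.norm_toLp]
  have := ENNReal.toReal_mono (ENNReal.mul_lt_top ENNReal.coe_lt_top enorm_lt_top).ne
    (eLpNorm_two_le_iff.2 (lintegral_kernelOp_one_sq_le hν f₀))
  rwa [ENNReal.toReal_mul, ENNReal.coe_toReal, toReal_enorm] at this

/-- The nonlinear term `|∇|⁻¹ Q(u,u)` on the Fourier side. -/
def force (s : ℝ) : FL := qL a (U s) (U s)

theorem force_ae_eq : (qL a).holder 1 U U =ᵐ[volume] force a U := (qL a).coeFn_holder U U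

theorem integrable_force : Integrable (force a U) :=
  (memLp_one_iff_integrable.1 (Lp.memLp ((qL a).holder 1 U U))).congr (force_ae_eq a U)

/-- The Fourier transform of the solution at time `t`, divided by `|ξ|`. -/
def state (ν : ℝ) (t : ℝ) : FL := heatL (ν * t) f₀ + duhamel (kernelOp ν 0) (force a U) t

theorem norm_kernelOp_zero_le (hν : 0 < ν) (τ : ℝ) (f : FL) : ‖kernelOp ν 0 τ f‖ ≤ ‖f‖ := by
  rcases le_or_gt τ 0 with hτ | hτ
  · rw [kernelOp_of_nonpos ν 0 hτ, zero_apply, norm_zero]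
    exact norm_nonneg _
  · rw [kernelOp_zero_eq hν hτ]
    exact norm_heatL_le _ _

theorem integrable_kernelOp_zero (hν : 0 < ν) {F : ℝ → FL} (hF : Integrable F) (t : ℝ) :
    Integrable fun s => kernelOp ν 0 (t - s) (F s) := by
  refine hF.mono (aestronglyMeasurable_kernel_comp_right
    (stronglyMeasurable_kernelOp hν zero_le_two) hF.1 t) (Eventually.of_forall fun s => ?_)
  exact norm_kernelOp_zero_le hν _ _

/-- Dominated convergence: the operators are contractions, the force is integrable, and the kernel
jumps only at `s = t`, a null set. -/
theorem continuous_state (hν : 0 < ν) : Continuous (state a f₀ U ν) := by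
  refine ((continuous_heatL f₀).comp (continuous_const.mul continuous_id)).add ?_
  refine continuous_iff_continuousAt.2 fun t => ?_
  have hF := integrable_force a U
  refine continuousAt_of_dominated (bound := fun s => ‖force a U s‖)
    (Eventually.of_forall fun r => (integrable_kernelOp_zero hν hF r).1)
    (Eventually.of_forall fun r => Eventually.of_forall fun s => norm_kernelOp_zero_le hν _ _)
    hF.norm ?_
  have hne : ∀ᵐ s : ℝ, s ≠ t := by simp [ae_iff]
  filter_upwards [hne] with s hs
  have hsub : Tendsto (fun r : ℝ => r - s) (𝓝 t) (𝓝 (t - s)) :=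
    (continuous_id.sub continuous_const).tendsto t
  rcases lt_or_gt_of_ne hs with h | h
  · exact (continuousAt_kernelOp hν zero_le_two (force a U s) (sub_pos.2 h)).tendsto.comp hsub
  · refine continuousAt_const.congr (f := fun _ => (0 : FL)) ?_
    filter_upwards [gt_mem_nhds h] with r hr
    rw [kernelOp_of_nonpos ν 0 (by linarith : r - s ≤ 0), zero_apply]

theorem pairL_kernelOp (hν : 0 < ν) (τ : ℝ) (f : FL) (φ : 𝓢(R3, ℂ)) :
    pairL 0 φ (kernelOp ν 1 τ f) = pairL 1 φ (kernelOp ν 0 τ f) := by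
  rw [pairL_apply, pairL_apply]
  refine integral_congr_ae ?_
  filter_upwards [coeFn_kernelOp hν one_le_two τ f, coeFn_kernelOp hν zero_le_two τ f]
    with ξ h1 h2
  rw [h1, h2]
  rcases le_or_gt τ 0 with hτ | hτ
  · simp [sym_of_nonpos ν _ hτ]
  · rw [sym_of_pos ν 0 hτ, sym_of_pos ν 1 hτ, smul_smul, smul_smul, smul_smul, smul_smul]
    congr 1
    push_cast
    ring

/-- The weight `|ξ|` passes from the kernel to the test function. The left-hand integral is known to
converge only for almost every `t`; the right-hand one converges for all. -/
theorem iota_state_eq (hν : 0 < ν) : ∀ᵐ t : ℝ, 0 < t →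
    iota 0 (kernelOp ν 1 t f₀ + duhamel (kernelOp ν 1) (force a U) t) =
      iota 1 (state a f₀ U ν t) := by
  filter_upwards [(heatKernel hν).ae_integrable (integrable_force a U)] with t ht ht0
  have ht : Integrable fun s => kernelOp ν 1 (t - s) (force a U s) := ht
  ext1 φ
  rw [iota_apply zero_le_one, iota_apply le_rfl, state, map_add, map_add, map_duhamel _ _ ht,
    map_duhamel _ _ (integrable_kernelOp_zero hν (integrable_force a U) t)]
  simp only [pairL_kernelOp hν]
  rw [kernelOp_zero_eq hν ht0]

variable {a U} {T : ℝ} {u : ℝ → 𝓢'(R3, C3)}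

theorem ae_eq_zero_of_cut_eq (hU : cut (Ioc 0 T) U = U) : ∀ᵐ s, s ∉ Ioc 0 T → U s = 0 := by
  filter_upwards [coeFn_cut (measurableSet_Ioc (a := 0) (b := T)) U] with s hs hsT
  rw [hU] at hs
  rw [hs, indicator_of_notMem hsT]

/-- The limits of integration are hidden in the integrand: the kernel removes `s ≥ t`, the support
of `U` removes `s < 0`. -/
theorem duhamel_zero_eq (hν : 0 < ν) (hU : cut (Ioc 0 T) U = U) {t : ℝ} (ht : 0 ≤ t) :
    duhamel (kernelOp ν 0) (force a U) t =
      ∫ s in (0 : ℝ)..t, heatL (ν * (t - s)) (force a U s) := by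
  rw [intervalIntegral.integral_of_le ht, integral_Ioc_eq_integral_Ioo,
    ← integral_indicator measurableSet_Ioo, duhamel]
  have h0 : ∀ᵐ s : ℝ, s ≠ 0 := by simp [ae_iff]
  refine integral_congr_ae ?_
  filter_upwards [ae_eq_zero_of_cut_eq hU, h0] with s hs hs0
  by_cases hst : s ∈ Ioo 0 t
  · rw [indicator_of_mem hst, kernelOp_zero_eq hν (sub_pos.2 hst.2)]
  · rw [indicator_of_notMem hst]
    rcases le_or_gt t s with h | h
    · rw [kernelOp_of_nonpos ν 0 (by linarith), zero_apply]
    · have : s < 0 := by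
        by_contra hc
        exact hst ⟨lt_of_le_of_ne (not_lt.1 hc) (Ne.symm hs0), h⟩
      rw [force, hs fun hc => absurd hc.1 (not_lt.2 this.le)]
      simp

theorem state_zero (hν : 0 < ν) (hU : cut (Ioc 0 T) U = U) : state a f₀ U ν 0 = f₀ := by
  rw [state, duhamel_zero_eq hν hU le_rfl, intervalIntegral.integral_same, mul_zero, heatL_zero,
    add_zero]

/-- The right-hand side of the integral equation. -/
theorem heat_add_integral_eq (hν : 0 < ν) (hU : cut (Ioc 0 T) U = U)
    (hu : ∀ᵐ s ∂volume.restrict (Ioc 0 T), u s = iota 0 (U s)) {t : ℝ} (ht : t ∈ Icc 0 T)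
    (φ : 𝓢(R3, ℂ)) (j : Fin 3) :
    heat (ν * t) (iota 1 f₀) φ j + ∫ s in (0 : ℝ)..t, heat (ν * (t - s)) (Q a j (u s) (u s)) φ =
      iota 1 (state a f₀ U ν t) φ j := by
  have h_int : ∫ s in (0 : ℝ)..t, heat (ν * (t - s)) (Q a j (u s) (u s)) φ =
      ∫ s in (0 : ℝ)..t, pairL 1 φ (heatL (ν * (t - s)) (force a U s)) j := by
    rw [intervalIntegral.integral_of_le ht.1, intervalIntegral.integral_of_le ht.1]
    refine integral_congr_ae ?_
    filter_upwards [ae_mono (Measure.restrict_mono (Ioc_subset_Ioc_right ht.2) le_rfl) hu,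
      ae_restrict_mem measurableSet_Ioc] with s hs hst
    rw [hs, heat_Q_apply a _ _ (mul_nonneg hν.le (sub_nonneg.2 hst.2))]
    rfl
  have hcomm := ((EuclideanSpace.proj j : C3 →L[ℂ] ℂ) ∘L pairL 1 φ).intervalIntegral_comp_comm
    (μ := volume) (a := 0) (b := t) (f := fun s => heatL (ν * (t - s)) (force a U s)) (by
      rw [intervalIntegrable_iff_integrableOn_Ioo_of_le ht.1]
      refine ((integrable_kernelOp_zero hν (integrable_force a U) t).integrableOn
        (s := Ioo 0 t)).congr_fun (fun s hs => ?_) measurableSet_Ioo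
      exact kernelOp_zero_eq hν (sub_pos.2 hs.2) _)
  rw [h_int, heat_iota le_rfl (mul_nonneg hν.le ht.1), iota_apply le_rfl, iota_apply le_rfl, state,
    duhamel_zero_eq hν hU ht.1, map_add]
  exact congrArg _ hcomm

theorem ae_eq_of_isSol (hν : 0 < ν)
    (hU : (heatKernel hν).IsSol (qL a) (linearPart hν f₀) T U) :
    ∀ᵐ t : ℝ, t ∈ Ioc 0 T → U t = kernelOp ν 1 t f₀ + duhamel (kernelOp ν 1) (force a U) t := by
  filter_upwards [coeFn_cut (measurableSet_Ioc (a := 0) (b := T))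
    (linearPart hν f₀ + (heatKernel hν).duhamelL ((qL a).holder 1 U U)),
    Lp.coeFn_add (linearPart hν f₀) ((heatKernel hν).duhamelL ((qL a).holder 1 U U)),
    (memLp_kernelOp_one hν f₀).coeFn_toLp,
    (heatKernel hν).coeFn_duhamelL ((qL a).holder 1 U U)] with t h1 h2 h3 h4 ht
  rw [← hU] at h1
  rw [h1, indicator_of_mem ht, h2, Pi.add_apply, h4, duhamel_congr _ (force_ae_eq a U), linearPart,
    h3]
  rfl

theorem iota_eq_of_isSol (hν : 0 < ν)
    (hU : (heatKernel hν).IsSol (qL a) (linearPart hν f₀) T U) :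
    ∀ᵐ t : ℝ, t ∈ Ioc 0 T → iota 1 (state a f₀ U ν t) = iota 0 (U t) := by
  filter_upwards [ae_eq_of_isSol f₀ hν hU, iota_state_eq a f₀ U hν] with t h1 h2 ht
  rw [h1 ht, h2 ht.1]

end State

end GNS

end

noncomputable section

namespace GNS

open Filter Topology

/-! ### Integrability in time with values in `χ¹`. -/

section HighNorm

variable {ν : ℝ} {F : ℝ → FL}

theorem ae_integrable_kernelOp_two (hν : 0 < ν) (hF : Integrable F) :
    ∀ᵐ t, Integrable fun s => kernelOp ν 2 (t - s) (F s) := by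
  have hm := aestronglyMeasurable_kernel_comp (stronglyMeasurable_kernelOp hν le_rfl) hF.1
  have h := lintegral_lintegral_kernel_le (stronglyMeasurable_kernelOp hν le_rfl)
    (lintegral_kernelOp_two_le hν) hF.1
  have h1 : ∫⁻ t, ∫⁻ s, ‖kernelOp ν 2 (t - s) (F s)‖ₑ ≠ ∞ :=
    (h.trans_lt (ENNReal.mul_lt_top ENNReal.ofReal_lt_top hF.hasFiniteIntegral)).ne
  filter_upwards [ae_lt_top' hm.enorm.lintegral_prod_right' h1] with t ht
  exact ⟨aestronglyMeasurable_kernel_comp_right (stronglyMeasurable_kernelOp hν le_rfl) hF.1 t, ht⟩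

theorem integrable_duhamel_kernelOp_two (hν : 0 < ν) (hF : Integrable F) :
    Integrable (duhamel (kernelOp ν 2) F) := by
  refine ⟨aestronglyMeasurable_duhamel (stronglyMeasurable_kernelOp hν le_rfl) hF.1, ?_⟩
  have h := lintegral_lintegral_kernel_le (stronglyMeasurable_kernelOp hν le_rfl)
    (lintegral_kernelOp_two_le hν) hF.1
  refine lt_of_le_of_lt (le_trans (lintegral_mono fun t => ?_) h)
    (ENNReal.mul_lt_top ENNReal.ofReal_lt_top hF.hasFiniteIntegral)
  exact enorm_integral_le_lintegral_enorm _

theorem integrable_kernelOp_two (hν : 0 < ν) (f : FL) : Integrable fun t => kernelOp ν 2 t f :=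
  ⟨(stronglyMeasurable_kernelOp hν le_rfl f).aestronglyMeasurable,
    (lintegral_kernelOp_two_le hν f).trans_lt
      (ENNReal.mul_lt_top ENNReal.ofReal_lt_top enorm_lt_top)⟩

theorem memLp_resolvent : MemLp (fun ξ : R3 => (((1 + ‖ξ‖ ^ 2)⁻¹ : ℝ) : ℂ)) ∞ := by
  refine memLp_top_of_bound (by fun_prop : Measurable _).aestronglyMeasurable 1
    (Eventually.of_forall fun ξ => ?_)
  rw [Complex.norm_real, Real.norm_of_nonneg (by positivity)]
  exact inv_le_one_of_one_le₀ (by nlinarith [sq_nonneg ‖ξ‖])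

theorem memLp_one_sub_resolvent :
    MemLp (fun ξ : R3 => ((‖ξ‖ ^ 2 * (1 + ‖ξ‖ ^ 2)⁻¹ : ℝ) : ℂ)) ∞ := by
  refine memLp_top_of_bound (by fun_prop : Measurable _).aestronglyMeasurable 1
    (Eventually.of_forall fun ξ => ?_)
  rw [Complex.norm_real, Real.norm_of_nonneg (by positivity), ← div_eq_mul_inv]
  exact div_le_one_of_le₀ (by linarith) (by positivity)

/-- Multiplication by `|ξ|²` is unbounded and cannot be pulled through a Bochner integral. After
division by `1 + |ξ|²` both sides are bounded multipliers, and the division is undone pointwise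
afterwards. -/
theorem mulLp_kernelOp_two (hν : 0 < ν) (τ : ℝ) (f : FL) :
    mulLp C3 volume 1 (fun ξ : R3 => (((1 + ‖ξ‖ ^ 2)⁻¹ : ℝ) : ℂ)) (kernelOp ν 2 τ f) =
      mulLp C3 volume 1 (fun ξ : R3 => ((‖ξ‖ ^ 2 * (1 + ‖ξ‖ ^ 2)⁻¹ : ℝ) : ℂ))
        (kernelOp ν 0 τ f) := by
  refine Lp.ext ?_
  filter_upwards [coeFn_mulLp memLp_resolvent (kernelOp ν 2 τ f),
    coeFn_mulLp memLp_one_sub_resolvent (kernelOp ν 0 τ f), coeFn_kernelOp hν le_rfl τ f,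
    coeFn_kernelOp hν zero_le_two τ f] with ξ h1 h2 h3 h4
  rw [h1, h2, h3, h4]
  rcases le_or_gt τ 0 with hτ | hτ
  · simp [sym_of_nonpos ν _ hτ]
  · rw [sym_of_pos ν 0 hτ, sym_of_pos ν 2 hτ, smul_smul, smul_smul]
    congr 1
    push_cast
    ring

variable (a : Coeffs) (f₀ : FL) (U : Lp FL 2 (volume : Measure ℝ))

theorem ae_state_mul_sq_eq (hν : 0 < ν) : ∀ᵐ t : ℝ, 0 < t →
    (kernelOp ν 2 t f₀ + duhamel (kernelOp ν 2) (force a U) t : FL) =ᵐ[volume]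
      fun ξ => ((‖ξ‖ : ℂ) ^ 2) • state a f₀ U ν t ξ := by
  filter_upwards [ae_integrable_kernelOp_two hν (integrable_force a U)] with t ht ht0
  have heq : mulLp C3 volume 1 (fun ξ : R3 => (((1 + ‖ξ‖ ^ 2)⁻¹ : ℝ) : ℂ))
      (kernelOp ν 2 t f₀ + duhamel (kernelOp ν 2) (force a U) t) =
      mulLp C3 volume 1 (fun ξ : R3 => ((‖ξ‖ ^ 2 * (1 + ‖ξ‖ ^ 2)⁻¹ : ℝ) : ℂ))
        (state a f₀ U ν t) := by
    rw [state, map_add, map_add, map_duhamel _ _ ht,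
      map_duhamel _ _ (integrable_kernelOp_zero hν (integrable_force a U) t)]
    simp only [mulLp_kernelOp_two hν]
    rw [kernelOp_zero_eq hν ht0]
  filter_upwards [coeFn_mulLp memLp_resolvent
      (kernelOp ν 2 t f₀ + duhamel (kernelOp ν 2) (force a U) t),
    coeFn_mulLp memLp_one_sub_resolvent (state a f₀ U ν t)] with ξ h1 h2
  rw [heq, h2] at h1
  have hne : (((1 + ‖ξ‖ ^ 2)⁻¹ : ℝ) : ℂ) ≠ 0 := by
    exact_mod_cast (by positivity : (1 + ‖ξ‖ ^ 2)⁻¹ ≠ 0)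
  refine smul_right_injective C3 hne ?_
  simp only
  rw [← h1, smul_smul]
  congr 1
  push_cast
  ring

theorem memL1_state (hν : 0 < ν) (T : ℝ) :
    MemLpChi 1 1 T fun t => iota 1 (state a f₀ U ν t) := by
  have key : ∀ᵐ t : ℝ, 0 < t → chiENorm 1 (iota 1 (state a f₀ U ν t)) < ∞ ∧
      toFL 1 (iota 1 (state a f₀ U ν t)) =
        kernelOp ν 2 t f₀ + duhamel (kernelOp ν 2) (force a U) t := by
    filter_upwards [ae_state_mul_sq_eq a f₀ U hν] with t ht ht0
    have h := ht ht0
    have hrep := represents_fourier_iota le_rfl (state a f₀ U ν t)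
    have hlt : chiENorm 1 (iota 1 (state a f₀ U ν t)) < ∞ := by
      rw [chiENorm_eq 1 hrep]
      refine lt_of_eq_of_lt (lintegral_congr_ae ?_) (L1.integrable_coeFn
        (kernelOp ν 2 t f₀ + duhamel (kernelOp ν 2) (force a U) t)).hasFiniteIntegral
      filter_upwards [h] with ξ hξ
      rw [hξ, ← enorm_zpow_smul 1 (fun ξ => ((‖ξ‖ : ℂ) ^ 1) • state a f₀ U ν t ξ), smul_smul]
      congr 2
      rw [zpow_one]
      ring
    refine ⟨hlt, Lp.ext ?_⟩
    filter_upwards [h, coeFn_toFL hlt hrep] with ξ h1 h2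
    rw [h2, h1, smul_smul]
    congr 1
    rw [zpow_one]
    ring
  have h0 : ∀ᵐ t : ℝ, t ≠ 0 := by simp [ae_iff]
  have key' : ∀ᵐ t ∂volume.restrict (Icc 0 T), chiENorm 1 (iota 1 (state a f₀ U ν t)) < ∞ ∧
      toFL 1 (iota 1 (state a f₀ U ν t)) =
        kernelOp ν 2 t f₀ + duhamel (kernelOp ν 2) (force a U) t := by
    filter_upwards [ae_restrict_of_ae key, ae_restrict_of_ae h0,
      ae_restrict_mem measurableSet_Icc] with t h1 h2 h3
    exact h1 (lt_of_le_of_ne h3.1 (Ne.symm h2))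
  refine memLpChi_of_toFL ?_ (key'.mono fun t ht => ht.1)
  have hi : Integrable fun t => kernelOp ν 2 t f₀ + duhamel (kernelOp ν 2) (force a U) t :=
    (integrable_kernelOp_two hν f₀).add (integrable_duhamel_kernelOp_two hν (integrable_force a U))
  exact (memLp_congr_ae (key'.mono fun t ht => ht.2)).2
    (memLp_one_iff_integrable.2 hi.integrableOn)

end HighNorm

/-! ### Mild solutions and solutions of the abstract equation. -/

section Correspondence

variable {ν : ℝ} (hν : 0 < ν) {a : Coeffs} {f₀ : FL} {U : Lp FL 2 (volume : Measure ℝ)} {T : ℝ}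
  {u : ℝ → 𝓢'(R3, C3)}

theorem restrict_Icc_eq_restrict_Ioc (T : ℝ) :
    (volume : Measure ℝ).restrict (Icc 0 T) = volume.restrict (Ioc 0 T) :=
  Measure.restrict_congr_set Ioc_ae_eq_Icc.symm

theorem ae_restrict_Ioc {P : ℝ → Prop} (h : ∀ᵐ t : ℝ, t ∈ Ioc 0 T → P t) :
    ∀ᵐ t ∂volume.restrict (Icc 0 T), P t := by
  rw [restrict_Icc_eq_restrict_Ioc, ae_restrict_iff' measurableSet_Ioc]
  exact h

/-- `U` is determined only almost everywhere, whereas `state` is defined at every time; it is the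
continuous representative. -/
theorem isRegularSolution_of_isSol
    (hU : (heatKernel hν).IsSol (qL a) (linearPart hν f₀) T U) :
    IsRegularSolution a ν (iota 1 f₀) T fun t => iota 1 (state a f₀ U ν t) := by
  have hae := iota_eq_of_isSol f₀ hν hU
  have hae' : ∀ᵐ t ∂volume.restrict (Icc 0 T), iota 1 (state a f₀ U ν t) = iota 0 (U t) :=
    ae_restrict_Ioc hae
  have hfin : ∀ t, chiENorm (-1) (iota 1 (state a f₀ U ν t)) < ∞ := fun t =>
    chiENorm_iota_lt_top le_rfl (by norm_num) _
  have hto : ∀ t, toFL (-1) (iota 1 (state a f₀ U ν t)) = state a f₀ U ν t := fun t =>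
    toFL_iota le_rfl (by norm_num) _
  have hcont := continuous_state a f₀ U hν
  refine ⟨⟨?_, ?_⟩, ?_, ?_, ?_, ?_⟩
  · refine memLpChi_of_toFL ?_ ?_
    · refine (memLp_congr_ae ?_).1 ((Lp.memLp U).restrict (Icc 0 T))
      filter_upwards [hae'] with t ht
      rw [ht, toFL_iota zero_le_one (by norm_num)]
    · filter_upwards [hae'] with t ht
      rw [ht]
      exact chiENorm_iota_lt_top zero_le_one (by norm_num) _
  · filter_upwards [ae_restrict_mem measurableSet_Icc] with t ht φ j
    rw [heat_add_integral_eq f₀ hν hU.cut_eq ?_ ht]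
    rw [ae_restrict_iff' measurableSet_Ioc]
    exact hae
  · rw [state_zero f₀ hν hU.cut_eq]
  · refine continuousChi_of_toFL ?_ fun t _ => hfin t
    simp only [hto]
    exact hcont.continuousOn
  · exact memL1_state a f₀ U hν T
  · refine memLpChi_of_toFL ?_ (Eventually.of_forall hfin)
    simp only [hto]
    obtain ⟨C, hC⟩ := isCompact_Icc.exists_bound_of_continuousOn (hcont.continuousOn (s := Icc 0 T))
    refine memLp_top_of_bound hcont.aestronglyMeasurable C ?_
    filter_upwards [ae_restrict_mem measurableSet_Icc] with t ht using hC t ht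

theorem ae_of_forall_lt {S : ℝ} {P : ℝ → Prop}
    (h : ∀ T, 0 < T → T < S → ∀ᵐ t ∂volume.restrict (Icc 0 T), P t) :
    ∀ᵐ t ∂volume.restrict (Ico 0 S), P t := by
  obtain ⟨r, -, hr, hrS⟩ := exists_seq_strictMono_tendsto S
  have hall : ∀ᵐ t : ℝ, ∀ n, t ∈ Icc 0 (r n) → 0 < r n → P t := by
    rw [ae_all_iff]
    intro n
    by_cases hn : 0 < r n
    · have := h (r n) hn (hr n)
      rw [ae_restrict_iff' measurableSet_Icc] at this
      exact this.mono fun t ht h1 _ => ht h1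
    · exact Eventually.of_forall fun t _ h0 => absurd h0 hn
  have h0 : ∀ᵐ t : ℝ, t ≠ 0 := by simp [ae_iff]
  rw [ae_restrict_iff' measurableSet_Ico]
  filter_upwards [hall, h0] with t ht h0 htS
  obtain ⟨n, hn⟩ := (hrS.eventually (lt_mem_nhds htS.2)).exists
  have ht0 : 0 < t := lt_of_le_of_ne htS.1 (Ne.symm h0)
  exact ht n ⟨htS.1, hn.le⟩ (ht0.trans hn)

theorem isSol_of_ae_eq (hcut : cut (Ioc 0 T) U = U)
    (hUt : ∀ᵐ t : ℝ, t ∈ Ioc 0 T →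
      U t = kernelOp ν 1 t f₀ + duhamel (kernelOp ν 1) (force a U) t) :
    (heatKernel hν).IsSol (qL a) (linearPart hν f₀) T U := by
  refine Lp.ext ?_
  filter_upwards [coeFn_cut (measurableSet_Ioc (a := 0) (b := T))
    (linearPart hν f₀ + (heatKernel hν).duhamelL ((qL a).holder 1 U U)),
    Lp.coeFn_add (linearPart hν f₀) ((heatKernel hν).duhamelL ((qL a).holder 1 U U)),
    (memLp_kernelOp_one hν f₀).coeFn_toLp,
    (heatKernel hν).coeFn_duhamelL ((qL a).holder 1 U U), hUt,
    coeFn_cut (measurableSet_Ioc (a := 0) (b := T)) U] with t h1 h2 h3 h4 h5 h6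
  rw [h1]
  by_cases ht : t ∈ Ioc 0 T
  · rw [indicator_of_mem ht, h2, Pi.add_apply, h4, duhamel_congr _ (force_ae_eq a U), linearPart,
      h3, h5 ht]
    rfl
  · rw [indicator_of_notMem ht, ← hcut, h6, indicator_of_notMem ht]

/-- Mild solutions are solutions of the equation in `L²(ℝ; L¹)`. -/
theorem exists_isSol_of_mild (hmem : MemLpChi 2 0 T u)
    (hmild : ∀ᵐ t ∂volume.restrict (Icc 0 T), ∀ (φ : 𝓢(R3, ℂ)) (j : Fin 3),
      u t φ j = heat (ν * t) (iota 1 f₀) φ j +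
        ∫ s in (0 : ℝ)..t, heat (ν * (t - s)) (Q a j (u s) (u s)) φ) :
    ∃ U, (heatKernel hν).IsSol (qL a) (linearPart hν f₀) T U ∧
      ∀ᵐ t ∂volume.restrict (Icc 0 T), u t = iota 0 (U t) := by
  have hm : MemLp ((Ioc 0 T).indicator fun t => toFL 0 (u t)) 2 volume := by
    rw [memLp_indicator_iff_restrict measurableSet_Ioc, ← restrict_Icc_eq_restrict_Ioc]
    exact hmem.memLp_toFL
  have hu : ∀ᵐ t ∂volume.restrict (Icc 0 T), u t = iota 0 (hm.toLp _ t) := by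
    have h1 : ∀ᵐ t ∂volume.restrict (Icc 0 T), t ∈ Ioc 0 T := by
      rw [restrict_Icc_eq_restrict_Ioc]
      exact ae_restrict_mem measurableSet_Ioc
    filter_upwards [hmem.chiENorm_lt_top, ae_restrict_of_ae hm.coeFn_toLp, h1] with t h1 h2 h3
    rw [h2, indicator_of_mem h3, iota_toFL zero_le_one (by norm_num) h1]
  refine ⟨hm.toLp, ?_, hu⟩
  set U := hm.toLp with hUdef
  have hcut : cut (Ioc 0 T) U = U := by
    refine Lp.ext ?_
    filter_upwards [coeFn_cut (measurableSet_Ioc (a := 0) (b := T)) U, hm.coeFn_toLp] with t h1 h2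
    rw [h1, hUdef]
    by_cases ht : t ∈ Ioc 0 T
    · rw [indicator_of_mem ht]
    · rw [indicator_of_notMem ht, h2, indicator_of_notMem ht]
  have hu' : ∀ᵐ t ∂volume.restrict (Ioc 0 T), u t = iota 0 (U t) := by
    rwa [← restrict_Icc_eq_restrict_Ioc]
  have hUt : ∀ᵐ t : ℝ, t ∈ Ioc 0 T →
      U t = kernelOp ν 1 t f₀ + duhamel (kernelOp ν 1) (force a U) t := by
    rw [restrict_Icc_eq_restrict_Ioc, ae_restrict_iff' measurableSet_Ioc] at hmild
    filter_upwards [hmild, (ae_restrict_iff' measurableSet_Ioc).1 hu', iota_state_eq a f₀ U hν]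
      with t h1 h2 h3 ht
    -- It suffices to compare distributions, for which the tested Duhamel formula is available.
    refine iota_injective zero_le_one ?_
    rw [← h2 ht, h3 ht.1]
    ext φ j
    rw [h1 ht φ j, heat_add_integral_eq f₀ hν hcut hu' (Ioc_subset_Icc_self ht)]
  exact isSol_of_ae_eq hν hcut hUt

end Correspondence

end GNS

end

noncomputable section

namespace GNS

open Filter Topology
open scoped ComplexConjugate

/-! ### Real fields. -/

section Conjugation

/-- Componentwise complex conjugation. -/
def conj3 (x : C3) : C3 := WithLp.toLp 2 fun k => conj (x k)

theorem conj3_apply (x : C3) (k : Fin 3) : conj3 x k = conj (x k) := rfl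

theorem norm_conj3 (x : C3) : ‖conj3 x‖ = ‖x‖ := by
  simp [EuclideanSpace.norm_eq, conj3_apply]

theorem continuous_conj3 : Continuous conj3 := by
  unfold conj3
  refine (PiLp.continuous_toLp 2 _).comp (continuous_pi fun k => ?_)
  exact Complex.continuous_conj.comp (by fun_prop)

theorem quasiMeasurePreserving_neg :
    Measure.QuasiMeasurePreserving (fun ξ : R3 => -ξ) volume volume :=
  (Measure.measurePreserving_neg volume).quasiMeasurePreserving

theorem integrable_conj3_neg {f : R3 → C3} (hf : Integrable f) :
    Integrable fun ξ => conj3 (f (-ξ)) :=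
  hf.comp_neg.mono (continuous_conj3.comp_aestronglyMeasurable hf.comp_neg.1)
    (Eventually.of_forall fun _ => (norm_conj3 _).le)

theorem conj3_neg_congr {f g : R3 → C3} (h : f =ᵐ[volume] g) :
    (fun ξ => conj3 (f (-ξ))) =ᵐ[volume] fun ξ => conj3 (g (-ξ)) := by
  filter_upwards [quasiMeasurePreserving_neg.ae h] with ξ hξ
  rw [hξ]

/-- Complex conjugation of fields, on the Fourier side. -/
def conjL : FL →SL[starRingEnd ℂ] FL :=
  LinearMap.mkContinuous
    { toFun := fun f => (integrable_conj3_neg (L1.integrable_coeFn f)).toL1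
      map_add' := fun f g => by
        rw [← Integrable.toL1_add, Integrable.toL1_eq_toL1_iff]
        refine (conj3_neg_congr (Lp.coeFn_add f g)).trans (Eventually.of_forall fun ξ => ?_)
        ext k
        simp [conj3_apply]
      map_smul' := fun c f => by
        rw [← Integrable.toL1_smul, Integrable.toL1_eq_toL1_iff]
        refine (conj3_neg_congr (Lp.coeFn_smul c f)).trans (Eventually.of_forall fun ξ => ?_)
        ext k
        simp [conj3_apply] }
    1 (fun f => by
      rw [LinearMap.coe_mk, AddHom.coe_mk, one_mul, L1.norm_eq_integral_norm,
        L1.norm_eq_integral_norm, ← integral_neg_eq_self (fun ξ => ‖f ξ‖)]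
      refine le_of_eq (integral_congr_ae ?_)
      filter_upwards [(integrable_conj3_neg (L1.integrable_coeFn f)).coeFn_toL1] with ξ h
      rw [h, norm_conj3])

theorem coeFn_conjL (f : FL) : conjL f =ᵐ[volume] fun ξ => conj3 (f (-ξ)) :=
  (integrable_conj3_neg (L1.integrable_coeFn f)).coeFn_toL1

theorem norm_conjL_le (f : FL) : ‖conjL f‖ ≤ ‖f‖ := by
  have := LinearMap.mkContinuous_norm_le _ zero_le_one _ |> conjL.le_of_opNorm_le (x := f)
  rwa [one_mul] at this

/-- `heven` is the Fourier-side form of the multiplier being a real operator. -/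
theorem conjL_mulLp {σ : R3 → ℂ} (hσ : MemLp σ ∞) (heven : ∀ ξ, conj (σ (-ξ)) = σ ξ) (f : FL) :
    conjL (mulLp C3 volume 1 σ f) = mulLp C3 volume 1 σ (conjL f) := by
  refine Lp.ext ?_
  filter_upwards [coeFn_conjL (mulLp C3 volume 1 σ f), conj3_neg_congr (coeFn_mulLp hσ f),
    coeFn_mulLp hσ (conjL f), coeFn_conjL f] with ξ h1 h2 h3 h4
  rw [h1, h2, h3, h4]
  ext k
  simp [conj3_apply, heven]

theorem gauss_neg (τ : ℝ) (ξ : R3) : gauss τ (-ξ) = gauss τ ξ := by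
  simp [gauss]

theorem conj_sym_neg (ν : ℝ) (p : ℕ) (τ : ℝ) (ξ : R3) :
    conj (sym ν p τ (-ξ)) = sym ν p τ ξ := by
  rcases le_or_gt τ 0 with hτ | hτ
  · simp [sym_of_nonpos ν p hτ]
  · rw [sym_of_pos ν p hτ, sym_of_pos ν p hτ, Complex.conj_ofReal, gauss_neg, norm_neg]

theorem conjL_kernelOp {ν : ℝ} (hν : 0 < ν) {p : ℕ} (hp : p ≤ 2) (τ : ℝ) (f : FL) :
    conjL (kernelOp ν p τ f) = kernelOp ν p τ (conjL f) :=
  conjL_mulLp (memLp_sym hν hp τ) (conj_sym_neg ν p τ) f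

theorem conjL_heatL (τ : ℝ) (f : FL) : conjL (heatL τ f) = heatL τ (conjL f) :=
  conjL_mulLp (memLp_gauss τ) (fun ξ => by rw [Complex.conj_ofReal, gauss_neg]) f

/-- Three odd factors change the sign, and so does the conjugation of `i`. -/
theorem conj_qSym_neg (a : Coeffs) (j k l : Fin 3) (ξ : R3) :
    conj (qSym a j k l (-ξ)) = qSym a j k l ξ := by
  simp only [qSym, map_sum, map_mul, Complex.conj_ofReal, Complex.conj_I, PiLp.neg_apply, norm_neg,
    map_ofNat]
  refine Finset.sum_congr rfl fun m _ => Finset.sum_congr rfl fun n _ =>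
    Finset.sum_congr rfl fun p _ => ?_
  push_cast
  ring

theorem conj_conv_neg (f g : R3 → ℂ) (ξ : R3) :
    conj (conv f g (-ξ)) = conv (fun ξ => conj (f (-ξ))) (fun ξ => conj (g (-ξ))) ξ := by
  rw [conv, conv, convolution_def, convolution_def, ← integral_conj,
    ← integral_neg_eq_self (fun t => conj _)]
  refine integral_congr_ae (Eventually.of_forall fun t => ?_)
  have : -(ξ - t) = -ξ - -t := by abel
  simp [this]

theorem conjL_qL (a : Coeffs) (U V : FL) : conjL (qL a U V) = qL a (conjL U) (conjL V) := by
  have h1 : ∀ᵐ ξ : R3, ∀ j, qL a U V (-ξ) j = ∑ k, ∑ l,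
      qSym a j k l (-ξ) * conv (fun ξ => U ξ k) (fun ξ => V ξ l) (-ξ) := by
    rw [ae_all_iff]
    exact fun j => quasiMeasurePreserving_neg.ae (coeFn_qL a U V j)
  have h2 : ∀ᵐ ξ : R3, ∀ j, qL a (conjL U) (conjL V) ξ j = ∑ k, ∑ l,
      qSym a j k l ξ * conv (fun ξ => conjL U ξ k) (fun ξ => conjL V ξ l) ξ := by
    rw [ae_all_iff]
    exact fun j => coeFn_qL a (conjL U) (conjL V) j
  have h3 : ∀ (W : FL) k, (fun ξ => conjL W ξ k) =ᵐ[volume] fun ξ => conj (W (-ξ) k) := by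
    intro W k
    filter_upwards [coeFn_conjL W] with ξ h
    rw [h, conj3_apply]
  refine Lp.ext ?_
  filter_upwards [coeFn_conjL (qL a U V), h1, h2] with ξ h4 h5 h6
  rw [h4]
  ext j
  rw [conj3_apply, h5, h6]
  simp only [map_sum, map_mul, conj_qSym_neg, conj_conv_neg]
  refine Finset.sum_congr rfl fun k _ => Finset.sum_congr rfl fun l _ => ?_
  rw [conv_congr (h3 U k) (h3 V l)]

theorem conj_fourierInv_of_real {φ : 𝓢(R3, ℂ)} (hφ : ∀ x, (φ x).im = 0) (ξ : R3) :
    conj ((𝓕⁻ φ) ξ) = (𝓕⁻ φ) (-ξ) := by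
  rw [SchwartzMap.fourierInv_coe, Real.fourierInv_eq', Real.fourierInv_eq', ← integral_conj]
  refine integral_congr_ae (Eventually.of_forall fun x => ?_)
  simp only [smul_eq_mul, map_mul, ← Complex.exp_conj, Complex.conj_ofReal, Complex.conj_I,
    inner_neg_right, Complex.conj_eq_iff_im.2 (hφ x)]
  congr 2
  push_cast
  ring

theorem conj_pairL {φ : 𝓢(R3, ℂ)} (hφ : ∀ x, (φ x).im = 0) (f : FL) (k : Fin 3) :
    conj (pairL 1 φ f k) = pairL 1 φ (conjL f) k := by
  rw [pairL_component, pairL_component, ← integral_conj,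
    ← integral_neg_eq_self (fun ξ => conj _)]
  refine integral_congr_ae ?_
  filter_upwards [coeFn_conjL f] with ξ h
  rw [h, conj3_apply, smul_eq_mul, smul_eq_mul, map_mul, map_mul, conj_fourierInv_of_real hφ]
  simp

theorem isRealField_of_conjL_eq {f : FL} (hf : conjL f = f) : IsRealField (iota 1 f) := by
  intro φ hφ k
  rw [iota_apply le_rfl, ← Complex.conj_eq_iff_im, conj_pairL hφ, hf]

theorem exists_real_imag_schwartz (φ : 𝓢(R3, ℂ)) : ∃ φ₁ φ₂ : 𝓢(R3, ℂ),
    (∀ x, (φ₁ x).im = 0) ∧ (∀ x, (φ₂ x).im = 0) ∧ φ = φ₁ + Complex.I • φ₂ := by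
  refine ⟨φ.postcompCLM (Complex.ofRealCLM ∘L Complex.reCLM),
    φ.postcompCLM (Complex.ofRealCLM ∘L Complex.imCLM), fun x => ?_, fun x => ?_, ?_⟩
  · simp
  · simp
  · ext x
    simp [mul_comm Complex.I, Complex.re_add_im]

/-- The hypothesis concerns real test functions only; splitting into real and imaginary parts
extends the identity by linearity. -/
theorem conjL_eq_of_isRealField {f : FL} (hf : IsRealField (iota 1 f)) : conjL f = f := by
  refine iota_injective le_rfl (m := 1) ?_
  have hreal : ∀ φ : 𝓢(R3, ℂ), (∀ x, (φ x).im = 0) → iota 1 (conjL f) φ = iota 1 f φ := by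
    intro φ hφ
    ext k
    rw [iota_apply le_rfl, ← conj_pairL hφ, ← iota_apply le_rfl, Complex.conj_eq_iff_im]
    exact hf φ hφ k
  ext1 φ
  obtain ⟨φ₁, φ₂, h1, h2, rfl⟩ := exists_real_imag_schwartz φ
  rw [map_add, map_add, map_smul, map_smul, hreal φ₁ h1, hreal φ₂ h2]

variable {ν : ℝ} (hν : 0 < ν) {a : Coeffs} {f₀ : FL} {U : Lp FL 2 (volume : Measure ℝ)} {T : ℝ}

theorem conjL_duhamel (hν : 0 < ν) {p : ℕ} (hp : p ≤ 2) {F : ℝ → FL} {t : ℝ}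
    (h : Integrable fun s => kernelOp ν p (t - s) (F s)) :
    conjL (duhamel (kernelOp ν p) F t) = duhamel (kernelOp ν p) (fun s => conjL (F s)) t := by
  rw [map_duhamel_conj _ _ h]
  simp only [conjL_kernelOp hν hp]
  rfl

/-- The conjugate of a solution solves the equation with the conjugate data, which are the same;
uniqueness concludes. -/
theorem ae_conjL_eq_of_isSol (hT : 0 ≤ T)
    (hU : (heatKernel hν).IsSol (qL a) (linearPart hν f₀) T U) (hf₀ : conjL f₀ = f₀) :
    ∀ᵐ t, conjL (U t) = U t := by
  have hm : MemLp (fun t => conjL (U t)) 2 :=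
    (Lp.memLp U).of_le (conjL.continuous.comp_aestronglyMeasurable (Lp.aestronglyMeasurable U))
      (Eventually.of_forall fun t => norm_conjL_le _)
  have hforce : force a hm.toLp =ᵐ[volume] fun s => conjL (force a U s) := by
    filter_upwards [hm.coeFn_toLp] with s hs
    rw [force, hs, ← conjL_qL]
    rfl
  have hcut : cut (Ioc 0 T) hm.toLp = hm.toLp := by
    refine Lp.ext ?_
    filter_upwards [coeFn_cut (measurableSet_Ioc (a := 0) (b := T)) hm.toLp, hm.coeFn_toLp,
      ae_eq_zero_of_cut_eq hU.cut_eq] with t h1 h2 h3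
    rw [h1]
    by_cases ht : t ∈ Ioc 0 T
    · rw [indicator_of_mem ht]
    · rw [indicator_of_notMem ht, h2, h3 ht, map_zero]
  have hsol : (heatKernel hν).IsSol (qL a) (linearPart hν f₀) T hm.toLp := by
    refine isSol_of_ae_eq hν hcut ?_
    filter_upwards [hm.coeFn_toLp, ae_eq_of_isSol f₀ hν hU,
      (heatKernel hν).ae_integrable (integrable_force a U)] with t h1 h2 h3 ht
    rw [h1, h2 ht, map_add, conjL_kernelOp hν one_le_two, hf₀, conjL_duhamel hν one_le_two h3,
      duhamel_congr _ hforce]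
  have heq := SmoothingKernel.IsSol.unique hT hsol hU
  filter_upwards [hm.coeFn_toLp] with t ht
  rw [← ht, heq]

theorem conjL_state_eq (hT : 0 ≤ T)
    (hU : (heatKernel hν).IsSol (qL a) (linearPart hν f₀) T U) (hf₀ : conjL f₀ = f₀) (t : ℝ) :
    conjL (state a f₀ U ν t) = state a f₀ U ν t := by
  have hforce : (fun s => conjL (force a U s)) =ᵐ[volume] force a U := by
    filter_upwards [ae_conjL_eq_of_isSol hν hT hU hf₀] with s hs
    rw [force, conjL_qL, hs]
  rw [state, map_add, conjL_heatL, hf₀, conjL_duhamel hν zero_le_two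
    (integrable_kernelOp_zero hν (integrable_force a U) t), duhamel_congr _ hforce]

end Conjugation

end GNS

end

noncomputable section

namespace GNS

open Filter Topology

/-! ### Shrinking the interval and changing the representative. -/

section Congruence

variable {a : Coeffs} {ν T T' : ℝ} {u₀ : 𝓢'(R3, C3)} {u v : ℝ → 𝓢'(R3, C3)}

theorem MemLpChi.congr {p : ℝ≥0∞} {i : ℤ} (hu : MemLpChi p i T u) (h : EqOn u v (Icc 0 T)) :
    MemLpChi p i T v := by
  obtain ⟨w, hw, hwu⟩ := hu
  refine ⟨w, hw, ?_⟩
  filter_upwards [hwu, ae_restrict_mem measurableSet_Icc] with t h1 h2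
  rw [h1, h h2]

theorem MemLpChi.mono {p : ℝ≥0∞} {i : ℤ} (hu : MemLpChi p i T' u) (hT : T ≤ T') :
    MemLpChi p i T u := by
  obtain ⟨w, hw, hwu⟩ := hu
  have hle := Measure.restrict_mono_set (volume : Measure ℝ)
    (Icc_subset_Icc_right hT : Icc (0 : ℝ) T ⊆ Icc 0 T')
  exact ⟨w, hw.mono_measure hle, ae_mono hle hwu⟩

theorem IsMildSolution.mono (hu : IsMildSolution a ν u₀ T' u) (hT : T ≤ T') :
    IsMildSolution a ν u₀ T u :=
  ⟨hu.memLp.mono hT, ae_mono (Measure.restrict_mono_set _ (Icc_subset_Icc_right hT)) hu.duhamel⟩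

theorem IsMildSolution.congr (hu : IsMildSolution a ν u₀ T u) (h : EqOn u v (Icc 0 T)) :
    IsMildSolution a ν u₀ T v := by
  refine ⟨hu.memLp.congr h, ?_⟩
  filter_upwards [hu.duhamel, ae_restrict_mem measurableSet_Icc] with t h1 h2 φ j
  have hQ : EqOn (fun s => heat (ν * (t - s)) (Q a j (u s) (u s)) φ)
      (fun s => heat (ν * (t - s)) (Q a j (v s) (v s)) φ) (uIcc 0 t) := fun s hs => by
    rw [uIcc_of_le h2.1] at hs
    simp only [h (⟨hs.1, hs.2.trans h2.2⟩ : s ∈ Icc 0 T)]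
  rw [← h h2, h1 φ j, intervalIntegral.integral_congr hQ]

theorem IsRegularSolution.congr (hT : 0 ≤ T) (hu : IsRegularSolution a ν u₀ T u)
    (h : EqOn u v (Icc 0 T)) : IsRegularSolution a ν u₀ T v := by
  refine ⟨hu.mild.congr h, ?_, ?_, hu.memL1.congr h, hu.memLinfty.congr h⟩
  · rw [← h ⟨le_rfl, hT⟩, hu.initial]
  · obtain ⟨w, hw, hwu⟩ := hu.continuous
    exact ⟨w, hw, fun t ht => (hwu t ht).trans (h ht)⟩

end Congruence

/-! ### The maximal solution, small data and blow-up. -/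

section Maximal

variable {ν : ℝ} (hν : 0 < ν) {a : Coeffs} {f₀ : FL} {U U' : Lp FL 2 (volume : Measure ℝ)}
  {T T' : ℝ} {u v : ℝ → 𝓢'(R3, C3)}

theorem ofReal_le_lifespan (hT : 0 < T)
    (hU : (heatKernel hν).IsSol (qL a) (linearPart hν f₀) T U) :
    ENNReal.ofReal T ≤ lifespan a ν (iota 1 f₀) :=
  le_iSup₂_of_le T ⟨hT, _, isRegularSolution_of_isSol hν hU⟩ le_rfl

theorem exists_isSol_of_lt_lifespan (hT : 0 ≤ T)
    (h : ENNReal.ofReal T < lifespan a ν (iota 1 f₀)) :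
    ∃ T' > T, ∃ U, (heatKernel hν).IsSol (qL a) (linearPart hν f₀) T' U := by
  simp only [lifespan, lt_iSup_iff] at h
  obtain ⟨T', ⟨-, u, hu⟩, hlt⟩ := h
  obtain ⟨U, hU, -⟩ := exists_isSol_of_mild hν hu.mild.memLp hu.mild.duhamel
  exact ⟨T', (ENNReal.ofReal_lt_ofReal_iff_of_nonneg hT).1 hlt, U, hU⟩

theorem lifespan_pos (hν : 0 < ν) (a : Coeffs) (f₀ : FL) : 0 < lifespan a ν (iota 1 f₀) := by
  obtain ⟨T, hT, U, hU⟩ := (SmoothingKernel.isSol_zero (K := heatKernel hν) (q := qL a)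
    (g := linearPart hν f₀)).extend le_rfl
  exact (ENNReal.ofReal_pos.2 hT).trans_le (ofReal_le_lifespan hν hT hU)

theorem IsMildSolution.ae_eq_state (hT : 0 ≤ T) (hv : IsMildSolution a ν (iota 1 f₀) T v)
    (hU : (heatKernel hν).IsSol (qL a) (linearPart hν f₀) T U) :
    v =ᵐ[volume.restrict (Icc 0 T)] fun t => iota 1 (state a f₀ U ν t) := by
  obtain ⟨V, hV, hvV⟩ := exists_isSol_of_mild hν hv.memLp hv.duhamel
  obtain rfl := SmoothingKernel.IsSol.unique hT hV hU
  filter_upwards [hvV, ae_restrict_Ioc (iota_eq_of_isSol f₀ hν hU)] with t h1 h2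
  rw [h1, h2]

/-- Solutions on two time intervals agree where both are defined. -/
theorem state_eqOn (hT : 0 < T) (hTT : T ≤ T')
    (hU : (heatKernel hν).IsSol (qL a) (linearPart hν f₀) T U)
    (hU' : (heatKernel hν).IsSol (qL a) (linearPart hν f₀) T' U') :
    EqOn (state a f₀ U ν) (state a f₀ U' ν) (Icc 0 T) := by
  have h := ((isRegularSolution_of_isSol hν hU').mild.mono hTT).ae_eq_state hν hT.le hU
  refine Measure.eqOn_Icc_of_ae_eq volume hT.ne ?_ (continuous_state a f₀ U hν).continuousOn
    (continuous_state a f₀ U' hν).continuousOn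
  filter_upwards [h] with t ht
  exact (iota_injective le_rfl ht).symm

/-- Solutions on different intervals are glued by `state_eqOn`. The half-open interval forces `0 <
T`, as needed there, and `u` is defined without reference to the lifespan. -/
theorem exists_maximal (a : Coeffs) (f₀ : FL) : ∃ u : ℝ → 𝓢'(R3, C3),
    ∀ T U, (heatKernel hν).IsSol (qL a) (linearPart hν f₀) T U →
      ∀ t ∈ Ico 0 T, u t = iota 1 (state a f₀ U ν t) := by
  have key : ∀ t : ℝ, ∃ w : 𝓢'(R3, C3), ∀ T U,
      (heatKernel hν).IsSol (qL a) (linearPart hν f₀) T U →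
      t ∈ Ico 0 T → w = iota 1 (state a f₀ U ν t) := by
    intro t
    by_cases h : ∃ T U, (heatKernel hν).IsSol (qL a) (linearPart hν f₀) T U ∧ t ∈ Ico 0 T
    · obtain ⟨T, U, hU, ht⟩ := h
      refine ⟨iota 1 (state a f₀ U ν t), fun T' U' hU' ht' => ?_⟩
      congr 1
      rcases le_total T T' with hle | hle
      · exact state_eqOn hν (ht.1.trans_lt ht.2) hle hU hU' (Ico_subset_Icc_self ht)
      · exact (state_eqOn hν (ht'.1.trans_lt ht'.2) hle hU' hU (Ico_subset_Icc_self ht')).symm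
    · exact ⟨0, fun T U hU ht => absurd ⟨T, U, hU, ht⟩ h⟩
  choose u hu using key
  exact ⟨u, fun T U hU t ht => hu t T U hU ht⟩

/-- Since `κ² = 1/(8π²ν)`, the quantity `4κ‖q‖ · κ‖f₀‖` is at most `‖q‖ / (2(‖q‖ + 1)) < 1`; the
viscosity cancels. -/
theorem lifespan_eq_top_of_small (hν : 0 < ν) (h : ‖f₀‖ ≤ Real.pi ^ 2 / (‖qL a‖ + 1) * ν) :
    lifespan a ν (iota 1 f₀) = ∞ := by
  have hb : ((heatKernel hν).bound : ℝ) ^ 2 = 1 / (8 * Real.pi ^ 2 * ν) := by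
    have : ((heatKernel hν).bound : ℝ) = √(1 / (8 * Real.pi ^ 2 * ν)) :=
      Real.coe_toNNReal _ (Real.sqrt_nonneg _)
    rw [this, Real.sq_sqrt (by positivity)]
  have hsmall : 4 * ((heatKernel hν).bound * ‖qL a‖) * ‖linearPart hν f₀‖ < 1 := by
    calc 4 * ((heatKernel hν).bound * ‖qL a‖) * ‖linearPart hν f₀‖
        ≤ 4 * ((heatKernel hν).bound * ‖qL a‖) *
          ((heatKernel hν).bound * (Real.pi ^ 2 / (‖qL a‖ + 1) * ν)) := by
          gcongr
          exact (norm_linearPart_le hν f₀).trans (by gcongr)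
      _ = 4 * ((heatKernel hν).bound : ℝ) ^ 2 * (Real.pi ^ 2 * ν) * (‖qL a‖ / (‖qL a‖ + 1)) := by
          ring
      _ = 1 / 2 * (‖qL a‖ / (‖qL a‖ + 1)) := by
          rw [hb]
          field_simp
          ring
      _ < 1 := by
          have : ‖qL a‖ / (‖qL a‖ + 1) ≤ 1 := div_le_one_of_le₀ (by linarith) (by positivity)
          linarith
  refine ENNReal.eq_top_of_forall_nnreal_le fun r => ?_
  obtain ⟨U, hU⟩ := SmoothingKernel.exists_isSol_of_small hsmall (r + 1 : ℝ)
  refine le_trans ?_ (ofReal_le_lifespan hν (by positivity) hU)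
  rw [← ENNReal.ofReal_coe_nnreal]
  exact ENNReal.ofReal_le_ofReal (by linarith)

/-- `hu` says nothing at the endpoint of an interval, so a solution on a longer interval is taken
and restricted to `[0,T]`. -/
theorem isRegularSolution_of_lt_lifespan
    (hu : ∀ T U, (heatKernel hν).IsSol (qL a) (linearPart hν f₀) T U →
      ∀ t ∈ Ico 0 T, u t = iota 1 (state a f₀ U ν t))
    (hT : 0 < T) (h : ENNReal.ofReal T < lifespan a ν (iota 1 f₀)) :
    IsRegularSolution a ν (iota 1 f₀) T u := by
  obtain ⟨T', hTT, U, hU⟩ := exists_isSol_of_lt_lifespan hν hT.le h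
  have hr := hU.restrict hTT.le
  refine (isRegularSolution_of_isSol hν hr).congr hT.le fun t ht => ?_
  rw [hu T' U hU t ⟨ht.1, ht.2.trans_lt hTT⟩, state_eqOn hν hT hTT.le hr hU ht]

theorem restrict_Ico_eq_restrict_Icc (T : ℝ) :
    (volume : Measure ℝ).restrict (Ico 0 T) = volume.restrict (Icc 0 T) :=
  Measure.restrict_congr_set Ico_ae_eq_Icc

theorem IsMildSolution.ae_eq_maximal
    (hu : ∀ T U, (heatKernel hν).IsSol (qL a) (linearPart hν f₀) T U →
      ∀ t ∈ Ico 0 T, u t = iota 1 (state a f₀ U ν t))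
    (hT : 0 ≤ T) (hv : IsMildSolution a ν (iota 1 f₀) T v) :
    v =ᵐ[volume.restrict (Icc 0 T)] u := by
  obtain ⟨U, hU, -⟩ := exists_isSol_of_mild hν hv.memLp hv.duhamel
  rw [← restrict_Ico_eq_restrict_Icc]
  have h := hv.ae_eq_state hν hT hU
  rw [← restrict_Ico_eq_restrict_Icc] at h
  filter_upwards [h, ae_restrict_mem measurableSet_Ico] with t h1 h2
  rw [h1, hu T U hU t h2]

/-- Measurability on `[0,S)` follows from countably many smaller intervals, and the norm is finite
by `hfin`. -/
theorem memLpChi_two_of_forall_lt {S : ℝ} (h : ∀ T, 0 < T → T < S → MemLpChi 2 0 T u)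
    (hfin : ∫⁻ t in Ico 0 S, chiENorm 0 (u t) ^ 2 ≠ ∞) : MemLpChi 2 0 S u := by
  have hlt : ∀ᵐ t ∂volume.restrict (Ico 0 S), chiENorm 0 (u t) < ∞ :=
    ae_of_forall_lt fun T h0 hS => (h T h0 hS).chiENorm_lt_top
  have hm : AEStronglyMeasurable (fun t => toFL 0 (u t)) (volume.restrict (Ico 0 S)) := by
    obtain ⟨r, -, hr, hrS⟩ := exists_seq_strictMono_tendsto S
    have hcov : Ico 0 S ⊆ ⋃ n, Icc 0 (r n) := fun t ht => by
      obtain ⟨n, hn⟩ := (hrS.eventually (lt_mem_nhds ht.2)).exists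
      exact mem_iUnion.2 ⟨n, ht.1, hn.le⟩
    refine AEStronglyMeasurable.mono_set hcov (AEStronglyMeasurable.iUnion fun n => ?_)
    rcases lt_or_ge 0 (r n) with hn | hn
    · exact (h (r n) hn (hr n)).memLp_toFL.1
    · have : (volume : Measure ℝ).restrict (Icc 0 (r n)) = 0 := by
        rw [Measure.restrict_eq_zero, Real.volume_Icc, ENNReal.ofReal_eq_zero]
        linarith
      rw [this]
      exact aestronglyMeasurable_zero_measure _
  rw [restrict_Ico_eq_restrict_Icc] at hlt hm hfin
  refine memLpChi_of_toFL ⟨hm, ?_⟩ hlt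
  rw [eLpNorm_lt_top_iff_lintegral_rpow_enorm_lt_top two_ne_zero ENNReal.ofNat_ne_top]
  refine lt_of_eq_of_lt (lintegral_congr_ae ?_) hfin.lt_top
  filter_upwards [hlt] with t ht
  rw [enorm_toFL ht]
  simp

/-- With a finite integral, `u` is a mild solution on the closed interval `[0,S]`, since the
endpoint is a null set. `IsSol.extend` then contradicts the maximality of `S`. -/
theorem lintegral_maximal_eq_top
    (hu : ∀ T U, (heatKernel hν).IsSol (qL a) (linearPart hν f₀) T U →
      ∀ t ∈ Ico 0 T, u t = iota 1 (state a f₀ U ν t))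
    (hS : lifespan a ν (iota 1 f₀) < ∞) :
    ∫⁻ t in Ico 0 (lifespan a ν (iota 1 f₀)).toReal, chiENorm 0 (u t) ^ 2 = ∞ := by
  by_contra hfin
  set S := (lifespan a ν (iota 1 f₀)).toReal with hSdef
  have hofReal : ENNReal.ofReal S = lifespan a ν (iota 1 f₀) := ENNReal.ofReal_toReal hS.ne
  have hS0 : 0 ≤ S := ENNReal.toReal_nonneg
  have hreg : ∀ T, 0 < T → T < S → IsRegularSolution a ν (iota 1 f₀) T u := fun T h0 hT =>
    isRegularSolution_of_lt_lifespan hν hu h0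
      (hofReal ▸ (ENNReal.ofReal_lt_ofReal_iff_of_nonneg h0.le).2 hT)
  have hmem := memLpChi_two_of_forall_lt (fun T h0 hT => (hreg T h0 hT).mild.memLp) hfin
  have hduh := ae_of_forall_lt fun T h0 hT => (hreg T h0 hT).mild.duhamel
  rw [restrict_Ico_eq_restrict_Icc] at hduh
  obtain ⟨U, hU, -⟩ := exists_isSol_of_mild hν hmem hduh
  obtain ⟨T', hT', U', hU'⟩ := hU.extend hS0
  have hle := ofReal_le_lifespan hν (hS0.trans_lt hT') hU'
  rw [← hofReal, ENNReal.ofReal_le_ofReal_iff hS0] at hle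
  exact hT'.not_ge hle

end Maximal

end GNS

end

/-! ### Conclusion. -/

theorem theorem1p1 (a : GNS.Coeffs) :
    ∃ C : ℝ, 0 < C ∧ ∀ (ν : ℝ), 0 < ν → ∀ u₀ : GNS.Chi GNS.C3 (-1),
      -- local existence and uniqueness
      (∃ T : ℝ, 0 < T ∧ ∃ u, GNS.IsRegularSolution a ν u₀.toDist T u ∧
        ∀ v, GNS.IsMildSolution a ν u₀.toDist T v → v =ᵐ[volume.restrict (Icc 0 T)] u) ∧
      -- smallness implies global existence
      (‖u₀‖ ≤ C * ν → GNS.lifespan a ν u₀.toDist = ∞) ∧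
      -- the maximal solution
      ∃ u : ℝ → 𝓢'(GNS.R3, GNS.C3),
        (∀ T : ℝ, 0 < T → ENNReal.ofReal T < GNS.lifespan a ν u₀.toDist →
          GNS.IsRegularSolution a ν u₀.toDist T u) ∧
        -- uniqueness on every time interval
        (∀ T : ℝ, 0 < T → ∀ v, GNS.IsMildSolution a ν u₀.toDist T v →
          v =ᵐ[volume.restrict (Icc 0 T)] u) ∧
        -- real data have real solutions
        (GNS.IsRealField u₀.toDist → ∀ t : ℝ, 0 ≤ t →
          ENNReal.ofReal t < GNS.lifespan a ν u₀.toDist → GNS.IsRealField (u t)) ∧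
        -- blow-up criterion
        (GNS.lifespan a ν u₀.toDist < ∞ →
          ∫⁻ t in Ico 0 (GNS.lifespan a ν u₀.toDist).toReal, GNS.chiENorm 0 (u t) ^ 2 = ∞) := by
  -- The constant involves only `‖qL a‖`, and `qL` contains neither the viscosity nor the data.
  refine ⟨Real.pi ^ 2 / (‖GNS.qL a‖ + 1), by positivity, fun ν hν u₀ => ?_⟩
  have hnorm : ‖GNS.toFL (-1) u₀.toDist‖ = ‖u₀‖ := by
    rw [← toReal_enorm, GNS.enorm_toFL u₀.chiENorm_lt_top]
    rfl
  have hiota := GNS.iota_toFL le_rfl (by norm_num) u₀.chiENorm_lt_top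
  -- From here on the data are `iota 1 f₀` with `f₀` arbitrary in `L¹`, of norm `‖u₀‖`.
  generalize GNS.toFL (-1) u₀.toDist = f₀ at hnorm hiota
  rw [← hiota, ← hnorm]
  obtain ⟨u, hu⟩ := GNS.exists_maximal hν a f₀
  have hreg := fun T => GNS.isRegularSolution_of_lt_lifespan (T := T) hν hu
  have huniq := fun T (hT : 0 < T) v (hv : GNS.IsMildSolution a ν (GNS.iota 1 f₀) T v) =>
    hv.ae_eq_maximal hν hu hT.le
  refine ⟨?_, GNS.lifespan_eq_top_of_small hν, u, hreg, huniq, fun hreal t ht hlt => ?_,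
    GNS.lintegral_maximal_eq_top hν hu⟩
  · obtain ⟨T, hT0, hT⟩ := ENNReal.lt_iff_exists_real_btwn.1
      (GNS.lifespan_pos hν a f₀)
    have hT' : 0 < T := ENNReal.ofReal_pos.1 hT.1
    exact ⟨T, hT', u, hreg T hT' hT.2, huniq T hT'⟩
  · obtain ⟨T, hT, U, hU⟩ := GNS.exists_isSol_of_lt_lifespan hν ht hlt
    rw [hu T U hU t ⟨ht, hT⟩]
    exact GNS.isRealField_of_conjL_eq (GNS.conjL_state_eq hν (ht.trans hT.le) hU
      (GNS.conjL_eq_of_isRealField hreal) t)
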